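/- **Setting.** Let $\Gamma\subset\mathbb{R}^k$ be a compact smooth embedded submanifold without boundary, of dimension $d$ and codimension $c=k-d$. Let $\rho=\operatorname{dist}(\cdot,\Gamma)$, and let $\delta_0>0$ be such that every point of $U_{\delta_0}(\Gamma)=\{\rho<\delta_0\}$ has a unique closest point $p(x)$ on $\Gamma$. Let $P_\Gamma(q)$ be the orthogonal projection onto $T_q\Gamma$, and fix constants $\sigma,\kappa>0$. For $h>0$, let $\widetilde{\mathcal T}_h$ be a finite conforming mesh of closed $k$-simplices of (the closure of) a bounded open set $\Omega\supset U_{\delta_0}(\Gamma)$ such that every $T\in\widetilde{\mathcal T}_h$ has diameter at most $\sigma h$ and contains a ball of radius $h/\sigma$. Let $\mathcal K_h$ be a finite conforming mesh, without boundary, of non-degenerate closed $d$-simplices, and put $\Gamma_h=\bigcup_{K\in\mathcal K_h}K$. Let $P_{\Gamma_h}$ be the orthogonal projection of $\mathbb R^k$ onto the direction of the affine span of $K$, on each $K\in\mathcal K_h$, and let $Q_{\Gamma_h}=I-P_{\Gamma_h}$. Assume that each $K$ is contained in some $T\in\widetilde{\mathcal T}_h$, that $\Gamma_h\subset U_{\delta_0}(\Gamma)$,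 that $p:\Gamma_h\to\Gamma$ is a bijection, and that $$\|\rho\|_{L^\infty(\Gamma_h)}\le\kappa h^2,\qquad \|P_\Gamma\circ p-P_{\Gamma_h}\|_{L^\infty(\Gamma_h)}\le\kappa h .$$ Let $\mathcal T_h=\{T\in\widetilde{\mathcal T}_h: T\cap\Gamma_h\ne\emptyset\}$ be the active mesh, $N_h=\bigcup_{T\in\mathcal T_h}T$, and $$V_h=\{v\in C(N_h): v|_T\in P_1(T)\ \ \forall\, T\in\mathcal T_h\}.$$ For $v\in V_h$ put $\|v\|_{\mathcal T_h}^2=\sum_{T\in\mathcal T_h}\int_T v^2$, let $\|\cdot\|_{\Gamma_h}$ be the $L^2$ norm with respect to $d$-dimensional surface measure on $\Gamma_h$, let $\nabla_{\Gamma_h}v=P_{\Gamma_h}\nabla v$, and let $\lambda_{\Gamma_h}(v)=|\Gamma_h|^{-1}\int_{\Gamma_h}v$ be the average of $v$. For $\alpha\in[0,2]$ let $$s_h^3(v,w)=h^{\alpha-c}\sum_{T\in\mathcal T_h}\int_T Q_{\Gamma_h}^e\nabla v\cdot Q_{\Gamma_h}^e\nabla w\,dx,$$ where $Q_{\Gamma_h}^e(x)=Q_{\Gamma_h}(y)$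 for the point $y\in\Gamma_h$ with $p(y)=p(x)$ (defined for almost every $x$ near $\Gamma$). **Proposition.** There are $h_0>0$ and $C>0$, depending only on $\Gamma,\delta_0,\sigma,\kappa$, such that for all $0<h\le h_0$, all $\alpha\in[0,2]$, all $\Omega$, $\widetilde{\mathcal T}_h$ and $\mathcal K_h$ as above, and all $v\in V_h$, $$h^{-c}\|v\|_{\mathcal T_h}^2\le C\bigl(\|v\|_{\Gamma_h}^2+s_h^3(v,v)\bigr),$$ and, if $\Gamma$ is connected, also $$h^{-c}\|v-\lambda_{\Gamma_h}(v)\|_{\mathcal T_h}^2\le C\bigl(\|\nabla_{\Gamma_h}v\|_{\Gamma_h}^2+s_h^3(v,v)\bigr).$$ -/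

import Mathlib

open Set MeasureTheory
open scoped ContDiff

noncomputable section

/-- Euclidean space `ℝᵏ`. -/
abbrev Euc (k : ℕ) : Type := EuclideanSpace ℝ (Fin k)

section Manifold

/-- `Γ ⊆ ℝᵈ⁺ᶜ` is a smooth embedded submanifold of dimension `d` and codimension `c`, without
boundary: near each of its points there is a smooth slice chart, that is, a `C^∞` diffeomorphism
between open sets of `ℝᵈ⁺ᶜ` and `ℝᵈ × ℝᶜ` that carries `Γ` to `ℝᵈ × {0}`. -/
def IsSmoothSubmanifold (d c : ℕ) (Γ : Set (Euc (d + c))) : Prop :=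
  ∀ x ∈ Γ, ∃ φ : OpenPartialHomeomorph (Euc (d + c)) (Euc d × Euc c),
    x ∈ φ.source ∧ ContDiffOn ℝ ∞ φ φ.source ∧ ContDiffOn ℝ ∞ φ.symm φ.target ∧
      ∀ y ∈ φ.source, y ∈ Γ ↔ (φ y).2 = 0

variable {k : ℕ}

/-- The tangent space `T_q Γ`, as a linear subspace of `ℝᵏ`. -/
def tangentSpaceAt (Γ : Set (Euc k)) (q : Euc k) : Submodule ℝ (Euc k) :=
  Submodule.span ℝ (tangentConeAt ℝ Γ q)

/-- The tangential projection `P_Γ(q)`: orthogonal projection of `ℝᵏ` onto `T_q Γ`. -/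
def tangentialProj (Γ : Set (Euc k)) (q : Euc k) : Euc k →L[ℝ] Euc k :=
  (tangentSpaceAt Γ q).starProjection

/-- `q` is a closest point to `x` on `Γ`. -/
def IsClosestPoint (Γ : Set (Euc k)) (x q : Euc k) : Prop :=
  q ∈ Γ ∧ dist x q = Metric.infDist x Γ

/-- `δ₀` is an admissible radius of a tubular neighbourhood `U_{δ₀}(Γ) = {x : dist(x, Γ) < δ₀}`:
each point of it has exactly one closest point on `Γ`. -/
def IsTubularRadius (Γ : Set (Euc k)) (δ₀ : ℝ) : Prop :=
  0 < δ₀ ∧ ∀ x ∈ Metric.thickening δ₀ Γ, ∃! q, IsClosestPoint Γ x q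

/-- The closest point projection `p` (used only on a tubular neighbourhood of `Γ`). -/
def closestPoint (Γ : Set (Euc k)) (x : Euc k) : Euc k :=
  Classical.epsilon (IsClosestPoint Γ x)

end Manifold

section Mesh

variable {k : ℕ}

/-- The closed simplex with vertex set `s`. -/
def simplex (s : Finset (Euc k)) : Set (Euc k) := convexHull ℝ (s : Set (Euc k))

/-- The domain covered by a mesh. -/
def carrier (𝒮 : Finset (Finset (Euc k))) : Set (Euc k) := ⋃ s ∈ 𝒮, simplex s

/-- A finite conforming mesh of non-degenerate closed `n`-simplices of `ℝᵏ`, each given by its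
vertex set: two simplices meet at most in the common face spanned by their common vertices. -/
structure IsConformingMesh (n : ℕ) (𝒮 : Finset (Finset (Euc k))) : Prop where
  card_eq : ∀ s ∈ 𝒮, s.card = n + 1
  affineIndependent : ∀ s ∈ 𝒮, AffineIndependent ℝ ((↑) : s → Euc k)
  inter_eq : ∀ s ∈ 𝒮, ∀ t ∈ 𝒮,
    simplex s ∩ simplex t = convexHull ℝ ((s : Set (Euc k)) ∩ (t : Set (Euc k)))

/-- The mesh has no boundary: each facet of a simplex (obtained by removing one vertex) belongs
to exactly two simplices. -/
def HasNoBoundary (𝒮 : Finset (Finset (Euc k))) : Prop :=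
  ∀ s ∈ 𝒮, ∀ x ∈ s, ((s : Set (Euc k)) \ {x}).Nonempty →
    {t | t ∈ 𝒮 ∧ (s : Set (Euc k)) \ {x} ⊆ (t : Set (Euc k))}.ncard = 2

/-- A shape regular, quasi-uniform simplicial mesh of `Ω ⊆ ℝᵏ` with mesh parameter `h`: each
simplex has diameter at most `σ h` and contains a ball of radius `h / σ`. -/
structure IsBackgroundMesh (σ h : ℝ) (Ω : Set (Euc k)) (𝒯 : Finset (Finset (Euc k))) : Prop where
  conforming : IsConformingMesh k 𝒯
  carrier_eq : carrier 𝒯 = closure Ω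
  diam_le : ∀ T ∈ 𝒯, Metric.diam (simplex T) ≤ σ * h
  ball_subset : ∀ T ∈ 𝒯, ∃ x, Metric.closedBall x (h / σ) ⊆ simplex T

open Classical in
/-- The active mesh `𝒯_h`: the elements of the background mesh that meet `Γ_h`. -/
def activeMesh (𝒯 : Finset (Finset (Euc k))) (Γh : Set (Euc k)) : Finset (Finset (Euc k)) :=
  𝒯.filter fun T => (simplex T ∩ Γh).Nonempty

/-- The finite element space `V_h` on an (active) mesh: functions that are continuous on the
domain `N_h` covered by the mesh and affine on each element. Values outside `N_h` are ignored. -/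
def IsP1Function (𝒮 : Finset (Finset (Euc k))) (v : Euc k → ℝ) : Prop :=
  ContinuousOn v (carrier 𝒮) ∧
    ∀ T ∈ 𝒮, ∃ a : Euc k →ᵃ[ℝ] ℝ, ∀ x ∈ simplex T, v x = a x

/-- The integral over a mesh, `∑ₛ ∫ₛ f(s, x) dμ(x)`, of an integrand given simplex by simplex. -/
def meshIntegral (μ : Measure (Euc k)) (𝒮 : Finset (Finset (Euc k)))
    (f : Finset (Euc k) → Euc k → ℝ) : ℝ :=
  ∑ s ∈ 𝒮, ∫ x in simplex s, f s x ∂μ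

/-- The squared `L²` norm over a mesh. -/
def meshNormSq (μ : Measure (Euc k)) (𝒮 : Finset (Finset (Euc k))) (v : Euc k → ℝ) : ℝ :=
  meshIntegral μ 𝒮 fun _ x => v x ^ 2

end Mesh

section DiscreteManifold

variable {k : ℕ}

/-- The value on the simplex `K` of the discrete tangential projection `P_{Γ_h}`: orthogonal
projection onto the direction of the affine span of `K`. -/
def discreteTangentialProj (K : Finset (Euc k)) : Euc k →L[ℝ] Euc k :=
  (vectorSpan ℝ (K : Set (Euc k))).starProjection

/-- The value on the simplex `K` of the discrete normal projection `Q_{Γ_h} = I - P_{Γ_h}`. -/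
def discreteNormalProj (K : Finset (Euc k)) : Euc k →L[ℝ] Euc k :=
  ContinuousLinearMap.id ℝ (Euc k) - discreteTangentialProj K

open Classical in
/-- The simplices `K` of the mesh of `Γ_h` that contain a point with the same closest point on
`Γ` as `x`; for `x` near `Γ` this is a single simplex, except for `x` in a null set. -/
def simplicesOver (Γ : Set (Euc k)) (𝒦 : Finset (Finset (Euc k))) (x : Euc k) :
    Finset (Finset (Euc k)) :=
  𝒦.filter fun K => closestPoint Γ x ∈ closestPoint Γ '' simplex K

open Classical in
/-- The extension `Q_{Γ_h}^e` of the piecewise constant field `Q_{Γ_h}` from `Γ_h` to a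
neighbourhood of `Γ`: `Q_{Γ_h}^e(x) = Q_{Γ_h}(y)` where `y ∈ Γ_h` has `p(y) = p(x)`. On the null
set where `y` lies in several simplices, one of them is chosen. -/
def discreteNormalProjExt (Γ : Set (Euc k)) (𝒦 : Finset (Finset (Euc k))) (x : Euc k) :
    Euc k →L[ℝ] Euc k :=
  if hx : (simplicesOver Γ 𝒦 x).Nonempty then discreteNormalProj hx.choose else 0

/-- The triangulation `𝒦` of the discrete manifold `Γ_h = carrier 𝒦` is admissible for the
`d`-dimensional manifold `Γ` and the background mesh `𝒯`, with constant `κ` in the geometry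
approximation estimates. -/
structure IsDiscreteManifold (d : ℕ) (Γ : Set (Euc k)) (δ₀ κ h : ℝ)
    (𝒯 𝒦 : Finset (Finset (Euc k))) : Prop where
  conforming : IsConformingMesh d 𝒦
  noBoundary : HasNoBoundary 𝒦
  /-- Each simplex of `Γ_h` lies in one element of the background mesh. -/
  compatible : ∀ K ∈ 𝒦, ∃ T ∈ 𝒯, simplex K ⊆ simplex T
  subset_tube : carrier 𝒦 ⊆ Metric.thickening δ₀ Γ
  bijOn : BijOn (closestPoint Γ) (carrier 𝒦) Γ
  /-- `‖ρ‖_{L^∞(Γ_h)} ≤ κ h²`. -/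
  dist_le : ∀ y ∈ carrier 𝒦, Metric.infDist y Γ ≤ κ * h ^ 2
  /-- `‖P_Γ^e - P_{Γ_h}‖_{L^∞(Γ_h)} ≤ κ h`. -/
  proj_le : ∀ K ∈ 𝒦, ∀ y ∈ simplex K,
    ‖tangentialProj Γ (closestPoint Γ y) - discreteTangentialProj K‖ ≤ κ * h

/-- The average `λ_{Γ_h}(v)` of `v` over the `d`-dimensional discrete manifold `Γ_h`. -/
def surfaceAverage (d : ℕ) (𝒦 : Finset (Finset (Euc k))) (v : Euc k → ℝ) : ℝ :=
  meshIntegral μHE[d] 𝒦 (fun _ => v) / meshIntegral μHE[d] 𝒦 (fun _ _ => 1)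

/-- `‖∇_{Γ_h} v‖²_{Γ_h}`, where `∇_{Γ_h} v = P_{Γ_h} ∇v` on each simplex `K`. All derivatives of
`v` within `K` (such as `∇(v|_T)` for an element `T ⊇ K`) have the same projection to the
direction of `K`, so that it does not matter which one `gradientWithin` returns. -/
def surfaceGradNormSq (d : ℕ) (𝒦 : Finset (Finset (Euc k))) (v : Euc k → ℝ) : ℝ :=
  meshIntegral μHE[d] 𝒦 fun K x =>
    ‖discreteTangentialProj K (gradientWithin v (simplex K) x)‖ ^ 2

/-- The normal gradient stabilization
`s_h³(v, w) = h^{α - c} ∑_{T ∈ 𝒯_h} ∫_T ⟨Q_{Γ_h}^e ∇v, Q_{Γ_h}^e ∇w⟩`, on the active mesh `𝒯h`. -/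
def normalGradStab (c : ℕ) (Γ : Set (Euc k)) (α h : ℝ) (𝒯h 𝒦 : Finset (Finset (Euc k)))
    (v w : Euc k → ℝ) : ℝ :=
  h ^ (α - c) * meshIntegral volume 𝒯h fun T x =>
    inner ℝ (discreteNormalProjExt Γ 𝒦 x (gradientWithin v (simplex T) x))
      (discreteNormalProjExt Γ 𝒦 x (gradientWithin w (simplex T) x))

end DiscreteManifold

end

/-! ### Maps that are close to the identity. -/

section NearIdentity

/-! Let `b T` be the gradient of `v` on an active element `T`. The stabilization controls the
component of `b T` normal to `Γ`: near `T` the projection `Q_{Γ_h}^e` differs by `O(h)` from the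
normal projection at one nearby point of `Γ`, and the inverse estimate turns the error `h ‖b T‖`
into an `L²` norm of `v`, which ends up with a factor `h²` and is absorbed for small `h`. It remains
to bound `v` and its tangential gradient on `T` by the values of `v` on `Γ_h` near `T`. At scale `h`
the set `Γ_h` is a graph of small slope over a tangent space of `Γ`, but it may meet `T` in a single
point, so information has to be carried to `T` from other elements.

If `T` and `T'` share a face, then `b T - b T'` is orthogonal to that face. If every vector
orthogonal to the face has a substantial component normal to `Γ` (`IsGoodFace`), then the smallness
of the normal parts of both gradients makes `b T - b T'` small, and the two affine pieces nearly
agree. The bad faces are those whose projection to the tangent space lies near a hyperplane.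
`exists_isRounding` moves the projected vertices slightly so that nearly degenerate families become
exactly degenerate; by compactness, the chambers cut out by the resulting hyperplanes have an
inradius bounded from below. Interpolation of the moved vertices maps the graph, after a tiny shift,
to `ℝᵈ` by a map close to the identity, and the part of the graph over one chamber meets only good
faces. Hence `exists_chain` links `T` through good faces to all elements met by a patch of definite
size. On part of such a patch an affine function with nearly tangential gradient is large compared
with its gradient (`exists_subball_le_affine`), which gives `exists_local_estimate`. Summation with
bounded overlap gives `exists_mesh_estimate`, and the powers of `h` fit because `h ^ (2 - c) ≤ h ^
(α - c)`.

For the second inequality the same estimate is applied to `v - λ`, which has the gradients of `v`.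
What is left is a Poincaré inequality on `Γ_h` with a uniform constant (`exists_poincare`): a fixed
finite family of balls covers `Γ`, the part of `Γ_h` over each ball lies in a Lipschitz graph,
integration along segments gives the inequality on each graph, and connectedness of `Γ` compares the
constants through overlaps. -/

theorem norm_sub_le_two_mul_of_near_identity {E : Type*} [NormedAddCommGroup E] {f : E → E} {u v : E}
    (hf : ‖f u - f v - (u - v)‖ ≤ 1 / 2 * ‖u - v‖) : ‖u - v‖ ≤ 2 * ‖f u - f v‖ := by
  have h1 : ‖u - v‖ ≤ ‖f u - f v‖ + ‖f u - f v - (u - v)‖ := by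
    have := norm_sub_le (f u - f v) (f u - f v - (u - v))
    rwa [sub_sub_cancel] at this
  linarith

/-- A perturbation of the identity with Lipschitz constant 1/2 maps the ball of radius `r` onto at
least the ball of radius `(1 - 1/2) r` about `f b`, as in the inverse function theorem. -/
theorem exists_eq_of_near_identity {E : Type*} [NormedAddCommGroup E] [NormedSpace ℝ E]
    [CompleteSpace E] {f : E → E} {b : E} {r : ℝ} (hr : 0 ≤ r)
    (hf : ∀ u ∈ Metric.closedBall b r, ∀ v ∈ Metric.closedBall b r,
      ‖f u - f v - (u - v)‖ ≤ 1 / 2 * ‖u - v‖)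
    {y : E} (hy : ‖y - f b‖ ≤ r / 2) :
    ∃ u ∈ Metric.closedBall b r, f u = y ∧ ‖u - b‖ ≤ 2 * ‖y - f b‖ := by
  have hA : ApproximatesLinearOn f (ContinuousLinearMap.id ℝ E) (Metric.closedBall b r)
      (1 / 2 : NNReal) := by
    intro u hu v hv
    simpa using hf u hu v hv
  let g : (ContinuousLinearMap.id ℝ E).NonlinearRightInverse :=
    { toFun := id, nnnorm := 1, bound' := by simp, right_inv' := by simp }
  have hs := hA.surjOn_closedBall_of_nonlinearRightInverse g hr subset_rfl
  have hc : (((g.nnnorm : NNReal) : ℝ)⁻¹ - ((1 / 2 : NNReal) : ℝ)) * r = r / 2 := by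
    have : (g.nnnorm : ℝ) = 1 := rfl
    rw [this]; push_cast; ring
  rw [hc] at hs
  obtain ⟨u, hu, rfl⟩ := hs (show y ∈ Metric.closedBall (f b) (r / 2) by
    rwa [mem_closedBall_iff_norm])
  exact ⟨u, hu, rfl, norm_sub_le_two_mul_of_near_identity
    (hf u hu b (Metric.mem_closedBall_self hr))⟩

end NearIdentity

/-! ### Functions that are Lipschitz on the members of a finite cover. -/

section Piecewise

/-- A function on `[0, 1]` that is `L`-Lipschitz on each member of a finite closed cover is
`L`-Lipschitz. -/
theorem norm_sub_le_of_finite_closed_cover {F ι : Type*} [SeminormedAddCommGroup F] [Finite ι]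
    {f : ℝ → F} {L : ℝ} {S : ι → Set ℝ} (hS : ∀ i, IsClosed (S i)) (hcov : Icc 0 1 ⊆ ⋃ i, S i)
    (hf : ∀ i, ∀ s ∈ S i ∩ Icc 0 1, ∀ t ∈ S i ∩ Icc 0 1, ‖f s - f t‖ ≤ L * |s - t|) :
    ‖f 1 - f 0‖ ≤ L := by
  -- Continuous induction: the supremum of `A` lies in `A`, and it cannot be smaller than 1.
  set A : Set ℝ := {t | t ∈ Icc (0 : ℝ) 1 ∧ ‖f t - f 0‖ ≤ L * t} with hA
  have h0 : (0 : ℝ) ∈ A := ⟨by simp, by simp⟩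
  have hbdd : BddAbove A := ⟨1, fun t ht => ht.1.2⟩
  set s := sSup A with hs
  have hs0 : 0 ≤ s := le_csSup hbdd h0
  have hs1 : s ≤ 1 := csSup_le ⟨0, h0⟩ fun t ht => ht.1.2
  have hsI : s ∈ Icc (0 : ℝ) 1 := ⟨hs0, hs1⟩
  -- Since the cover is finite and closed, a limit point of `B` shares a member of the cover with
  -- some point of `B`. This replaces continuity of `f`, which is not assumed.
  have key : ∀ B : Set ℝ, B ⊆ Icc 0 1 → s ∈ closure B →
      ∃ i, ∃ t ∈ B, t ∈ S i ∧ s ∈ S i := by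
    intro B hB hsB
    have h1 : B ⊆ ⋃ i, (B ∩ S i) := fun t ht => by
      obtain ⟨i, hi⟩ := mem_iUnion.1 (hcov (hB ht))
      exact mem_iUnion.2 ⟨i, ht, hi⟩
    have h2 := closure_mono h1 hsB
    rw [closure_iUnion_of_finite] at h2
    obtain ⟨i, hi⟩ := mem_iUnion.1 h2
    obtain ⟨t, ht⟩ := closure_nonempty_iff.1 ⟨s, hi⟩
    exact ⟨i, t, ht.1, ht.2, (hS i).closure_subset_iff.2 inter_subset_right hi⟩
  have hsA : s ∈ A := by
    obtain ⟨i, t, htA, hti, hsi⟩ := key A (fun t ht => ht.1) (csSup_mem_closure ⟨0, h0⟩ hbdd)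
    have hts : t ≤ s := le_csSup hbdd htA
    refine ⟨hsI, ?_⟩
    have h1 := hf i s ⟨hsi, hsI⟩ t ⟨hti, htA.1⟩
    rw [abs_of_nonneg (by linarith)] at h1
    have h2 := norm_sub_le_norm_sub_add_norm_sub (f s) (f t) (f 0)
    have h3 := htA.2
    linarith
  rcases hs1.lt_or_eq with hlt | heq
  · exfalso
    obtain ⟨i, t, htB, hti, hsi⟩ := key (Ioc s 1) (fun t ht => ⟨hs0.trans ht.1.le, ht.2⟩) (by
      rw [closure_Ioc hlt.ne]; exact ⟨le_rfl, hs1⟩)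
    have htI : t ∈ Icc (0 : ℝ) 1 := ⟨hs0.trans htB.1.le, htB.2⟩
    have h1 := hf i t ⟨hti, htI⟩ s ⟨hsi, hsI⟩
    rw [abs_of_nonneg (by linarith [htB.1])] at h1
    have h2 := norm_sub_le_norm_sub_add_norm_sub (f t) (f s) (f 0)
    have h3 := hsA.2
    have : t ∈ A := ⟨htI, by linarith⟩
    exact absurd (le_csSup hbdd this) (not_le.2 htB.1)
  · have := hsA.2
    rw [heq] at this
    linarith

/-- Restriction to a segment reduces this to the interval. It extends slope bounds known element by
element to a whole parameter ball. -/
theorem norm_sub_le_of_finite_closed_cover_convex {E F ι : Type*} [NormedAddCommGroup E]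
    [NormedSpace ℝ E] [SeminormedAddCommGroup F] [Finite ι] {f : E → F} {L : ℝ} {B : Set E}
    (hB : Convex ℝ B) {S : ι → Set E} (hS : ∀ i, IsClosed (S i)) (hcov : B ⊆ ⋃ i, S i)
    (hf : ∀ i, ∀ u ∈ S i ∩ B, ∀ v ∈ S i ∩ B, ‖f u - f v‖ ≤ L * ‖u - v‖) :
    ∀ u ∈ B, ∀ v ∈ B, ‖f u - f v‖ ≤ L * ‖u - v‖ := by
  intro u hu v hv
  let γ : ℝ → E := fun t => AffineMap.lineMap v u t
  have hγ : Continuous γ := AffineMap.lineMap_continuous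
  have hγB : ∀ t ∈ Icc (0 : ℝ) 1, γ t ∈ B := fun t ht => hB.lineMap_mem hv hu ht
  have hdist : ∀ s t, ‖γ s - γ t‖ = |s - t| * ‖u - v‖ := by
    intro s t
    have := dist_lineMap_lineMap v u s t
    rw [dist_eq_norm, Real.dist_eq, dist_eq_norm, norm_sub_rev v u] at this
    exact this
  have := norm_sub_le_of_finite_closed_cover (f := f ∘ γ) (L := L * ‖u - v‖)
    (S := fun i => γ ⁻¹' S i) (fun i => (hS i).preimage hγ)
    (fun t ht => by simpa using hcov (hγB t ht)) (by
      rintro i s ⟨hs, hsI⟩ t ⟨ht, htI⟩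
      have := hf i (γ s) ⟨hs, hγB s hsI⟩ (γ t) ⟨ht, hγB t htI⟩
      rw [hdist] at this
      simp only [Function.comp]
      linarith)
  simpa [γ] using this

/-- A continuous function on `[0, 1]` that is `c i`-Lipschitz on the set `S i` of a finite
measurable cover satisfies `|f 1 - f 0|² ≤ ∑ c i ² |S i|`. -/
theorem sq_sub_le_sum_of_finite_cover {n : ℕ} {f : ℝ → ℝ} (hfc : ContinuousOn f (Icc 0 1))
    {c : Fin n → ℝ} (hc : ∀ i, 0 ≤ c i) {S : Fin n → Set ℝ} (hS : ∀ i, MeasurableSet (S i))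
    (hcov : Icc 0 1 ⊆ ⋃ i, S i)
    (hf : ∀ i, ∀ s ∈ S i ∩ Icc 0 1, ∀ t ∈ S i ∩ Icc 0 1, |f s - f t| ≤ c i * |s - t|) :
    (f 1 - f 0) ^ 2 ≤ ∑ i, c i ^ 2 * (volume (S i ∩ Icc 0 1)).toReal := by
  have hfin : ∀ A : Set ℝ, volume (A ∩ Icc 0 1) ≠ ⊤ := fun A =>
    ((measure_mono inter_subset_right).trans_lt (by simp)).ne
  -- A disjoint refinement, so that the lengths add up to exactly 1 in the Cauchy–Schwarz inequality
  -- below.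
  let D : Fin n → Set ℝ := fun i => disjointed S i ∩ Icc 0 1
  have hDS : ∀ i, D i ⊆ S i ∩ Icc 0 1 := fun i =>
    inter_subset_inter_left _ (disjointed_subset S i)
  have hDm : ∀ i, MeasurableSet (D i) := fun i =>
    (disjointedRec (fun _ _ ht => ht.diff (hS _)) (hS i)).inter measurableSet_Icc
  have hDdisj : Pairwise (Function.onFun Disjoint D) := fun i j hij =>
    (disjoint_disjointed S hij).mono inter_subset_left inter_subset_left
  have hDU : ⋃ i, D i = Icc 0 1 := by
    rw [← iUnion_inter, iUnion_disjointed]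
    exact inter_eq_self_of_subset_right hcov
  have hsum : ∑ i, (volume (D i)).toReal = 1 := by
    rw [← ENNReal.toReal_sum fun i _ => hfin _, ← tsum_fintype (L := .unconditional _), ← measure_iUnion hDdisj hDm,
      hDU]
    simp
  have himg : ∀ i, volume (f '' D i) ≤ ENNReal.ofReal (c i) * volume (D i) := by
    intro i
    have hL : LipschitzOnWith (Real.toNNReal (c i)) f (D i) := by
      refine LipschitzOnWith.of_dist_le_mul fun s hs t ht => ?_
      rw [Real.dist_eq, Real.dist_eq, Real.coe_toNNReal _ (hc i)]
      exact hf i s (hDS i hs) t (hDS i ht)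
    have := hL.hausdorffMeasure_image_le (d := 1) zero_le_one
    rw [hausdorffMeasure_real] at this
    simpa [ENNReal.ofReal] using this
  have hle : |f 1 - f 0| ≤ ∑ i, c i * (volume (D i)).toReal := by
    -- By the intermediate value theorem the images of the pieces cover the interval between `f 0`
    -- and `f 1`, so no fundamental theorem of calculus is needed.
    have h1 : uIcc (f 0) (f 1) ⊆ ⋃ i, f '' D i := by
      rw [← image_iUnion, hDU]
      have := intermediate_value_uIcc (a := (0 : ℝ)) (b := 1) (f := f) (by simpa using hfc)
      simpa using this
    have h2 : volume (uIcc (f 0) (f 1)) ≤ ∑ i, ENNReal.ofReal (c i) * volume (D i) :=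
      (measure_mono h1).trans ((measure_iUnion_fintype_le _ _).trans
        (Finset.sum_le_sum fun i _ => himg i))
    rw [Real.volume_interval] at h2
    have h3 := ENNReal.toReal_mono (by
      refine (ENNReal.sum_lt_top.2 fun i _ => ?_).ne
      exact ENNReal.mul_lt_top ENNReal.ofReal_lt_top (hfin _).lt_top) h2
    rw [ENNReal.toReal_ofReal (abs_nonneg _), ENNReal.toReal_sum (fun i _ =>
      (ENNReal.mul_lt_top ENNReal.ofReal_lt_top (hfin _).lt_top).ne)] at h3
    refine h3.trans (le_of_eq (Finset.sum_congr rfl fun i _ => ?_))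
    rw [ENNReal.toReal_mul, ENNReal.toReal_ofReal (hc i)]
  have hcs : (∑ i, c i * (volume (D i)).toReal) ^ 2 ≤
      (∑ i, c i ^ 2 * (volume (D i)).toReal) * ∑ i, (volume (D i)).toReal := by
    refine Finset.sum_sq_le_sum_mul_sum_of_sq_le_mul _ (fun i _ => by positivity)
      (fun i _ => by positivity) fun i _ => le_of_eq (by ring)
  rw [hsum, mul_one] at hcs
  calc (f 1 - f 0) ^ 2 = |f 1 - f 0| ^ 2 := (sq_abs _).symm
    _ ≤ _ := pow_le_pow_left₀ (abs_nonneg _) hle 2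
    _ ≤ _ := hcs
    _ ≤ _ := Finset.sum_le_sum fun i _ => mul_le_mul_of_nonneg_left
      (ENNReal.toReal_mono (hfin _) (measure_mono (hDS i))) (sq_nonneg _)

end Piecewise

/-! ### Simplices, and adjacency of elements along a connected set. -/

section Simplices

variable {k : ℕ}

theorem isCompact_simplex (s : Finset (Euc k)) : IsCompact (simplex s) :=
  s.finite_toSet.isCompact_convexHull ℝ

theorem isClosed_simplex (s : Finset (Euc k)) : IsClosed (simplex s) :=
  (isCompact_simplex s).isClosed

theorem convex_simplex (s : Finset (Euc k)) : Convex ℝ (simplex s) := convex_convexHull ℝ _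

theorem isCompact_carrier (𝒮 : Finset (Finset (Euc k))) : IsCompact (carrier 𝒮) :=
  𝒮.isCompact_biUnion fun s _ => isCompact_simplex s

theorem affineSpan_eq_top_of_mesh {𝒮 : Finset (Finset (Euc k))} (h : IsConformingMesh k 𝒮)
    {T : Finset (Euc k)} (hT : T ∈ 𝒮) : affineSpan ℝ (T : Set (Euc k)) = ⊤ := by
  have h1 := (h.affineIndependent T hT).affineSpan_eq_top_iff_card_eq_finrank_add_one.2 (by
    simpa using h.card_eq T hT)
  simpa using h1

theorem interior_simplex_nonempty {𝒮 : Finset (Finset (Euc k))} (h : IsConformingMesh k 𝒮)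
    {T : Finset (Euc k)} (hT : T ∈ 𝒮) : (interior (simplex T)).Nonempty :=
  interior_convexHull_nonempty_iff_affineSpan_eq_top.2 (affineSpan_eq_top_of_mesh h hT)

theorem closure_interior_simplex {𝒮 : Finset (Finset (Euc k))} (h : IsConformingMesh k 𝒮)
    {T : Finset (Euc k)} (hT : T ∈ 𝒮) : closure (interior (simplex T)) = simplex T := by
  rw [(convex_simplex T).closure_interior_eq_closure_of_nonempty_interior
    (interior_simplex_nonempty h hT), (isClosed_simplex T).closure_eq]

theorem card_inter_le_of_ne {n : ℕ} {𝒮 : Finset (Finset (Euc k))} (h : IsConformingMesh n 𝒮)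
    [DecidableEq (Euc k)] {T₁ T₂ : Finset (Euc k)} (h₁ : T₁ ∈ 𝒮) (h₂ : T₂ ∈ 𝒮) (hne : T₁ ≠ T₂) :
    (T₁ ∩ T₂).card ≤ n := by
  by_contra hc
  have e1 : T₁ ∩ T₂ = T₁ := Finset.eq_of_subset_of_card_le Finset.inter_subset_left (by
    rw [h.card_eq T₁ h₁]; omega)
  have e2 : T₁ ∩ T₂ = T₂ := Finset.eq_of_subset_of_card_le Finset.inter_subset_right (by
    rw [h.card_eq T₂ h₂]; omega)
  exact hne (e1.symm.trans e2)

theorem eventually_mem_imp_mem {𝒜 : Finset (Finset (Euc k))} (D : Finset (Euc k) → Set (Euc k))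
    (hD : ∀ T, IsClosed (D T)) (y : Euc k) :
    ∀ᶠ z in nhds y, ∀ T ∈ 𝒜, z ∈ D T → y ∈ D T := by
  rw [Filter.eventually_all_finset]
  intro T _
  by_cases hy : y ∈ D T
  · exact Filter.Eventually.of_forall fun z _ => hy
  · filter_upwards [(hD T).isOpen_compl.mem_nhds hy] with z hz h using absurd h hz

/-- Two elements are adjacent when their common face satisfies `good`. -/
def FaceAdj (𝒜 : Finset (Finset (Euc k))) (good : Set (Euc k) → Prop) (T₁ T₂ : Finset (Euc k)) :
    Prop :=
  T₁ ∈ 𝒜 ∧ T₂ ∈ 𝒜 ∧ ((T₁ : Set (Euc k)) ∩ T₂).Nonempty ∧ good ((T₁ : Set (Euc k)) ∩ T₂)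

/-- Elements that contain a point close to `x` contain `x` itself, since there are finitely many of
them and they are closed. They are therefore pairwise adjacent at `x`, and induction over the
connected set `D` joins these local links into a chain. -/
theorem reflTransGen_faceAdj_of_isPreconnected {𝒜 : Finset (Finset (Euc k))}
    {good : Set (Euc k) → Prop} {D : Set (Euc k)} (hD : IsPreconnected D)
    (hcov : ∀ y ∈ D, ∃ T ∈ 𝒜, y ∈ simplex T)
    (hloc : ∀ y ∈ D, ∀ T ∈ 𝒜, ∀ T' ∈ 𝒜, y ∈ simplex T → y ∈ simplex T' → FaceAdj 𝒜 good T T')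
    {y y' : Euc k} (hy : y ∈ D) (hy' : y' ∈ D) {T T' : Finset (Euc k)} (hT : T ∈ 𝒜)
    (hT' : T' ∈ 𝒜) (hyT : y ∈ simplex T) (hyT' : y' ∈ simplex T') :
    Relation.ReflTransGen (FaceAdj 𝒜 good) T T' := by
  refine hD.induction₂' (fun y y' => ∀ T ∈ 𝒜, ∀ T' ∈ 𝒜, y ∈ simplex T → y' ∈ simplex T' →
    Relation.ReflTransGen (FaceAdj 𝒜 good) T T') ?_ ?_ hy hy' T hT T' hT' hyT hyT'
  · intro x hx
    filter_upwards [mem_nhdsWithin_of_mem_nhds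
      (eventually_mem_imp_mem (𝒜 := 𝒜) simplex isClosed_simplex x)] with z hz
    exact ⟨fun T hT T' hT' h h' => .single (hloc x hx T hT T' hT' h (hz T' hT' h')),
      fun T hT T' hT' h h' => .single (hloc x hx T hT T' hT' (hz T hT h) h')⟩
  · intro a b c _ hb _ hab hbc T hT T' hT' h h'
    obtain ⟨S, hS, hbS⟩ := hcov b hb
    exact (hab T hT S hS h hbS).trans (hbc S hS T' hT' hbS h')

end Simplices

/-! ### Rounding of finite point configurations to exactly degenerate ones. -/

section Rounding

variable {V : Type*} [NormedAddCommGroup V] [InnerProductSpace ℝ V] [FiniteDimensional ℝ V]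

omit [FiniteDimensional ℝ V] in
/-- The chambers of a finite hyperplane arrangement that meet a ball have a positive minimal
inradius there. -/
theorem exists_inradius_chambers {J : Type*} [Finite J] (ξ : J → V) (s : J → ℝ) (r : ℝ) :
    ∃ ρ > 0, ∀ u₀ ∈ Metric.ball (0 : V) r, (∀ j, inner ℝ (ξ j) u₀ ≠ s j) →
      ∃ C : Set V, Convex ℝ C ∧ u₀ ∈ C ∧ C ⊆ Metric.ball 0 r ∧
        (∀ u ∈ C, ∀ j, inner ℝ (ξ j) u ≠ s j) ∧ ∃ y, Metric.closedBall y ρ ⊆ C := by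
  let C : Set J → Set V := fun P => Metric.ball 0 r ∩
    ((⋂ j ∈ P, {u | s j < inner ℝ (ξ j) u}) ∩ ⋂ j ∈ Pᶜ, {u | inner ℝ (ξ j) u < s j})
  have hlin : ∀ j, IsLinearMap ℝ fun u : V => inner ℝ (ξ j) u := fun j =>
    ⟨fun x y => inner_add_right _ _ _, fun c x => by simp [inner_smul_right]⟩
  have hopen : ∀ P, IsOpen (C P) := by
    intro P
    refine Metric.isOpen_ball.inter (IsOpen.inter ?_ ?_)
    · exact P.toFinite.isOpen_biInter fun j _ => isOpen_lt continuous_const (by fun_prop)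
    · exact Pᶜ.toFinite.isOpen_biInter fun j _ => isOpen_lt (by fun_prop) continuous_const
  have hconv : ∀ P, Convex ℝ (C P) := by
    intro P
    refine (convex_ball _ _).inter (Convex.inter ?_ ?_)
    · exact convex_iInter₂ fun j _ => convex_halfSpace_gt (hlin j) _
    · exact convex_iInter₂ fun j _ => convex_halfSpace_lt (hlin j) _
  -- There are finitely many sign patterns `P`. Each nonempty open cell contains some closed ball,
  -- and the minimum of the radii over all patterns is the uniform inradius.
  have hρ : ∀ P, ∃ ρ > 0, (C P).Nonempty → ∃ y, Metric.closedBall y ρ ⊆ C P := by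
    intro P
    by_cases hne : (C P).Nonempty
    · obtain ⟨y, hy⟩ := hne
      obtain ⟨ε, hε, h⟩ := Metric.nhds_basis_closedBall.mem_iff.1 ((hopen P).mem_nhds hy)
      exact ⟨ε, hε, fun _ => ⟨y, h⟩⟩
    · exact ⟨1, one_pos, fun h => absurd h hne⟩
  choose ρ hρ0 hρ using hρ
  obtain ⟨P₀, hP₀⟩ := Finite.exists_min ρ
  refine ⟨ρ P₀, hρ0 _, fun u₀ hu₀ hne => ?_⟩
  set P : Set J := {j | s j < inner ℝ (ξ j) u₀} with hP
  have hmem : u₀ ∈ C P := by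
    refine ⟨hu₀, ?_, ?_⟩
    · simp only [mem_iInter]
      exact fun j hj => hj
    · simp only [mem_iInter]
      exact fun j hj => lt_of_le_of_ne (not_lt.1 (show ¬ s j < inner ℝ (ξ j) u₀ from hj)) (hne j)
  refine ⟨C P, hconv P, hmem, inter_subset_left, fun u hu j => ?_, ?_⟩
  · by_cases hj : j ∈ P
    · exact (mem_iInter₂.1 hu.2.1 j hj).ne'
    · exact (mem_iInter₂.1 hu.2.2 j hj).ne
  · obtain ⟨y, hy⟩ := hρ P ⟨u₀, hmem⟩
    exact ⟨y, (Metric.closedBall_subset_closedBall (hP₀ P)).trans hy⟩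

/-- The points `ζ i`, `i ∈ F`, lie `η`-close to a hyperplane. -/
def NearHyperplane {ι : Type*} (η : ℝ) (ζ : ι → V) (F : Set ι) : Prop :=
  ∃ ξ : V, ‖ξ‖ = 1 ∧ ∀ i ∈ F, ∀ j ∈ F, |inner ℝ ξ (ζ i - ζ j)| ≤ η

/-- `(w, H)` is a rounding of the points `ζ`: points `w` close to `ζ` and a set `H` that contains
the convex hulls of all families that are nearly contained in a hyperplane, such that the
components of the complement of `H` in a ball are not too small. -/
def IsRounding {ι : Type*} (r τ η ρ : ℝ) (S : Set ι) (ζ w : ι → V) (H : Set V) : Prop :=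
  (∀ i ∈ S, ‖w i - ζ i‖ ≤ τ) ∧ Dense Hᶜ ∧
    (∀ F ⊆ S, NearHyperplane η ζ F → convexHull ℝ (w '' F) ⊆ H) ∧
    ∀ u₀ ∈ Metric.ball (0 : V) r, u₀ ∉ H → ∃ C : Set V, Convex ℝ C ∧ u₀ ∈ C ∧
      C ⊆ Metric.ball 0 r ∧ Disjoint C H ∧ ∃ y, Metric.closedBall y ρ ⊆ C

/-- Configurations `ζ` near `w` are rounded to `w` itself. A family not exactly contained in a
hyperplane for `w` is not nearly contained in one for `ζ` close to `w`, so `H` needs one hyperplane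
only for each family that is exactly degenerate for `w`. -/
theorem exists_isRounding_nhds {N : ℕ} (r : ℝ) {τ : ℝ} (hτ : 0 < τ) (w : Fin N → V) :
    ∃ η > 0, ∃ ρ > 0, ∃ H : Set V, ∀ ζ ∈ Metric.ball w η, IsRounding r τ η ρ univ ζ w H := by
  classical
  let J := {F : Set (Fin N) // NearHyperplane 0 w F}
  have hJ : ∀ F : J, ∃ ξ : V, ‖ξ‖ = 1 ∧ ∃ s : ℝ, ∀ i ∈ F.1, inner ℝ ξ (w i) = s := by
    rintro ⟨F, ξ, hξ, h⟩
    refine ⟨ξ, hξ, ?_⟩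
    rcases F.eq_empty_or_nonempty with rfl | ⟨j, hj⟩
    · exact ⟨0, by simp⟩
    · refine ⟨inner ℝ ξ (w j), fun i hi => ?_⟩
      have := abs_nonpos_iff.1 (h i hi j hj)
      rw [inner_sub_right] at this
      linarith
  choose ξ hξ s hs using hJ
  obtain ⟨ρ, hρ, hch⟩ := exists_inradius_chambers ξ s r
  let H : Set V := ⋃ F : J, {u | inner ℝ (ξ F) u = s F}
  have hbad : ∀ F : Set (Fin N), ∃ η > 0, ∀ ζ ∈ Metric.ball w η, NearHyperplane η ζ F →
      NearHyperplane 0 w F := by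
    intro F
    by_cases hF : NearHyperplane 0 w F
    · exact ⟨1, one_pos, fun _ _ _ => hF⟩
    -- The spread of the family in direction `ξ`. For a nondegenerate family it is positive on the
    -- unit sphere, hence bounded below there by some `m > 0`.
    let f : V → ℝ := fun ξ => ∑ i, ∑ j, if i ∈ F ∧ j ∈ F then |inner ℝ ξ (w i - w j)| else 0
    have hfc : Continuous f := by
      refine continuous_finsetSum _ fun i _ => continuous_finsetSum _ fun j _ => ?_
      split_ifs
      · fun_prop
      · exact continuous_const
    have hterm : ∀ ξ i j, 0 ≤ (if i ∈ F ∧ j ∈ F then |inner ℝ ξ (w i - w j)| else 0) := by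
      intro ξ i j
      split_ifs
      · exact abs_nonneg _
      · exact le_rfl
    have hpos : ∀ ξ ∈ Metric.sphere (0 : V) 1, 0 < f ξ := by
      intro ξ hξ
      rw [mem_sphere_zero_iff_norm] at hξ
      by_contra hle
      refine hF ⟨ξ, hξ, fun i hi j hj => ?_⟩
      have h1 := Finset.single_le_sum (f := fun i => ∑ j, if i ∈ F ∧ j ∈ F then
        |inner ℝ ξ (w i - w j)| else 0) (fun i _ => Finset.sum_nonneg fun j _ => hterm ξ i j)
        (Finset.mem_univ i)
      have h2 := Finset.single_le_sum (f := fun j => if i ∈ F ∧ j ∈ F then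
        |inner ℝ ξ (w i - w j)| else 0) (fun j _ => hterm ξ i j) (Finset.mem_univ j)
      beta_reduce at h2
      rw [if_pos (⟨hi, hj⟩ : i ∈ F ∧ j ∈ F)] at h2
      have h3 := not_lt.1 hle
      simp only [f] at h3
      linarith
    obtain ⟨m, hm, hfm⟩ := (isCompact_sphere (0 : V) 1).exists_forall_le' hfc.continuousOn hpos
    -- If `ζ` is `η`-close to `w` and `η`-near a hyperplane, then each of the at most `N ^ 2` terms
    -- of the spread is at most `3 η`, so `m ≤ 3 N ^ 2 η`; this value of `η` excludes that.
    let η : ℝ := m / (3 * N ^ 2 + 1) / 2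
    have hη : 0 < η := by positivity
    refine ⟨η, hη, fun ζ hζ ⟨ξ, hξ, h⟩ => ?_⟩
    exfalso
    have hζ' : ∀ i, ‖w i - ζ i‖ ≤ η := fun i => by
      have := (dist_le_pi_dist ζ w i).trans (Metric.mem_ball.1 hζ).le
      rwa [dist_eq_norm, norm_sub_rev] at this
    have h1 : f ξ ≤ ∑ i : Fin N, ∑ j : Fin N, 3 * η := by
      refine Finset.sum_le_sum fun i _ => Finset.sum_le_sum fun j _ => ?_
      split_ifs with hij
      · have e : w i - w j = (ζ i - ζ j) + ((w i - ζ i) - (w j - ζ j)) := by abel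
        rw [e, inner_add_right, inner_sub_right ξ (w i - ζ i)]
        have b1 := h i hij.1 j hij.2
        have b2 := abs_real_inner_le_norm ξ (w i - ζ i)
        have b3 := abs_real_inner_le_norm ξ (w j - ζ j)
        rw [hξ, one_mul] at b2 b3
        have b4 := abs_add_le (inner ℝ ξ (ζ i - ζ j))
          (inner ℝ ξ (w i - ζ i) - inner ℝ ξ (w j - ζ j))
        have b5 := abs_sub (inner ℝ ξ (w i - ζ i)) (inner ℝ ξ (w j - ζ j))
        linarith [hζ' i, hζ' j]
      · positivity
    have h2 := hfm ξ (by simpa using hξ)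
    simp only [Finset.sum_const, Finset.card_univ, Fintype.card_fin, nsmul_eq_mul] at h1
    have h3 : η * (3 * N ^ 2 + 1) = m / 2 := by
      simp only [η]; field_simp
    nlinarith
  choose ηF hηF0 hηF using hbad
  obtain ⟨F₀, hF₀⟩ := Finite.exists_min ηF
  refine ⟨min τ (ηF F₀), lt_min hτ (hηF0 _), ρ, hρ, H, fun ζ hζ => ⟨?_, ?_, ?_, ?_⟩⟩
  · intro i _
    have := (dist_le_pi_dist ζ w i).trans (Metric.mem_ball.1 hζ).le
    rw [dist_eq_norm, norm_sub_rev] at this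
    exact this.trans (min_le_left _ _)
  · have : Hᶜ = ⋂ F : J, {u | inner ℝ (ξ F) u ≠ s F} := by
      simp only [H, compl_iUnion]; rfl
    rw [this]
    refine dense_iInter_of_isOpen (fun F => isOpen_ne_fun (by fun_prop) continuous_const)
      fun F => ?_
    rw [Metric.dense_iff]
    intro u ε hε
    by_cases hu : inner ℝ (ξ F) u = s F
    · refine ⟨u + (ε / 2) • ξ F, ?_, ?_⟩
      · rw [mem_ball_iff_norm, add_sub_cancel_left, norm_smul, hξ, mul_one, Real.norm_eq_abs,
          abs_of_pos (by linarith)]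
        linarith
      · simp only [mem_ofPred_eq, inner_add_right, inner_smul_right, hu, real_inner_self_eq_norm_sq,
          hξ]
        intro h
        linarith
    · exact ⟨u, Metric.mem_ball_self hε, hu⟩
  · intro F _ hF
    obtain ⟨ξ', hξ', h'⟩ := hF
    have hη : min τ (ηF F₀) ≤ ηF F := (min_le_right _ _).trans (hF₀ F)
    have hb := hηF F ζ (Metric.ball_subset_ball hη hζ)
      ⟨ξ', hξ', fun i hi j hj => (h' i hi j hj).trans hη⟩
    have hsub : convexHull ℝ (w '' F) ⊆ {u | inner ℝ (ξ ⟨F, hb⟩) u = s ⟨F, hb⟩} := by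
      refine convexHull_min ?_ ?_
      · rintro _ ⟨i, hi, rfl⟩
        exact hs ⟨F, hb⟩ i hi
      · exact convex_hyperplane
          ⟨fun x y => inner_add_right _ _ _, fun c x => by simp [inner_smul_right]⟩ _
    exact hsub.trans (subset_iUnion (fun F : J => {u | inner ℝ (ξ F) u = s F}) ⟨F, hb⟩)
  · intro u₀ hu₀ hH
    obtain ⟨C, h1, h2, h3, h4, h5⟩ := hch u₀ hu₀ fun F h => hH (mem_iUnion.2 ⟨F, h⟩)
    refine ⟨C, h1, h2, h3, ?_, h5⟩
    rw [Set.disjoint_left]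
    intro u hu hu'
    obtain ⟨F, hF⟩ := mem_iUnion.1 hu'
    exact h4 u hu F hF

omit [FiniteDimensional ℝ V] in
theorem IsRounding.mono {ι : Type*} {r τ η ρ η' ρ' : ℝ} {S : Set ι} {ζ w : ι → V} {H : Set V}
    (h : IsRounding r τ η ρ S ζ w H) (hη : η' ≤ η) (hρ : ρ' ≤ ρ) :
    IsRounding r τ η' ρ' S ζ w H := by
  obtain ⟨h1, h2, h3, h4⟩ := h
  refine ⟨h1, h2, fun F hF ⟨ξ, hξ, hb⟩ =>
    h3 F hF ⟨ξ, hξ, fun i hi j hj => (hb i hi j hj).trans hη⟩, fun u hu huH => ?_⟩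
  obtain ⟨C, c1, c2, c3, c4, y, hy⟩ := h4 u hu huH
  exact ⟨C, c1, c2, c3, c4, y, (Metric.closedBall_subset_closedBall hρ).trans hy⟩

/-- Bounded configurations form a relatively compact set, so finitely many of the neighbourhoods
from `exists_isRounding_nhds` suffice, and `η`, `ρ` can be taken as minima. -/
theorem exists_isRounding_fin (N : ℕ) (R r : ℝ) {τ : ℝ} (hτ : 0 < τ) :
    ∃ η > 0, ∃ ρ > 0, ∀ ζ : Fin N → V, (∀ i, ‖ζ i‖ ≤ R) →
      ∃ w H, IsRounding r τ η ρ univ ζ w H := by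
  classical
  choose η hη ρ hρ H h using exists_isRounding_nhds (V := V) (N := N) r hτ
  have hK : IsCompact (Metric.closedBall (0 : Fin N → V) (max R 0)) := isCompact_closedBall _ _
  obtain ⟨t, -, ht⟩ := hK.elim_nhds_subcover (fun w => Metric.ball w (η w))
    fun w _ => Metric.ball_mem_nhds w (hη w)
  have hmin : ∀ f : (Fin N → V) → ℝ, (∀ w, 0 < f w) → ∃ m > 0, ∀ w ∈ t, m ≤ f w := by
    intro f hf
    rcases t.eq_empty_or_nonempty with rfl | hne
    · exact ⟨1, one_pos, by simp⟩
    · obtain ⟨w, hw, hm⟩ := t.exists_min_image f hne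
      exact ⟨f w, hf w, hm⟩
  obtain ⟨η₀, hη₀, hη₁⟩ := hmin η hη
  obtain ⟨ρ₀, hρ₀, hρ₁⟩ := hmin ρ hρ
  refine ⟨η₀, hη₀, ρ₀, hρ₀, fun ζ hζ => ?_⟩
  have hmem : ζ ∈ Metric.closedBall (0 : Fin N → V) (max R 0) := by
    rw [mem_closedBall_zero_iff, pi_norm_le_iff_of_nonneg (le_max_right _ _)]
    exact fun i => (hζ i).trans (le_max_left _ _)
  obtain ⟨w, hw, hζw⟩ := mem_iUnion₂.1 (ht hmem)
  exact ⟨w, H w, (h w ζ hζw).mono (hη₁ w hw) (hρ₁ w hw)⟩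

/-- The points are numbered, and unused indices are filled with the point 0, which changes neither
the bound nor the families inside `S`. -/
theorem exists_isRounding {α : Type*} (N : ℕ) (R r : ℝ) {τ : ℝ} (hτ : 0 < τ) :
    ∃ η > 0, ∃ ρ > 0, ∀ (S : Finset α), S.card ≤ N → ∀ ζ : α → V, (∀ a ∈ S, ‖ζ a‖ ≤ R) →
      ∃ w H, IsRounding r τ η ρ (S : Set α) ζ w H := by
  classical
  obtain ⟨η, hη, ρ, hρ, h⟩ := exists_isRounding_fin (V := V) N (max R 0) r hτ
  refine ⟨η, hη, ρ, hρ, fun S hS ζ hζ => ?_⟩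
  let σ : S → Fin N := fun a => Fin.castLE hS (S.equivFin a)
  have hσ : Function.Injective σ := (Fin.castLE_injective hS).comp S.equivFin.injective
  let ζ' : Fin N → V := Function.extend σ (fun a => ζ a) 0
  have hζ'σ : ∀ a, ζ' (σ a) = ζ a := fun a => hσ.extend_apply _ _ a
  have hζ' : ∀ i, ‖ζ' i‖ ≤ max R 0 := by
    intro i
    by_cases hi : ∃ a, σ a = i
    · obtain ⟨a, rfl⟩ := hi
      rw [hζ'σ]
      exact (hζ a a.2).trans (le_max_left _ _)
    · simp only [ζ']
      rw [Function.extend_apply' _ _ _ hi]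
      simp
  obtain ⟨w, H, h1, h2, h3, h4⟩ := h ζ' hζ'
  refine ⟨fun a => if ha : a ∈ S then w (σ ⟨a, ha⟩) else 0, H, fun a ha => ?_, h2, ?_, h4⟩
  · have ha' : a ∈ S := ha
    have := h1 (σ ⟨a, ha'⟩) (mem_univ _)
    rw [hζ'σ] at this
    simpa [ha'] using this
  · rintro F hF ⟨ξ, hξ, hb⟩
    have := h3 (σ '' {a | (a : α) ∈ F}) (subset_univ _) ⟨ξ, hξ, by
      rintro _ ⟨a, ha, rfl⟩ _ ⟨b, hb', rfl⟩
      rw [hζ'σ, hζ'σ]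
      exact hb a ha b hb'⟩
    refine (convexHull_mono ?_).trans this
    rintro _ ⟨a, ha, rfl⟩
    have ha' : a ∈ S := hF ha
    exact ⟨σ ⟨a, ha'⟩, ⟨⟨a, ha'⟩, ha, rfl⟩, by simp [ha']⟩

end Rounding

/-! ### Coordinates in the tangent space and good faces. -/

section Adjoint

variable {d k : ℕ}

/-- Coordinates with respect to an isometric embedding: the adjoint of the embedding. -/
noncomputable def coordMap (A : Euc d →ₗᵢ[ℝ] Euc k) : Euc k →L[ℝ] Euc d :=
  ContinuousLinearMap.adjoint A.toContinuousLinearMap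

theorem inner_coordMap (A : Euc d →ₗᵢ[ℝ] Euc k) (u : Euc d) (x : Euc k) :
    inner ℝ u (coordMap A x) = inner ℝ (A u) x :=
  ContinuousLinearMap.adjoint_inner_right _ _ _

theorem coordMap_inner (A : Euc d →ₗᵢ[ℝ] Euc k) (u : Euc d) (x : Euc k) :
    inner ℝ (coordMap A x) u = inner ℝ x (A u) :=
  ContinuousLinearMap.adjoint_inner_left _ _ _

theorem coordMap_apply_self (A : Euc d →ₗᵢ[ℝ] Euc k) (u : Euc d) : coordMap A (A u) = u := by
  refine ext_inner_left ℝ fun v => ?_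
  rw [inner_coordMap, A.inner_map_map]

theorem norm_coordMap_le (A : Euc d →ₗᵢ[ℝ] Euc k) (x : Euc k) : ‖coordMap A x‖ ≤ ‖x‖ := by
  have h := ContinuousLinearMap.le_opNorm (coordMap A) x
  have h2 : ‖coordMap A‖ ≤ 1 := by
    rw [coordMap, LinearIsometryEquiv.norm_map]
    exact A.norm_toContinuousLinearMap_le
  nlinarith [norm_nonneg x]

theorem inner_sub_coordMap (A : Euc d →ₗᵢ[ℝ] Euc k) (u : Euc d) (x : Euc k) :
    inner ℝ (A u) (x - A (coordMap A x)) = 0 := by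
  rw [inner_sub_right, A.inner_map_map, inner_coordMap, sub_self]

/-- Vectors orthogonal to the face `F` have a substantial component orthogonal to the range
of `A`. -/
def IsGoodFace (A : Euc d →ₗᵢ[ℝ] Euc k) (η : ℝ) (F : Set (Euc k)) : Prop :=
  ∀ ξ : Euc k, (∀ x ∈ F, ∀ y ∈ F, inner ℝ ξ (x - y) = 0) → η * ‖ξ‖ ≤ ‖ξ - A (coordMap A ξ)‖

/-- A bad face has a nonzero orthogonal vector `ξ` that is almost tangential. Its normalized
tangential part is the normal of the hyperplane: on differences of points of `F` it pairs as minus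
the normal part, which has size less than `η ‖ξ‖`. Since `η ≤ 1/2`, the tangential part has norm at
least `‖ξ‖ / 2`, whence the factor 2. -/
theorem nearHyperplane_of_not_isGoodFace {A : Euc d →ₗᵢ[ℝ] Euc k} {η σ h : ℝ} (hη : η ≤ 1 / 2)
    (hη0 : 0 ≤ η) (hh : 0 < h) {F : Set (Euc k)} (hF : ∀ x ∈ F, ∀ y ∈ F, ‖x - y‖ ≤ σ * h)
    (x₀ : Euc k) (hbad : ¬ IsGoodFace A η F) :
    NearHyperplane (2 * σ * η) (fun z => h⁻¹ • coordMap A (z - x₀)) F := by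
  simp only [IsGoodFace, not_forall, not_le] at hbad
  obtain ⟨ξ, hξF, hξ⟩ := hbad
  have h0 : 0 < ‖ξ‖ := by
    rcases (norm_nonneg ξ).eq_or_lt with h | h
    · rw [← h, mul_zero] at hξ
      exact absurd hξ (not_lt.2 (norm_nonneg _))
    · exact h
  have hB : ‖ξ‖ / 2 ≤ ‖coordMap A ξ‖ := by
    have h1 := norm_add_le (A (coordMap A ξ)) (ξ - A (coordMap A ξ))
    rw [add_sub_cancel, A.norm_map] at h1
    nlinarith
  have hB0 : 0 < ‖coordMap A ξ‖ := by linarith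
  refine ⟨‖coordMap A ξ‖⁻¹ • coordMap A ξ, ?_, fun x hx y hy => ?_⟩
  · rw [norm_smul, norm_inv, norm_norm, inv_mul_cancel₀ hB0.ne']
  · rw [← smul_sub, ← map_sub, sub_sub_sub_cancel_right, inner_smul_left, inner_smul_right,
      inner_coordMap]
    have e : inner ℝ (A (coordMap A ξ)) (x - y) = - inner ℝ (ξ - A (coordMap A ξ)) (x - y) := by
      rw [inner_sub_left, hξF x hx y hy]; ring
    have h1 : |inner ℝ (A (coordMap A ξ)) (x - y)| ≤ (η * ‖ξ‖) * (σ * h) := by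
      rw [e, abs_neg]
      exact (abs_real_inner_le_norm _ _).trans (mul_le_mul hξ.le (hF x hx y hy) (norm_nonneg _)
        (by positivity))
    have hσ : 0 ≤ σ * h := (norm_nonneg _).trans (hF x hx y hy)
    rw [abs_mul, abs_mul, abs_of_pos (inv_pos.2 hh)]
    simp only [conj_trivial, abs_inv, abs_norm]
    calc ‖coordMap A ξ‖⁻¹ * (h⁻¹ * |inner ℝ (A (coordMap A ξ)) (x - y)|)
        ≤ ‖coordMap A ξ‖⁻¹ * (h⁻¹ * ((η * (2 * ‖coordMap A ξ‖)) * (σ * h))) := by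
          refine mul_le_mul_of_nonneg_left (mul_le_mul_of_nonneg_left (h1.trans ?_) ?_) ?_
          · exact mul_le_mul_of_nonneg_right (mul_le_mul_of_nonneg_left (by linarith) hη0) hσ
          · positivity
          · positivity
      _ = 2 * σ * η := by field_simp

end Adjoint

/-! ### Affine maps with prescribed values at the vertices of a simplex. -/

section Interpolation

variable {k : ℕ} {V : Type*} [NormedAddCommGroup V] [NormedSpace ℝ V]

theorem exists_affineMap_eq_on_vertices {T : Finset (Euc k)}
    (hT : AffineIndependent ℝ ((↑) : T → Euc k)) (hspan : affineSpan ℝ (T : Set (Euc k)) = ⊤)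
    (w : Euc k → V) : ∃ a : Euc k →ᵃ[ℝ] V, ∀ z ∈ T, a z = w z := by
  classical
  let b : AffineBasis T ℝ (Euc k) := ⟨(↑), hT, by simpa using hspan⟩
  refine ⟨∑ i : T, (LinearMap.toSpanSingleton ℝ V (w i)).toAffineMap.comp (b.coord i),
    fun z hz => ?_⟩
  have h1 : ∀ (s : Finset T) (x : Euc k),
      (∑ i ∈ s, (LinearMap.toSpanSingleton ℝ V (w i)).toAffineMap.comp (b.coord i)) x =
        ∑ i ∈ s, b.coord i x • w i := by
    intro s x
    induction s using Finset.induction_on with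
    | empty => simp
    | insert i s hi ih => rw [Finset.sum_insert hi, Finset.sum_insert hi, ← ih]; simp
  rw [h1]
  have h2 : ∀ i : T, b.coord i z = if i = ⟨z, hz⟩ then 1 else 0 := fun i =>
    b.coord_apply i ⟨z, hz⟩
  simp [h2]

theorem AffineMap.norm_linear_le_of_norm_le_on_ball {a : Euc k →ᵃ[ℝ] V} {x : Euc k} {r M : ℝ}
    (hr : 0 < r) (ha : ∀ y ∈ Metric.closedBall x r, ‖a y‖ ≤ M) (v : Euc k) :
    ‖a.linear v‖ ≤ 2 * M / r * ‖v‖ := by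
  rcases eq_or_ne v 0 with rfl | hv
  · simp
  have hv0 : 0 < ‖v‖ := norm_pos_iff.2 hv
  have h1 : a (x + (r / ‖v‖) • v) - a x = (r / ‖v‖) • a.linear v := by
    have := a.map_vadd x ((r / ‖v‖) • v)
    rw [vadd_eq_add, vadd_eq_add, add_comm _ x] at this
    rw [this, map_smul, add_sub_cancel_right]
  have h2 : ‖a (x + (r / ‖v‖) • v) - a x‖ ≤ 2 * M := by
    refine (norm_sub_le _ _).trans ?_
    have h3 := ha (x + (r / ‖v‖) • v) (by
      rw [mem_closedBall_iff_norm, add_sub_cancel_left, norm_smul, Real.norm_eq_abs,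
        abs_of_pos (by positivity), div_mul_cancel₀ _ hv0.ne'])
    have h4 := ha x (Metric.mem_closedBall_self hr.le)
    linarith
  rw [h1, norm_smul, Real.norm_eq_abs, abs_of_pos (by positivity), div_mul_eq_mul_div,
    div_le_iff₀ hv0] at h2
  rw [div_mul_eq_mul_div, le_div_iff₀ hr]
  linarith

theorem norm_le_on_simplex_of_vertices {a : Euc k →ᵃ[ℝ] V} {T : Finset (Euc k)} {M : ℝ}
    (h : ∀ z ∈ T, ‖a z‖ ≤ M) : ∀ x ∈ simplex T, ‖a x‖ ≤ M := by
  intro x hx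
  have hc : Convex ℝ (a ⁻¹' Metric.closedBall 0 M) := (convex_closedBall _ _).affine_preimage a
  have := convexHull_min (s := (T : Set (Euc k))) (fun z hz => by simpa using h z hz) hc hx
  simpa using this

theorem AffineMap.eqOn_convexHull {a b : Euc k →ᵃ[ℝ] V} {F : Set (Euc k)} (h : EqOn a b F) :
    EqOn a b (convexHull ℝ F) := by
  intro x hx
  have hc : Convex ℝ ((a - b) ⁻¹' ({0} : Set V)) := (convex_singleton _).affine_preimage (a - b)
  have := convexHull_min (s := F) (fun z hz => by simp [h hz]) hc hx
  simpa [sub_eq_zero] using this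

end Interpolation

/-! ### Chains of elements through good faces. -/

section Chain

variable {d k : ℕ}

theorem norm_sub_le_of_mem_simplex {T : Finset (Euc k)} {r : ℝ}
    (h : Metric.diam (simplex T) ≤ r) {x y : Euc k} (hx : x ∈ simplex T) (hy : y ∈ simplex T) :
    ‖x - y‖ ≤ r := by
  rw [← dist_eq_norm]
  exact (Metric.dist_le_diam_of_mem (isCompact_simplex T).isBounded hx hy).trans h

/-- The interpolant and the scaled projection are both affine on `T` and differ by at most `τ` at
the vertices, hence on all of `T`. The inscribed ball of radius `h / σ` converts this into a bound
for the difference of the linear parts. -/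
theorem exists_near_interpolation {𝒜 : Finset (Finset (Euc k))} (h𝒜 : IsConformingMesh k 𝒜)
    {σ h τ : ℝ} (hσ : 0 < σ) (hh : 0 < h)
    (hball : ∀ T ∈ 𝒜, ∃ x, Metric.closedBall x (h / σ) ⊆ simplex T)
    (A : Euc d →ₗᵢ[ℝ] Euc k) (x₀ : Euc k) (w : Euc k → Euc d)
    (hw : ∀ T ∈ 𝒜, ∀ z ∈ T, ‖w z - h⁻¹ • coordMap A (z - x₀)‖ ≤ τ) :
    ∃ a : Finset (Euc k) → (Euc k →ᵃ[ℝ] Euc d), (∀ T ∈ 𝒜, ∀ z ∈ T, a T z = w z) ∧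
      (∀ T ∈ 𝒜, ∀ x ∈ simplex T, ‖a T x - h⁻¹ • coordMap A (x - x₀)‖ ≤ τ) ∧
      ∀ T ∈ 𝒜, ∀ x y, ‖a T x - a T y - h⁻¹ • coordMap A (x - y)‖ ≤ 2 * τ * σ * h⁻¹ * ‖x - y‖ := by
  have hex : ∀ T, ∃ a : Euc k →ᵃ[ℝ] Euc d, T ∈ 𝒜 → ∀ z ∈ T, a z = w z := by
    intro T
    by_cases hT : T ∈ 𝒜
    · obtain ⟨a, ha⟩ := exists_affineMap_eq_on_vertices (h𝒜.affineIndependent T hT)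
        (affineSpan_eq_top_of_mesh h𝒜 hT) w
      exact ⟨a, fun _ => ha⟩
    · exact ⟨AffineMap.const ℝ _ 0, fun h => absurd h hT⟩
  choose a ha using hex
  let b : Euc k →ᵃ[ℝ] Euc d :=
    (h⁻¹ • (coordMap A : Euc k →ₗ[ℝ] Euc d)).toAffineMap +
      AffineMap.const ℝ (Euc k) (-(h⁻¹ • coordMap A x₀))
  have hb : ∀ x, b x = h⁻¹ • coordMap A (x - x₀) := by
    intro x
    simp only [b, AffineMap.coe_add, Pi.add_apply, LinearMap.coe_toAffineMap, LinearMap.smul_apply,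
      AffineMap.coe_const, Function.const_apply, map_sub, smul_sub]
    rw [← sub_eq_add_neg]; rfl
  have hsimp : ∀ T ∈ 𝒜, ∀ x ∈ simplex T, ‖(a T - b) x‖ ≤ τ := by
    intro T hT
    refine norm_le_on_simplex_of_vertices fun z hz => ?_
    rw [AffineMap.coe_sub, Pi.sub_apply, ha T hT z hz, hb]
    exact hw T hT z hz
  refine ⟨a, fun T hT => ha T hT, fun T hT x hx => ?_, fun T hT x y => ?_⟩
  · have := hsimp T hT x hx
    rwa [AffineMap.coe_sub, Pi.sub_apply, hb] at this
  · obtain ⟨c, hc⟩ := hball T hT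
    have h1 := AffineMap.norm_linear_le_of_norm_le_on_ball (a := a T - b) (div_pos hh hσ)
      (fun y hy => hsimp T hT y (hc hy)) (x - y)
    have h2 : (a T - b).linear (x - y) = a T x - a T y - h⁻¹ • coordMap A (x - y) := by
      have h3 := (a T - b).linearMap_vsub x y
      rw [vsub_eq_sub, vsub_eq_sub] at h3
      rw [h3, AffineMap.coe_sub, Pi.sub_apply, Pi.sub_apply, hb, hb]
      simp only [map_sub, smul_sub]
      abel
    rw [h2] at h1
    refine h1.trans (le_of_eq ?_)
    field_simp

/-- Around a piece of a `d`-dimensional Lipschitz graph, each element that contains the centre is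
linked, through good faces, to all the elements that meet a ball of a definite size in a
slightly shifted graph. -/
theorem exists_chain (d k N : ℕ) {σ : ℝ} (hσ : 0 < σ) :
    ∃ η > 0, ∃ ρ > 0, ∀ (A : Euc d →ₗᵢ[ℝ] Euc k) (h : ℝ) (𝒜 : Finset (Finset (Euc k)))
      (Y : Euc d → Euc k), 0 < h → IsConformingMesh k 𝒜 → 𝒜.card ≤ N →
      (∀ T ∈ 𝒜, Metric.diam (simplex T) ≤ σ * h) →
      (∀ T ∈ 𝒜, ∃ x, Metric.closedBall x (h / σ) ⊆ simplex T) →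
      (∀ u ∈ Metric.closedBall 0 1, ∀ v ∈ Metric.closedBall 0 1,
        ‖Y u - Y v - h • A (u - v)‖ ≤ 1 / 4 * h * ‖u - v‖) →
      (∀ T ∈ 𝒜, ∃ u ∈ Metric.closedBall 0 1, Y u ∈ simplex T) →
      (∀ u ∈ Metric.closedBall 0 1, ∀ᶠ z in nhds (Y u), ∃ T ∈ 𝒜, z ∈ simplex T) →
      ∀ T₀ ∈ 𝒜, Y 0 ∈ simplex T₀ → ∀ θ > 0, ∃ e : Euc k, ‖e‖ < θ ∧
        ∃ u₁ : Euc d, Metric.closedBall u₁ ρ ⊆ Metric.closedBall 0 1 ∧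
          ∀ u ∈ Metric.closedBall u₁ ρ, ∃ T ∈ 𝒜, Y u + e ∈ simplex T ∧
            Relation.ReflTransGen (FaceAdj 𝒜 (IsGoodFace A η)) T₀ T := by
  classical
  -- Small enough that the slope error `2 τ σ` of the interpolant is at most 1/16 and its pointwise
  -- error at most 1/32.
  set τ : ℝ := 1 / (32 * (σ + 1)) with hτ
  have hτ0 : 0 < τ := by positivity
  have hτσ : 2 * τ * σ ≤ 1 / 16 := by
    rw [hτ, mul_one_div, div_mul_eq_mul_div, div_le_div_iff₀ (by positivity) (by norm_num)]
    nlinarith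
  have hτ32 : τ ≤ 1 / 32 := by
    rw [hτ]
    exact one_div_le_one_div_of_le (by norm_num) (by nlinarith)
  obtain ⟨η₀, hη₀, ρ₀, hρ₀, hround⟩ := exists_isRounding (V := Euc d) (α := Euc k)
    (N * (k + 1)) (σ + 2) (1 / 4) hτ0
  -- With `η ≤ η₀ / (2 σ)` the projections of bad faces are `η₀`-near a hyperplane. The halved `ρ₀`
  -- compensates for the expansion of a map near the identity, and 1/4 keeps the final ball inside
  -- the unit ball.
  refine ⟨min (η₀ / (2 * σ)) (1 / 2), by positivity, min (ρ₀ / 2) (1 / 4), by positivity, ?_⟩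
  intro A h 𝒜 Y hh h𝒜 hN hdiam hball hY hmeet hcov T₀ hT₀ hx₀ θ hθ
  set η := min (η₀ / (2 * σ)) (1 / 2) with hη
  set ρ := min (ρ₀ / 2) (1 / 4) with hρ
  set x₀ := Y 0 with hx₀def
  have h0mem : (0 : Euc d) ∈ Metric.closedBall (0 : Euc d) 1 := by simp
  have hYlip : ∀ u ∈ Metric.closedBall (0 : Euc d) 1, ∀ v ∈ Metric.closedBall (0 : Euc d) 1,
      ‖Y u - Y v‖ ≤ 5 / 4 * h * ‖u - v‖ := by
    intro u hu v hv
    have h1 := hY u hu v hv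
    have h2 := norm_add_le (Y u - Y v - h • A (u - v)) (h • A (u - v))
    rw [sub_add_cancel, norm_smul, A.norm_map, Real.norm_eq_abs, abs_of_pos hh] at h2
    linarith
  have hYc : ContinuousOn Y (Metric.closedBall 0 1) := by
    refine LipschitzOnWith.continuousOn (K := Real.toNNReal (5 / 4 * h))
      (LipschitzOnWith.of_dist_le_mul fun u hu v hv => ?_)
    rw [dist_eq_norm, dist_eq_norm, Real.coe_toNNReal _ (by positivity)]
    exact hYlip u hu v hv
  -- rounding of the vertices
  let S : Finset (Euc k) := 𝒜.biUnion id
  have hS : S.card ≤ N * (k + 1) := by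
    refine Finset.card_biUnion_le_card_mul _ _ _ (fun T hT => (h𝒜.card_eq T hT).le) |>.trans ?_
    exact Nat.mul_le_mul_right _ hN
  have hvert : ∀ T : Finset (Euc k), ∀ z ∈ T, z ∈ simplex T := fun T z hz =>
    subset_convexHull ℝ _ hz
  obtain ⟨w, H, hwζ, hHd, hHF, hHC⟩ := hround S hS (fun z => h⁻¹ • coordMap A (z - x₀)) (by
    intro z hz
    obtain ⟨T, hT, hzT⟩ := Finset.mem_biUnion.1 hz
    obtain ⟨u, hu, huT⟩ := hmeet T hT
    have h1 := norm_sub_le_of_mem_simplex (hdiam T hT) (hvert T z hzT) huT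
    have h2 := hYlip u hu 0 h0mem
    have h3 : ‖z - x₀‖ ≤ (σ + 2) * h := by
      refine (norm_sub_le_norm_sub_add_norm_sub z (Y u) x₀).trans ?_
      rw [sub_zero] at h2
      have : ‖u‖ ≤ 1 := by simpa using hu
      nlinarith
    rw [norm_smul, norm_inv, Real.norm_eq_abs, abs_of_pos hh, inv_mul_le_iff₀ hh]
    linarith [norm_coordMap_le A (z - x₀)])
  have hTS : ∀ T ∈ 𝒜, (T : Set (Euc k)) ⊆ S := fun T hT z hz =>
    Finset.mem_biUnion.2 ⟨T, hT, hz⟩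
  obtain ⟨a, haw, haτ, halip⟩ := exists_near_interpolation h𝒜 hσ hh hball A x₀ w
    fun T hT z hz => hwζ z (hTS T hT hz)
  -- the interpolant
  let g : Euc k → Euc d := fun x =>
    if hx : ∃ T ∈ 𝒜, x ∈ simplex T then a hx.choose x else 0
  have hg : ∀ T ∈ 𝒜, ∀ x ∈ simplex T, g x = a T x := by
    intro T hT x hx
    have hex : ∃ T ∈ 𝒜, x ∈ simplex T := ⟨T, hT, hx⟩
    simp only [g, dif_pos hex]
    obtain ⟨h1, h2⟩ := hex.choose_spec
    refine AffineMap.eqOn_convexHull (F := (hex.choose : Set (Euc k)) ∩ T) ?_ ?_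
    · intro z hz
      rw [haw _ h1 z hz.1, haw T hT z hz.2]
    · rw [← h𝒜.inter_eq _ h1 T hT]
      exact ⟨h2, hx⟩
  have hgF : ∀ T ∈ 𝒜, ∀ T' ∈ 𝒜, ∀ x, x ∈ simplex T → x ∈ simplex T' →
      g x ∈ convexHull ℝ (w '' ((T : Set (Euc k)) ∩ T')) := by
    intro T hT T' hT' x hx hx'
    have h1 : x ∈ convexHull ℝ ((T : Set (Euc k)) ∩ T') := by
      rw [← h𝒜.inter_eq T hT T' hT']; exact ⟨hx, hx'⟩
    have h2 : w '' ((T : Set (Euc k)) ∩ T') = a T '' ((T : Set (Euc k)) ∩ T') :=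
      image_congr fun z hz => (haw T hT z hz.1).symm
    rw [h2, ← (a T).image_convexHull, hg T hT x hx]
    exact mem_image_of_mem _ h1
  -- the shift
  obtain ⟨ε₀, hε₀, hε₀cov⟩ : ∃ ε₀ > 0, ∀ u ∈ Metric.closedBall (0 : Euc d) 1, ∀ e : Euc k,
      ‖e‖ < ε₀ → ∃ T ∈ 𝒜, Y u + e ∈ simplex T := by
    have hK : IsCompact (Y '' Metric.closedBall 0 1) :=
      (isCompact_closedBall _ _).image_of_continuousOn hYc
    obtain ⟨ε, hε, hsub⟩ := hK.exists_thickening_subset_open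
      (t := interior {z | ∃ T ∈ 𝒜, z ∈ simplex T}) isOpen_interior (by
        rintro _ ⟨u, hu, rfl⟩
        exact mem_interior_iff_mem_nhds.2 (Filter.eventually_iff.1 (hcov u hu)))
    refine ⟨ε, hε, fun u hu e he => ?_⟩
    have hmem : Y u + e ∈ interior {z | ∃ T ∈ 𝒜, z ∈ simplex T} := hsub (Metric.mem_thickening_iff.2 ⟨Y u,
      mem_image_of_mem _ hu, by rwa [dist_eq_norm, add_sub_cancel_left]⟩)
    exact (interior_subset hmem :)
  set θ' := min θ (min ε₀ (h / 32)) with hθ'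
  have hθ'0 : 0 < θ' := by positivity
  -- The point `g x₀` itself may lie in `H`. The linear part of `a T₀` is surjective, being close to
  -- the scaled projection, so `a T₀` is open and pulls the dense set `Hᶜ` back to a dense set; this
  -- set meets the interior of `T₀` arbitrarily close to `x₀`.
  obtain ⟨e, heθ, heT, heH⟩ : ∃ e : Euc k, ‖e‖ < θ' ∧ x₀ + e ∈ simplex T₀ ∧ g (x₀ + e) ∉ H := by
    have hcl : x₀ ∈ closure (interior (simplex T₀)) := by
      rw [closure_interior_simplex h𝒜 hT₀]; exact hx₀
    have hlin : Function.Surjective (a T₀).linear := by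
      have hnear : ∀ v : Euc d, ‖(a T₀).linear (h • A v) - v‖ ≤ 1 / 16 * ‖v‖ := by
        intro v
        have h1 := halip T₀ hT₀ (h • A v) 0
        rw [sub_zero, map_smul (coordMap A), coordMap_apply_self, smul_smul, inv_mul_cancel₀ hh.ne', one_smul,
          norm_smul, A.norm_map, Real.norm_eq_abs, abs_of_pos hh] at h1
        have h2 := (a T₀).linearMap_vsub (h • A v) 0
        simp only [vsub_eq_sub, sub_zero] at h2
        rw [h2]
        refine h1.trans ?_
        have : 2 * τ * σ * h⁻¹ * (h * ‖v‖) = 2 * τ * σ * ‖v‖ := by field_simp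
        rw [this]
        exact mul_le_mul_of_nonneg_right hτσ (norm_nonneg _)
      have hinj : Function.Injective ((a T₀).linear ∘ₗ (h • A.toLinearMap)) := by
        rw [← LinearMap.ker_eq_bot, LinearMap.ker_eq_bot']
        intro v hv
        have h1 := hnear v
        have h2 : (a T₀).linear (h • A v) = 0 := hv
        rw [h2, zero_sub, norm_neg] at h1
        have := norm_nonneg v
        exact norm_eq_zero.1 (by linarith)
      have := LinearMap.injective_iff_surjective.1 hinj
      intro v
      obtain ⟨u, hu⟩ := this v
      exact ⟨h • A u, hu⟩
    have hopen : IsOpenMap (a T₀) := by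
      rw [← AffineMap.isOpenMap_linear_iff]
      exact ContinuousLinearMap.isOpenMap (LinearMap.toContinuousLinearMap (a T₀).linear) hlin
    obtain ⟨y, hy, hyT⟩ := Metric.mem_closure_iff.1 hcl θ' hθ'0
    obtain ⟨z, ⟨hzT, hzb⟩, hzH⟩ := (hHd.preimage hopen).inter_open_nonempty
      (interior (simplex T₀) ∩ Metric.ball x₀ θ') (isOpen_interior.inter Metric.isOpen_ball)
      ⟨y, hy, by rwa [Metric.mem_ball, dist_comm]⟩
    refine ⟨z - x₀, ?_, ?_, ?_⟩
    · rwa [← mem_ball_iff_norm]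
    · rw [add_sub_cancel]; exact interior_subset hzT
    · rw [add_sub_cancel, hg T₀ hT₀ z (interior_subset hzT)]; exact hzH
  have heθ1 : ‖e‖ < θ := heθ.trans_le (min_le_left _ _)
  have heε : ‖e‖ < ε₀ := heθ.trans_le ((min_le_right _ _).trans (min_le_left _ _))
  have heh : ‖e‖ < h / 32 := heθ.trans_le ((min_le_right _ _).trans (min_le_right _ _))
  -- the parametrization of the graph composed with the interpolant
  let G : Euc d → Euc d := fun u => g (Y u + e)
  -- On each element the slope of the graph contributes 1/4 and the interpolation error `1/16 *
  -- 5/4`, together less than 1/2.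
  have hG : ∀ u ∈ Metric.closedBall (0 : Euc d) 1, ∀ v ∈ Metric.closedBall (0 : Euc d) 1,
      ‖G u - G v - (u - v)‖ ≤ 1 / 2 * ‖u - v‖ := by
    have hpiece := norm_sub_le_of_finite_closed_cover_convex (f := fun u => G u - u)
      (L := 1 / 2) (convex_closedBall (0 : Euc d) 1)
      (S := fun T : 𝒜 => Metric.closedBall (0 : Euc d) 1 ∩ (fun u => Y u + e) ⁻¹' simplex T.1)
      (fun T => (hYc.add continuousOn_const).preimage_isClosed_of_isClosed
        Metric.isClosed_closedBall (isClosed_simplex _))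
      (fun u hu => by
        obtain ⟨T, hT, h1⟩ := hε₀cov u hu e heε
        exact mem_iUnion.2 ⟨⟨T, hT⟩, hu, h1⟩)
      (by
        rintro ⟨T, hT⟩ u ⟨⟨-, huT⟩, hu⟩ v ⟨⟨-, hvT⟩, hv⟩
        have h1 := halip T hT (Y u + e) (Y v + e)
        rw [add_sub_add_right_eq_sub] at h1
        have h2 : ‖h⁻¹ • coordMap A (Y u - Y v) - (u - v)‖ ≤ 1 / 4 * ‖u - v‖ := by
          have e1 : h⁻¹ • coordMap A (Y u - Y v) - (u - v) =
              h⁻¹ • coordMap A (Y u - Y v - h • A (u - v)) := by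
            rw [map_sub (coordMap A) (Y u - Y v), map_smul (coordMap A), coordMap_apply_self, smul_sub, smul_smul,
              inv_mul_cancel₀ hh.ne', one_smul]
          rw [e1, norm_smul, norm_inv, Real.norm_eq_abs, abs_of_pos hh, inv_mul_le_iff₀ hh]
          linarith [norm_coordMap_le A (Y u - Y v - h • A (u - v)), hY u hu v hv]
        have h3 : 2 * τ * σ * h⁻¹ * ‖Y u - Y v‖ ≤ 1 / 16 * (5 / 4) * ‖u - v‖ := by
          have := hYlip u hu v hv
          calc 2 * τ * σ * h⁻¹ * ‖Y u - Y v‖ ≤ 1 / 16 * h⁻¹ * (5 / 4 * h * ‖u - v‖) := by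
                gcongr
            _ = _ := by field_simp
        have e2 : G u - u - (G v - v) = (a T (Y u + e) - a T (Y v + e) -
            h⁻¹ • coordMap A (Y u - Y v)) + (h⁻¹ • coordMap A (Y u - Y v) - (u - v)) := by
          simp only [G]
          rw [hg T hT _ huT, hg T hT _ hvT]
          abel
        rw [e2]
        refine (norm_add_le _ _).trans ?_
        linarith [norm_nonneg (u - v)])
    intro u hu v hv
    have := hpiece u hu v hv
    rwa [sub_sub_sub_comm] at this
  have hG0 : ‖G 0‖ ≤ 1 / 16 := by
    have h1 := haτ T₀ hT₀ (x₀ + e) heT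
    rw [add_sub_cancel_left] at h1
    have h2 : ‖h⁻¹ • coordMap A e‖ ≤ 1 / 32 := by
      rw [norm_smul, norm_inv, Real.norm_eq_abs, abs_of_pos hh, inv_mul_le_iff₀ hh]
      linarith [norm_coordMap_le A e]
    have h3 : G 0 = a T₀ (x₀ + e) := hg T₀ hT₀ _ heT
    have h4 := norm_add_le (a T₀ (x₀ + e) - h⁻¹ • coordMap A e) (h⁻¹ • coordMap A e)
    rw [sub_add_cancel] at h4
    rw [h3]
    linarith
  obtain ⟨C, hCconv, hC0, hCball, hCH, y₁, hy₁⟩ := hHC (G 0) (by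
    rw [mem_ball_zero_iff]; linarith) heH
  -- Points of the chamber have norm below 1/4 and `‖G 0‖ ≤ 1/16`, so their distance to `G 0` is at
  -- most `5/16 < 1/2`: the whole chamber is in the range of `G`, with preimages of norm at most
  -- 5/8.
  have hinv : ∀ c ∈ C, ∃ u ∈ Metric.closedBall (0 : Euc d) 1, G u = c ∧ ‖u‖ ≤ 5 / 8 := by
    intro c hc
    have hc4 : ‖c‖ < 1 / 4 := by simpa using hCball hc
    have h1 : ‖c - G 0‖ ≤ 5 / 16 := (norm_sub_le _ _).trans (by linarith)
    obtain ⟨u, hu, h2, h3⟩ := exists_eq_of_near_identity zero_le_one hG (y := c) (by linarith)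
    rw [sub_zero] at h3
    exact ⟨u, hu, h2, by linarith⟩
  choose! i hi hGi hi8 using hinv
  have hilip : ∀ c ∈ C, ∀ c' ∈ C, ‖i c - i c'‖ ≤ 2 * ‖c - c'‖ := by
    intro c hc c' hc'
    have := norm_sub_le_two_mul_of_near_identity (hG (i c) (hi c hc) (i c') (hi c' hc'))
    rwa [hGi c hc, hGi c' hc'] at this
  have hiG : ∀ u ∈ Metric.closedBall (0 : Euc d) 1, G u ∈ C → i (G u) = u := by
    intro u hu huC
    have := norm_sub_le_two_mul_of_near_identity (hG (i (G u)) (hi _ huC) u hu)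
    rw [hGi _ huC, sub_self, norm_zero, mul_zero] at this
    exact sub_eq_zero.1 (norm_le_zero_iff.1 this)
  have hic : ContinuousOn i C := by
    refine LipschitzOnWith.continuousOn (K := 2)
      (LipschitzOnWith.of_dist_le_mul fun u hu v hv => ?_)
    rw [dist_eq_norm, dist_eq_norm]
    exact hilip u hu v hv
  -- The part of the shifted graph over the chamber, connected as a continuous image of a convex
  -- set.
  let D : Set (Euc k) := (fun c => Y (i c) + e) '' C
  have hD : IsPreconnected D :=
    hCconv.isPreconnected.image _ ((hYc.comp hic hi).add continuousOn_const)
  have hDmem : ∀ u ∈ Metric.closedBall (0 : Euc d) 1, G u ∈ C → Y u + e ∈ D := fun u hu huC =>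
    ⟨G u, huC, by simp only [hiG u hu huC]⟩
  have hDG : ∀ y ∈ D, g y ∈ C := by
    rintro _ ⟨c, hc, rfl⟩
    have : g (Y (i c) + e) = G (i c) := rfl
    simp only [this, hGi c hc, hc]
  have hDcov : ∀ y ∈ D, ∃ T ∈ 𝒜, y ∈ simplex T := by
    rintro _ ⟨c, hc, rfl⟩
    exact hε₀cov _ (hi c hc) e heε
  -- `g y` lies in the hull of the moved vertices of the common face. If the face were bad, this
  -- hull would be contained in `H`, which the chamber avoids.
  have hDloc : ∀ y ∈ D, ∀ T ∈ 𝒜, ∀ T' ∈ 𝒜, y ∈ simplex T → y ∈ simplex T' →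
      FaceAdj 𝒜 (IsGoodFace A η) T T' := by
    intro y hy T hT T' hT' hyT hyT'
    have hconv := hgF T hT T' hT' y hyT hyT'
    refine ⟨hT, hT', ?_, ?_⟩
    · have := convexHull_nonempty_iff.1 ⟨_, hconv⟩
      exact image_nonempty.1 this
    · by_contra hbad
      have hnear := nearHyperplane_of_not_isGoodFace (σ := σ) (min_le_right _ _)
        (by positivity : 0 ≤ η) hh (fun x hx y hy => norm_sub_le_of_mem_simplex (hdiam T hT)
          (hvert T x hx.1) (hvert T y hy.1)) x₀ hbad
      have hle : 2 * σ * η ≤ η₀ := by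
        calc 2 * σ * η ≤ 2 * σ * (η₀ / (2 * σ)) := by gcongr; exact min_le_left _ _
          _ = η₀ := by field_simp
      obtain ⟨ξ, hξ, hξb⟩ := hnear
      have := hHF ((T : Set (Euc k)) ∩ T') (inter_subset_left.trans (hTS T hT))
        ⟨ξ, hξ, fun x hx y hy => (hξb x hx y hy).trans hle⟩ hconv
      exact disjoint_left.1 hCH (hDG y hy) this
  have hy₁C : y₁ ∈ C := hy₁ (Metric.mem_closedBall_self hρ₀.le)
  have hsub : Metric.closedBall (i y₁) ρ ⊆ Metric.closedBall (0 : Euc d) 1 := by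
    refine Metric.closedBall_subset_closedBall' ?_
    rw [dist_zero_right]
    have : ρ ≤ 1 / 4 := min_le_right _ _
    linarith [hi8 y₁ hy₁C]
  refine ⟨e, heθ1, i y₁, hsub, fun u hu => ?_⟩
  have hu1 := hsub hu
  have hGu : G u ∈ C := by
    refine hy₁ ?_
    have h1 := hG u hu1 (i y₁) (hi y₁ hy₁C)
    rw [hGi y₁ hy₁C] at h1
    rw [mem_closedBall_iff_norm] at hu ⊢
    have h2 := norm_add_le (G u - y₁ - (u - i y₁)) (u - i y₁)
    rw [sub_add_cancel] at h2
    have h3 : ρ ≤ ρ₀ / 2 := min_le_left _ _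
    linarith
  obtain ⟨T, hT, huT⟩ := hε₀cov u hu1 e heε
  exact ⟨T, hT, huT, reflTransGen_faceAdj_of_isPreconnected hD hDcov hDloc
    (hDmem 0 h0mem hC0) (hDmem u hu1 hGu) hT₀ hT heT huT⟩

end Chain

/-! ### Quantitative local geometry of `Γ`. -/

section LocalGeometry

variable {d k : ℕ}

/-- A smooth local parametrization `ψ` of `Γ` with smooth left inverse `β`. -/
structure IsLocalParam (Γ : Set (Euc k)) (ψ : Euc d → Euc k) (β : Euc k → Euc d)
    (V : Set (Euc d)) (W : Set (Euc k)) : Prop where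
  isOpen_source : IsOpen V
  isOpen_target : IsOpen W
  contDiffOn_param : ContDiffOn ℝ ∞ ψ V
  contDiffOn_inv : ContDiffOn ℝ ∞ β W
  mem : ∀ u ∈ V, ψ u ∈ Γ
  mem_target : ∀ u ∈ V, ψ u ∈ W
  left_inv : ∀ u ∈ V, β (ψ u) = u
  inv_mem : ∀ q ∈ Γ, q ∈ W → β q ∈ V
  right_inv : ∀ q ∈ Γ, q ∈ W → ψ (β q) = q

theorem IsSmoothSubmanifold.exists_localParam {d c : ℕ} {Γ : Set (Euc (d + c))}
    (hΓ : IsSmoothSubmanifold d c Γ) {x : Euc (d + c)} (hx : x ∈ Γ) :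
    ∃ (ψ : Euc d → Euc (d + c)) (β : Euc (d + c) → Euc d) (V : Set (Euc d))
      (W : Set (Euc (d + c))), IsLocalParam Γ ψ β V W ∧ x ∈ W := by
  obtain ⟨φ, hxφ, hφ, hφs, hφΓ⟩ := hΓ x hx
  have hinj : ContDiff ℝ ∞ (fun u : Euc d => (u, (0 : Euc c))) := by fun_prop
  refine ⟨fun u => φ.symm (u, 0), fun y => (φ y).1, (fun u => (u, (0 : Euc c))) ⁻¹' φ.target,
    φ.source, ?_, hxφ⟩
  constructor
  · exact φ.open_target.preimage hinj.continuous
  · exact φ.open_source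
  · exact hφs.comp hinj.contDiffOn fun u hu => hu
  · exact hφ.fst
  · intro u hu
    rw [hφΓ _ (φ.map_target hu), φ.right_inv hu]
  · intro u hu
    exact φ.map_target hu
  · intro u hu
    simp only [φ.right_inv (show (u, (0 : Euc c)) ∈ φ.target from hu)]
  · intro q hq hqW
    have h0 := (hφΓ q hqW).1 hq
    have : ((φ q).1, (0 : Euc c)) = φ q := by rw [← h0]
    simp only [mem_preimage, this]
    exact φ.map_source hqW
  · intro q hq hqW
    have h0 := (hφΓ q hqW).1 hq
    have : ((φ q).1, (0 : Euc c)) = φ q := by rw [← h0]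
    simp only [this]
    exact φ.left_inv hqW

namespace IsLocalParam

variable {Γ : Set (Euc k)} {ψ : Euc d → Euc k} {β : Euc k → Euc d} {V : Set (Euc d)}
  {W : Set (Euc k)}

theorem contDiffAt_param (h : IsLocalParam Γ ψ β V W) {u : Euc d} (hu : u ∈ V) :
    ContDiffAt ℝ ∞ ψ u :=
  h.contDiffOn_param.contDiffAt (h.isOpen_source.mem_nhds hu)

theorem contDiffAt_inv (h : IsLocalParam Γ ψ β V W) {q : Euc k} (hq : q ∈ W) :
    ContDiffAt ℝ ∞ β q :=
  h.contDiffOn_inv.contDiffAt (h.isOpen_target.mem_nhds hq)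

theorem hasFDerivAt_param (h : IsLocalParam Γ ψ β V W) {u : Euc d} (hu : u ∈ V) :
    HasFDerivAt ψ (fderiv ℝ ψ u) u :=
  ((h.contDiffAt_param hu).differentiableAt (by simp)).hasFDerivAt

theorem hasFDerivAt_inv (h : IsLocalParam Γ ψ β V W) {q : Euc k} (hq : q ∈ W) :
    HasFDerivAt β (fderiv ℝ β q) q :=
  ((h.contDiffAt_inv hq).differentiableAt (by simp)).hasFDerivAt

theorem fderiv_inv_fderiv (h : IsLocalParam Γ ψ β V W) {u : Euc d} (hu : u ∈ V) (ξ : Euc d) :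
    fderiv ℝ β (ψ u) (fderiv ℝ ψ u ξ) = ξ := by
  have h1 := (h.hasFDerivAt_inv (h.mem_target u hu)).comp u (h.hasFDerivAt_param hu)
  have h2 : HasFDerivAt (β ∘ ψ) (ContinuousLinearMap.id ℝ (Euc d)) u := by
    refine (hasFDerivAt_id u).congr_of_eventuallyEq ?_
    filter_upwards [h.isOpen_source.mem_nhds hu] with v hv using h.left_inv v hv
  have := congrArg (fun L => L ξ) (h1.unique h2)
  simpa using this

/-- On `Γ` near `q` the map `ψ ∘ β` is the identity, so its derivative fixes the tangent cone;
conversely `ψ` maps an open set of parameters into `Γ`, so its derivative takes values in the cone.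
-/
theorem tangentSpaceAt_eq (h : IsLocalParam Γ ψ β V W) {q : Euc k} (hq : q ∈ Γ) (hqW : q ∈ W) :
    tangentSpaceAt Γ q = LinearMap.range (fderiv ℝ ψ (β q) : Euc d →ₗ[ℝ] Euc k) := by
  have hu := h.inv_mem q hq hqW
  have hr := h.right_inv q hq hqW
  apply le_antisymm
  · refine Submodule.span_le.2 fun w hw => ?_
    have h1 : HasFDerivAt (ψ ∘ β) ((fderiv ℝ ψ (β q)).comp (fderiv ℝ β q)) q :=
      (h.hasFDerivAt_param hu).comp q (h.hasFDerivAt_inv hqW)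
    have h2 : HasFDerivWithinAt (ψ ∘ β) (ContinuousLinearMap.id ℝ (Euc k)) Γ q := by
      refine (hasFDerivWithinAt_id q Γ).congr_of_eventuallyEq ?_ hr
      filter_upwards [self_mem_nhdsWithin, mem_nhdsWithin_of_mem_nhds
        (h.isOpen_target.mem_nhds hqW)] with y hy hyW using h.right_inv y hy hyW
    have h3 : fderiv ℝ ψ (β q) (fderiv ℝ β q w) = w := h1.hasFDerivWithinAt.unique_on h2 hw
    exact ⟨fderiv ℝ β q w, h3⟩
  · rintro _ ⟨ξ, rfl⟩
    refine Submodule.subset_span ?_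
    have h1 := (h.hasFDerivAt_param hu).hasFDerivWithinAt (s := V)
    have h2 : tangentConeAt ℝ V (β q) = univ :=
      tangentConeAt_of_mem_nhds (h.isOpen_source.mem_nhds hu)
    have h3 := h1.mapsTo_tangent_cone (h2 ▸ mem_univ ξ)
    rw [hr] at h3
    exact tangentConeAt_mono (image_subset_iff.2 fun u hu => h.mem u hu) h3

theorem finrank_tangentSpaceAt (h : IsLocalParam Γ ψ β V W) {q : Euc k} (hq : q ∈ Γ)
    (hqW : q ∈ W) : Module.finrank ℝ (tangentSpaceAt Γ q) = d := by
  rw [h.tangentSpaceAt_eq hq hqW, LinearMap.finrank_range_of_inj, finrank_euclideanSpace_fin]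
  intro ξ ξ' hξ
  rw [← h.fderiv_inv_fderiv (h.inv_mem q hq hqW) ξ,
    ← h.fderiv_inv_fderiv (h.inv_mem q hq hqW) ξ']
  exact congrArg _ hξ

end IsLocalParam

/-- The difference of the projections is `(1 - L) K - L (1 - K)`, and the second term is the adjoint
of `(1 - K) L`. -/
theorem norm_starProjection_sub_le_add {E : Type*} [NormedAddCommGroup E] [InnerProductSpace ℝ E]
    [FiniteDimensional ℝ E] (K L : Submodule ℝ E) {a b : ℝ} (ha : 0 ≤ a) (hb : 0 ≤ b)
    (h1 : ∀ w, ‖K.starProjection w - L.starProjection (K.starProjection w)‖ ≤ a * ‖w‖)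
    (h2 : ∀ w, ‖L.starProjection w - K.starProjection (L.starProjection w)‖ ≤ b * ‖w‖) :
    ‖K.starProjection - L.starProjection‖ ≤ a + b := by
  refine ContinuousLinearMap.opNorm_le_bound _ (add_nonneg ha hb) fun w => ?_
  have h3 : ‖L.starProjection (w - K.starProjection w)‖ ≤ b * ‖w‖ := by
    set z := L.starProjection (w - K.starProjection w) with hz
    have e1 : ‖z‖ ^ 2 = inner ℝ w (L.starProjection z - K.starProjection (L.starProjection z)) := by
      have hLz : L.starProjection z = z := L.starProjection_eq_self_iff.2
        (L.starProjection_apply_mem _)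
      have : ‖z‖ ^ 2 = inner ℝ (w - K.starProjection w) z := by
        rw [← real_inner_self_eq_norm_sq]
        conv_lhs => rw [hz]
        rw [L.inner_starProjection_left_eq_right, hLz]
      rw [this, hLz, inner_sub_right, inner_sub_left, K.inner_starProjection_left_eq_right]
    have e2 := real_inner_le_norm w (L.starProjection z - K.starProjection (L.starProjection z))
    have e3 := mul_le_mul_of_nonneg_left (h2 z) (norm_nonneg w)
    rcases (norm_nonneg z).eq_or_lt with h0 | h0
    · rw [← h0]; positivity
    · have : ‖z‖ * ‖z‖ ≤ b * ‖w‖ * ‖z‖ := by nlinarith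
      exact le_of_mul_le_mul_right this h0
  have e : (K.starProjection - L.starProjection) w =
      (K.starProjection w - L.starProjection (K.starProjection w)) -
        L.starProjection (w - K.starProjection w) := by
    rw [map_sub]; simp
  rw [e]
  refine (norm_sub_le _ _).trans ?_
  linarith [h1 w]

theorem norm_sub_starProjection_le {E : Type*} [NormedAddCommGroup E] [InnerProductSpace ℝ E]
    [FiniteDimensional ℝ E] (K : Submodule ℝ E) (w : E) : ‖w - K.starProjection w‖ ≤ ‖w‖ := by
  rw [← K.starProjection_orthogonal_val]
  exact Kᗮ.norm_starProjection_apply_le w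

theorem norm_sub_starProjection_le_of_mem {E : Type*} [NormedAddCommGroup E]
    [InnerProductSpace ℝ E] [FiniteDimensional ℝ E] (K : Submodule ℝ E) (w : E) {z : E}
    (hz : z ∈ K) : ‖w - K.starProjection w‖ ≤ ‖w - z‖ := by
  have : w - K.starProjection w = (w - z) - K.starProjection (w - z) := by
    rw [map_sub, K.starProjection_eq_self_iff.2 hz]; abel
  rw [this]
  exact norm_sub_starProjection_le K _

/-- Quantitative regularity of `Γ` near the point `x`. -/
structure GeometryNear (d : ℕ) (Γ : Set (Euc k)) (C r : ℝ) (x : Euc k) : Prop where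
  finrank_eq : ∀ q ∈ Γ, q ∈ Metric.ball x r → Module.finrank ℝ (tangentSpaceAt Γ q) = d
  proj_sub_le : ∀ q ∈ Γ, q ∈ Metric.ball x r → ∀ q' ∈ Γ, q' ∈ Metric.ball x r →
    ‖tangentialProj Γ q - tangentialProj Γ q'‖ ≤ C * ‖q - q'‖
  normal_le : ∀ q ∈ Γ, q ∈ Metric.ball x r → ∀ q' ∈ Γ, q' ∈ Metric.ball x r →
    ‖(q' - q) - tangentialProj Γ q (q' - q)‖ ≤ C * ‖q' - q‖ ^ 2
  exists_graph : ∀ q ∈ Γ, q ∈ Metric.ball x r → ∀ w ∈ tangentSpaceAt Γ q, ‖w‖ ≤ r →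
    ∃ q' ∈ Γ, tangentialProj Γ q (q' - q) = w ∧ ‖q' - q‖ ≤ C * ‖w‖

theorem GeometryNear.mono {Γ : Set (Euc k)} {C C' r r' : ℝ} {x : Euc k}
    (h : GeometryNear d Γ C r x) (hC : C ≤ C') (hr : r' ≤ r) : GeometryNear d Γ C' r' x := by
  have hb := Metric.ball_subset_ball (x := x) hr
  constructor
  · exact fun q hq hqr => h.finrank_eq q hq (hb hqr)
  · exact fun q hq hqr q' hq' hqr' => (h.proj_sub_le q hq (hb hqr) q' hq' (hb hqr')).trans
      (mul_le_mul_of_nonneg_right hC (norm_nonneg _))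
  · exact fun q hq hqr q' hq' hqr' => (h.normal_le q hq (hb hqr) q' hq' (hb hqr')).trans
      (mul_le_mul_of_nonneg_right hC (sq_nonneg _))
  · intro q hq hqr w hw hwr
    obtain ⟨q', h1, h2, h3⟩ := h.exists_graph q hq (hb hqr) w hw (hwr.trans hr)
    exact ⟨q', h1, h2, h3.trans (mul_le_mul_of_nonneg_right hC (norm_nonneg _))⟩

/-- A neighbourhood of a parameter on which the parametrization is uniformly `C^{1,1}`. -/
theorem IsLocalParam.exists_bounds {Γ : Set (Euc k)} {ψ : Euc d → Euc k} {β : Euc k → Euc d}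
    {V : Set (Euc d)} {W : Set (Euc k)} (h : IsLocalParam Γ ψ β V W) {x : Euc k} (hx : x ∈ Γ)
    (hxW : x ∈ W) : ∃ M ≥ 1, ∃ s > 0, ∃ r > 0, Metric.ball (β x) s ⊆ V ∧ Metric.ball x r ⊆ W ∧
      (∀ u ∈ Metric.ball (β x) s, ∀ v ∈ Metric.ball (β x) s,
        ‖fderiv ℝ ψ u - fderiv ℝ ψ v‖ ≤ M * ‖u - v‖ ∧ ‖ψ u - ψ v‖ ≤ M * ‖u - v‖) ∧
      (∀ q ∈ Metric.ball x r, ‖fderiv ℝ β q‖ ≤ M ∧ β q ∈ Metric.ball (β x) (s / 2)) ∧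
      ∀ q ∈ Metric.ball x r, ∀ q' ∈ Metric.ball x r, ‖β q - β q'‖ ≤ M * ‖q - q'‖ := by
  have hu := h.inv_mem x hx hxW
  have hDψ : ContDiffAt ℝ 1 (fderiv ℝ ψ) (β x) :=
    (h.contDiffAt_param hu).fderiv_right (m := 1) (by norm_cast)
  have hDβ : ContDiffAt ℝ 1 (fderiv ℝ β) x :=
    (h.contDiffAt_inv hxW).fderiv_right (m := 1) (by norm_cast)
  obtain ⟨K₁, t₁, ht₁, hK₁⟩ := hDψ.exists_lipschitzOnWith
  obtain ⟨K₂, t₂, ht₂, hK₂⟩ :=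
    ((h.contDiffAt_param hu).of_le (by simp : (1 : WithTop ℕ∞) ≤ ∞)).exists_lipschitzOnWith
  obtain ⟨K₃, t₃, ht₃, hK₃⟩ :=
    ((h.contDiffAt_inv hxW).of_le (by simp : (1 : WithTop ℕ∞) ≤ ∞)).exists_lipschitzOnWith
  have hb : ∀ᶠ q in nhds x, ‖fderiv ℝ β q‖ < ‖fderiv ℝ β x‖ + 1 :=
    hDβ.continuousAt.norm.eventually_lt continuousAt_const (lt_add_one _)
  obtain ⟨s, hs, hsub⟩ := Metric.mem_nhds_iff.1
    (Filter.inter_mem (Filter.inter_mem ht₁ ht₂) (h.isOpen_source.mem_nhds hu))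
  have hβc : ∀ᶠ q in nhds x, β q ∈ Metric.ball (β x) (s / 2) :=
    (h.contDiffAt_inv hxW).continuousAt (Metric.ball_mem_nhds _ (by linarith))
  obtain ⟨r, hr, hrsub⟩ := Metric.mem_nhds_iff.1 (Filter.inter_mem (Filter.inter_mem ht₃
    (h.isOpen_target.mem_nhds hxW)) (hb.and hβc))
  refine ⟨max 1 (max K₁ (max K₂ (max K₃ (‖fderiv ℝ β x‖ + 1)))), le_max_left _ _, s, hs, r, hr,
    fun u hu => (hsub hu).2, fun q hq => (hrsub hq).1.2, fun u hu v hv => ⟨?_, ?_⟩,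
    fun q hq => ⟨?_, (hrsub hq).2.2⟩, fun q hq q' hq' => ?_⟩
  · have := hK₁.dist_le_mul u (hsub hu).1.1 v (hsub hv).1.1
    rw [dist_eq_norm, dist_eq_norm] at this
    refine this.trans (mul_le_mul_of_nonneg_right ?_ (norm_nonneg _))
    simp
  · have := hK₂.dist_le_mul u (hsub hu).1.2 v (hsub hv).1.2
    rw [dist_eq_norm, dist_eq_norm] at this
    refine this.trans (mul_le_mul_of_nonneg_right ?_ (norm_nonneg _))
    simp
  · refine (hrsub hq).2.1.le.trans ?_
    simp
  · have := hK₃.dist_le_mul q (hrsub hq).1.1 q' (hrsub hq').1.1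
    rw [dist_eq_norm, dist_eq_norm] at this
    refine this.trans (mul_le_mul_of_nonneg_right ?_ (norm_nonneg _))
    simp

theorem IsLocalParam.exists_geometryNear {Γ : Set (Euc k)} {ψ : Euc d → Euc k} {β : Euc k → Euc d}
    {V : Set (Euc d)} {W : Set (Euc k)} (h : IsLocalParam Γ ψ β V W) {x : Euc k} (hx : x ∈ Γ)
    (hxW : x ∈ W) : ∃ C r, 0 < C ∧ 0 < r ∧ GeometryNear d Γ C r x := by
  obtain ⟨M, hM, s, hs, r, hr, hsV, hrW, hψ, hβ, hβlip⟩ := h.exists_bounds hx hxW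
  have hM0 : 0 < M := by linarith
  -- The mean value inequality for a parametrization with `M`-Lipschitz derivative. It yields both
  -- the quadratic bound for the normal deviation and the near-identity property of the graph map
  -- below.
  have htaylor : ∀ u₀ ∈ Metric.ball (β x) s, ∀ u ∈ Metric.ball (β x) s,
      ∀ v ∈ Metric.ball (β x) s, ∀ t, ‖u - u₀‖ ≤ t → ‖v - u₀‖ ≤ t →
      ‖ψ u - ψ v - fderiv ℝ ψ u₀ (u - v)‖ ≤ M * t * ‖u - v‖ := by
    intro u₀ hu₀ u hu v hv t hut hvt
    have hconv : Convex ℝ (Metric.ball (β x) s ∩ Metric.closedBall u₀ t) :=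
      (convex_ball _ _).inter (convex_closedBall _ _)
    refine hconv.norm_image_sub_le_of_norm_hasFDerivWithin_le' (f' := fderiv ℝ ψ)
      (fun y hy => (h.hasFDerivAt_param (hsV hy.1)).hasFDerivWithinAt) (fun y hy => ?_)
      ⟨hv, by rwa [mem_closedBall_iff_norm]⟩ ⟨hu, by rwa [mem_closedBall_iff_norm]⟩
    refine ((hψ y hy.1 u₀ hu₀).1).trans (mul_le_mul_of_nonneg_left ?_ hM0.le)
    rw [← mem_closedBall_iff_norm]; exact hy.2
  have hball2 : Metric.ball (β x) (s / 2) ⊆ Metric.ball (β x) s :=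
    Metric.ball_subset_ball (by linarith)
  -- tangent vectors in coordinates
  have htan : ∀ q ∈ Γ, q ∈ Metric.ball x r → ∀ w ∈ tangentSpaceAt Γ q,
      ∃ ξ, fderiv ℝ ψ (β q) ξ = w ∧ ‖ξ‖ ≤ M * ‖w‖ := by
    intro q hq hqr w hw
    rw [h.tangentSpaceAt_eq hq (hrW hqr)] at hw
    obtain ⟨ξ, rfl⟩ := hw
    refine ⟨ξ, rfl, ?_⟩
    have h1 := h.fderiv_inv_fderiv (h.inv_mem q hq (hrW hqr)) ξ
    rw [h.right_inv q hq (hrW hqr)] at h1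
    have h2 := (fderiv ℝ β q).le_of_opNorm_le (hβ q hqr).1 (fderiv ℝ ψ (β q) ξ)
    rw [h1] at h2
    exact h2
  have hmemT : ∀ q ∈ Γ, q ∈ Metric.ball x r → ∀ ξ, fderiv ℝ ψ (β q) ξ ∈ tangentSpaceAt Γ q := by
    intro q hq hqr ξ
    rw [h.tangentSpaceAt_eq hq (hrW hqr)]
    exact ⟨ξ, rfl⟩
  have hhalf : ∀ q ∈ Γ, q ∈ Metric.ball x r → ∀ q' ∈ Γ, q' ∈ Metric.ball x r → ∀ w,
      ‖tangentialProj Γ q w - tangentialProj Γ q' (tangentialProj Γ q w)‖ ≤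
        M * M * M * ‖q - q'‖ * ‖w‖ := by
    intro q hq hqr q' hq' hqr' w
    obtain ⟨ξ, hξ, hξM⟩ := htan q hq hqr (tangentialProj Γ q w)
      ((tangentSpaceAt Γ q).starProjection_apply_mem w)
    refine (norm_sub_starProjection_le_of_mem _ _ (hmemT q' hq' hqr' ξ)).trans ?_
    rw [← hξ, ← sub_apply]
    have h1 := (hψ _ (hball2 (hβ q hqr).2) _ (hball2 (hβ q' hqr').2)).1
    have h2 := hβlip q hqr q' hqr'
    have h3 : ‖tangentialProj Γ q w‖ ≤ ‖w‖ :=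
      (tangentSpaceAt Γ q).norm_starProjection_apply_le w
    calc ‖(fderiv ℝ ψ (β q) - fderiv ℝ ψ (β q')) ξ‖
        ≤ ‖fderiv ℝ ψ (β q) - fderiv ℝ ψ (β q')‖ * ‖ξ‖ := ContinuousLinearMap.le_opNorm _ _
      _ ≤ (M * (M * ‖q - q'‖)) * (M * ‖w‖) := by
          refine mul_le_mul (h1.trans (mul_le_mul_of_nonneg_left h2 hM0.le))
            (hξM.trans (mul_le_mul_of_nonneg_left h3 hM0.le)) (norm_nonneg _) (by positivity)
      _ = _ := by ring
  -- radius of the graph chart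
  set s' := min (s / 4) (1 / (2 * (M * M))) with hs'
  have hs'0 : 0 < s' := by positivity
  have hs'M : M * M * s' ≤ 1 / 2 := by
    have : s' ≤ 1 / (2 * (M * M)) := min_le_right _ _
    calc M * M * s' ≤ M * M * (1 / (2 * (M * M))) := by gcongr
      _ = 1 / 2 := by field_simp
  refine ⟨2 * (M * M * M), min r (s' / (2 * M)), by positivity, by positivity, ?_⟩
  have hrr : Metric.ball x (min r (s' / (2 * M))) ⊆ Metric.ball x r :=
    Metric.ball_subset_ball (min_le_left _ _)
  constructor
  · exact fun q hq hqr => h.finrank_tangentSpaceAt hq (hrW (hrr hqr))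
  · intro q hq hqr q' hq' hqr'
    have h1 := hhalf q hq (hrr hqr) q' hq' (hrr hqr')
    have h2 := hhalf q' hq' (hrr hqr') q hq (hrr hqr)
    rw [norm_sub_rev q' q] at h2
    have := norm_starProjection_sub_le_add (tangentSpaceAt Γ q) (tangentSpaceAt Γ q')
      (by positivity) (by positivity) h1 h2
    unfold tangentialProj
    linarith
  · intro q hq hqr q' hq' hqr'
    have hq1 := hball2 (hβ q (hrr hqr)).2
    have hq2 := hball2 (hβ q' (hrr hqr')).2
    refine (norm_sub_starProjection_le_of_mem _ _
      (hmemT q hq (hrr hqr) (β q' - β q))).trans ?_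
    have h1 := htaylor (β q) hq1 (β q') hq2 (β q) hq1 ‖β q' - β q‖ le_rfl (by simp)
    rw [h.right_inv q hq (hrW (hrr hqr)), h.right_inv q' hq' (hrW (hrr hqr'))] at h1
    have h2 := hβlip q' (hrr hqr') q (hrr hqr)
    calc ‖q' - q - fderiv ℝ ψ (β q) (β q' - β q)‖
        ≤ M * ‖β q' - β q‖ * ‖β q' - β q‖ := h1
      _ ≤ M * (M * ‖q' - q‖) * (M * ‖q' - q‖) := by gcongr
      _ ≤ _ := by nlinarith [sq_nonneg ‖q' - q‖, mul_pos (mul_pos hM0 hM0) hM0]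
  · intro q hq hqr w hw hwr
    have hqr' := hrr hqr
    obtain ⟨ξ, hξ, hξM⟩ := htan q hq hqr' w hw
    have hq1 := (hβ q hqr').2
    have hcb : Metric.closedBall (β q) s' ⊆ Metric.ball (β x) s := by
      refine (Metric.closedBall_subset_ball' ?_)
      rw [Metric.mem_ball] at hq1
      have : s' ≤ s / 4 := min_le_left _ _
      linarith
    set P := tangentialProj Γ q with hP
    have hPD : ∀ ζ, P (fderiv ℝ ψ (β q) ζ) = fderiv ℝ ψ (β q) ζ := fun ζ =>
      (tangentSpaceAt Γ q).starProjection_eq_self_iff.2 (hmemT q hq hqr' ζ)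
    have hinv : ∀ ζ, fderiv ℝ β q (fderiv ℝ ψ (β q) ζ) = ζ := by
      intro ζ
      have h1 := h.fderiv_inv_fderiv (h.inv_mem q hq (hrW hqr')) ζ
      rwa [h.right_inv q hq (hrW hqr')] at h1
    -- The tangential part of `ψ u - q` in parameter coordinates. Its derivative at `β q` is the
    -- identity, so a graph representation over `T_q Γ` comes from `exists_eq_of_near_identity`.
    let F : Euc d → Euc d := fun u => fderiv ℝ β q (P (ψ u - q))
    have hF0 : F (β q) = 0 := by
      simp only [F, h.right_inv q hq (hrW hqr'), sub_self, map_zero]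
    have hF : ∀ u ∈ Metric.closedBall (β q) s', ∀ v ∈ Metric.closedBall (β q) s',
        ‖F u - F v - (u - v)‖ ≤ 1 / 2 * ‖u - v‖ := by
      intro u hu v hv
      have e : F u - F v - (u - v) =
          fderiv ℝ β q (P (ψ u - ψ v - fderiv ℝ ψ (β q) (u - v))) := by
        simp only [F]
        rw [map_sub P (ψ u - ψ v), hPD, map_sub (fderiv ℝ β q), hinv, ← map_sub, ← map_sub,
          sub_sub_sub_cancel_right]
      rw [e]
      have h1 := (fderiv ℝ β q).le_of_opNorm_le (hβ q hqr').1
        (P (ψ u - ψ v - fderiv ℝ ψ (β q) (u - v)))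
      have h2 : ‖P (ψ u - ψ v - fderiv ℝ ψ (β q) (u - v))‖ ≤
          ‖ψ u - ψ v - fderiv ℝ ψ (β q) (u - v)‖ :=
        (tangentSpaceAt Γ q).norm_starProjection_apply_le _
      have h3 := htaylor (β q) (hball2 hq1) u (hcb hu) v (hcb hv) s'
        (by rwa [← mem_closedBall_iff_norm]) (by rwa [← mem_closedBall_iff_norm])
      calc _ ≤ M * (M * s' * ‖u - v‖) :=
            h1.trans (mul_le_mul_of_nonneg_left (h2.trans h3) hM0.le)
        _ = M * M * s' * ‖u - v‖ := by ring
        _ ≤ _ := mul_le_mul_of_nonneg_right hs'M (norm_nonneg _)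
    have hξs : ‖ξ‖ ≤ s' / 2 := by
      have : ‖w‖ ≤ s' / (2 * M) := hwr.trans (min_le_right _ _)
      calc ‖ξ‖ ≤ M * ‖w‖ := hξM
        _ ≤ M * (s' / (2 * M)) := by gcongr
        _ = s' / 2 := by field_simp
    obtain ⟨u, hu, hFu, hub⟩ := exists_eq_of_near_identity hs'0.le hF (y := ξ) (by
      rw [hF0, sub_zero]; exact hξs)
    rw [hF0, sub_zero] at hub
    refine ⟨ψ u, h.mem u (hsV (hcb hu)), ?_, ?_⟩
    · obtain ⟨ζ, hζ, -⟩ := htan q hq hqr' (P (ψ u - q))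
        ((tangentSpaceAt Γ q).starProjection_apply_mem _)
      have : fderiv ℝ β q (P (ψ u - q)) = ξ := hFu
      rw [← hζ, hinv] at this
      rw [← hζ, this, hξ]
    · have h1 := (hψ u (hcb hu) (β q) (hball2 hq1)).2
      rw [h.right_inv q hq (hrW hqr')] at h1
      calc ‖ψ u - q‖ ≤ M * (2 * (M * ‖w‖)) :=
            h1.trans (mul_le_mul_of_nonneg_left (hub.trans (by linarith)) hM0.le)
        _ = 2 * (M * M) * ‖w‖ := by ring
        _ ≤ 2 * (M * M * M) * ‖w‖ := by
            refine mul_le_mul_of_nonneg_right ?_ (norm_nonneg _)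
            nlinarith [mul_pos hM0 hM0]

/-- Quantitative regularity of a compact submanifold. -/
structure UniformGeometry (d : ℕ) (Γ : Set (Euc k)) (C r : ℝ) : Prop where
  C_ge : 1 ≤ C
  r_pos : 0 < r
  finrank_eq : ∀ q ∈ Γ, Module.finrank ℝ (tangentSpaceAt Γ q) = d
  proj_sub_le : ∀ q ∈ Γ, ∀ q' ∈ Γ, ‖tangentialProj Γ q - tangentialProj Γ q'‖ ≤ C * ‖q - q'‖
  normal_le : ∀ q ∈ Γ, ∀ q' ∈ Γ, ‖(q' - q) - tangentialProj Γ q (q' - q)‖ ≤ C * ‖q' - q‖ ^ 2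
  exists_graph : ∀ q ∈ Γ, ∀ w ∈ tangentSpaceAt Γ q, ‖w‖ ≤ r →
    ∃ q' ∈ Γ, tangentialProj Γ q (q' - q) = w ∧ ‖q' - q‖ ≤ C * ‖w‖

/-- A Lebesgue number argument: pairs of points closer than `r₀` lie in a common ball where the
local estimates hold. -/
theorem exists_uniformGeometry {d c : ℕ} {Γ : Set (Euc (d + c))} (hc : IsCompact Γ)
    (hΓ : IsSmoothSubmanifold d c Γ) : ∃ C r, UniformGeometry d Γ C r := by
  have hloc : ∀ x ∈ Γ, ∃ C r, 0 < C ∧ 0 < r ∧ GeometryNear d Γ C r x := by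
    intro x hx
    obtain ⟨ψ, β, V, W, h, hxW⟩ := hΓ.exists_localParam hx
    exact h.exists_geometryNear hx hxW
  choose! C r hC hr hg using hloc
  obtain ⟨t, htΓ, ht⟩ := hc.elim_nhds_subcover (fun x => Metric.ball x (r x / 2))
    fun x hx => Metric.ball_mem_nhds x (half_pos (hr x hx))
  obtain ⟨r₀, hr₀, hr₁⟩ : ∃ m > 0, ∀ x ∈ t, m ≤ r x / 2 := by
    rcases t.eq_empty_or_nonempty with rfl | hne
    · exact ⟨1, one_pos, by simp⟩
    · obtain ⟨x, hx, hm⟩ := t.exists_min_image (fun x => r x / 2) hne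
      exact ⟨r x / 2, half_pos (hr x (htΓ x hx)), hm⟩
  obtain ⟨C₀, hC₀⟩ : ∃ C₀, ∀ x ∈ t, C x ≤ C₀ := by
    rcases t.eq_empty_or_nonempty with rfl | hne
    · exact ⟨1, by simp⟩
    · obtain ⟨x, hx, hm⟩ := t.exists_max_image C hne
      exact ⟨C x, hm⟩
  -- The term `2 / r₀` makes the estimates trivial for points at distance at least `r₀`, because
  -- projections have norm at most 1.
  set C' := max 1 (max C₀ (2 / r₀)) with hC'
  have hC'0 : 0 < C' := one_pos.trans_le (le_max_left _ _)
  have hC'r : 2 / r₀ ≤ C' := (le_max_right _ _).trans (le_max_right _ _)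
  have hCC' : C₀ ≤ C' := (le_max_left _ _).trans (le_max_right _ _)
  have hcov : ∀ q ∈ Γ, ∃ x ∈ t, q ∈ Metric.ball x (r x / 2) := fun q hq => by
    simpa using ht hq
  have hbig : ∀ {x q : Euc (d + c)}, x ∈ t → q ∈ Metric.ball x (r x / 2) →
      q ∈ Metric.ball x (r x) := fun hx hq =>
    Metric.ball_subset_ball (by linarith [hr _ (htΓ _ hx)]) hq
  have hbig' : ∀ {x q q' : Euc (d + c)}, x ∈ t → q ∈ Metric.ball x (r x / 2) →
      ‖q - q'‖ < r₀ → q' ∈ Metric.ball x (r x) := by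
    intro x q q' hx hq hlt
    rw [Metric.mem_ball] at hq ⊢
    have h1 := dist_triangle q' q x
    rw [dist_eq_norm q' q, norm_sub_rev] at h1
    linarith [hr₁ x hx]
  have hfar : ∀ {a : ℝ}, r₀ ≤ a → 2 ≤ C' * a := by
    intro a ha
    calc (2 : ℝ) = 2 / r₀ * r₀ := by field_simp
      _ ≤ C' * a := by gcongr
  refine ⟨C', r₀, le_max_left _ _, hr₀, ?_, ?_, ?_, ?_⟩
  · intro q hq
    obtain ⟨x, hx, hqx⟩ := hcov q hq
    exact (hg x (htΓ x hx)).finrank_eq q hq (hbig hx hqx)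
  · intro q hq q' hq'
    rcases lt_or_ge ‖q - q'‖ r₀ with hlt | hge
    · obtain ⟨x, hx, hqx⟩ := hcov q hq
      exact ((hg x (htΓ x hx)).mono ((hC₀ x hx).trans hCC') le_rfl).proj_sub_le q hq
        (hbig hx hqx) q' hq' (hbig' hx hqx hlt)
    · have h1 : ‖tangentialProj Γ q‖ ≤ 1 := (tangentSpaceAt Γ q).starProjection_norm_le
      have h2 : ‖tangentialProj Γ q'‖ ≤ 1 := (tangentSpaceAt Γ q').starProjection_norm_le
      refine (norm_sub_le _ _).trans ?_
      linarith [hfar hge]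
  · intro q hq q' hq'
    rcases lt_or_ge ‖q - q'‖ r₀ with hlt | hge
    · obtain ⟨x, hx, hqx⟩ := hcov q hq
      exact ((hg x (htΓ x hx)).mono ((hC₀ x hx).trans hCC') le_rfl).normal_le q hq
        (hbig hx hqx) q' hq' (hbig' hx hqx hlt)
    · rw [norm_sub_rev] at hge
      refine (norm_sub_starProjection_le _ _).trans ?_
      have := hfar hge
      nlinarith [norm_nonneg (q' - q)]
  · intro q hq w hw hwr
    obtain ⟨x, hx, hqx⟩ := hcov q hq
    exact ((hg x (htΓ x hx)).mono ((hC₀ x hx).trans hCC') le_rfl).exists_graph q hq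
      (hbig hx hqx) w hw (hwr.trans (by linarith [hr₁ x hx, hr x (htΓ x hx)]))

end LocalGeometry

/-! ### The closest point projection. -/

section ClosestPoint

variable {d k : ℕ} {Γ : Set (Euc k)} {C r δ₀ : ℝ}

theorem IsTubularRadius.isClosestPoint (hδ : IsTubularRadius Γ δ₀) {x : Euc k}
    (hx : x ∈ Metric.thickening δ₀ Γ) : IsClosestPoint Γ x (closestPoint Γ x) :=
  Classical.epsilon_spec (hδ.2 x hx).exists

/-- The projection onto `T_q Γ` in terms of an orthonormal frame. -/
theorem UniformGeometry.exists_frame (hg : UniformGeometry d Γ C r) {q : Euc k} (hq : q ∈ Γ) :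
    ∃ A : Euc d →ₗᵢ[ℝ] Euc k, (∀ x, tangentialProj Γ q x = A (coordMap A x)) ∧
      ∀ u, A u ∈ tangentSpaceAt Γ q := by
  let e : tangentSpaceAt Γ q ≃ₗᵢ[ℝ] Euc d :=
    (stdOrthonormalBasis ℝ (tangentSpaceAt Γ q)).repr.trans
      (LinearIsometryEquiv.piLpCongrLeft 2 ℝ ℝ (finCongr (hg.finrank_eq q hq)))
  let A : Euc d →ₗᵢ[ℝ] Euc k := (tangentSpaceAt Γ q).subtypeₗᵢ.comp e.symm.toLinearIsometry
  have hA : ∀ u, A u ∈ tangentSpaceAt Γ q := fun u => (e.symm u).2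
  refine ⟨A, fun x => ?_, hA⟩
  refine (tangentSpaceAt Γ q).eq_starProjection_of_mem_of_inner_eq_zero (hA _) fun w hw => ?_
  have hw' : A (e ⟨w, hw⟩) = w := by
    change ((e.symm (e ⟨w, hw⟩) : tangentSpaceAt Γ q) : Euc k) = w
    rw [e.symm_apply_apply]
  rw [← hw', real_inner_comm]
  exact inner_sub_coordMap A _ _

/-- First variation: a point of `Γ` above `t • w` differs from `q + t • w` by `O(t ^ 2)`, so
minimality of the distance gives `2 t ⟪x - q, w⟫ ≤ B t ^ 2`. Letting `t` tend to 0, and replacing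
`w` by `-w`, gives equality. -/
theorem UniformGeometry.inner_eq_zero (hg : UniformGeometry d Γ C r) {x q : Euc k}
    (hq : IsClosestPoint Γ x q) {w : Euc k} (hw : w ∈ tangentSpaceAt Γ q) :
    inner ℝ (x - q) w = 0 := by
  have hC := hg.C_ge
  have hle : ∀ w ∈ tangentSpaceAt Γ q, inner ℝ (x - q) w ≤ 0 := by
    intro w hw
    set B := C ^ 2 * ‖w‖ ^ 2 + 2 * ‖x - q‖ * C ^ 3 * ‖w‖ ^ 2 with hB
    have hB0 : 0 ≤ B := by positivity
    have hstep : ∀ t : ℝ, 0 < t → t * ‖w‖ ≤ r → 2 * inner ℝ (x - q) w ≤ B * t := by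
      intro t ht htr
      obtain ⟨q', hq', h1, h2⟩ := hg.exists_graph q hq.1 (t • w) (Submodule.smul_mem _ _ hw) (by
        rwa [norm_smul, Real.norm_eq_abs, abs_of_pos ht])
      rw [norm_smul, Real.norm_eq_abs, abs_of_pos ht] at h2
      have h3 := hg.normal_le q hq.1 q' hq'
      rw [h1] at h3
      have h4 : ‖x - q‖ ≤ ‖x - q'‖ := by
        rw [← dist_eq_norm, ← dist_eq_norm, hq.2]
        exact Metric.infDist_le_dist_of_mem hq'
      have h5 : x - q' = (x - q) - (q' - q) := by abel
      have h6 : 2 * inner ℝ (x - q) (q' - q) ≤ ‖q' - q‖ ^ 2 := by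
        have := norm_sub_sq_real (x - q) (q' - q)
        rw [← h5] at this
        nlinarith [norm_nonneg (x - q)]
      have h7 : inner ℝ (x - q) (q' - q) =
          t * inner ℝ (x - q) w + inner ℝ (x - q) (q' - q - t • w) := by
        rw [inner_sub_right _ (q' - q), inner_smul_right]; ring
      have h8 := neg_le_of_abs_le (abs_real_inner_le_norm (x - q) (q' - q - t • w))
      have h9 : ‖q' - q‖ ^ 2 ≤ (C * (t * ‖w‖)) ^ 2 := pow_le_pow_left₀ (norm_nonneg _) h2 2
      have h10 : ‖x - q‖ * ‖q' - q - t • w‖ ≤ ‖x - q‖ * (C * (C * (t * ‖w‖)) ^ 2) :=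
        mul_le_mul_of_nonneg_left (h3.trans (mul_le_mul_of_nonneg_left h9 (by linarith)))
          (norm_nonneg _)
      have h11 : t * (2 * inner ℝ (x - q) w) ≤ t * (B * t) := by
        rw [hB]; nlinarith
      exact le_of_mul_le_mul_left h11 ht
    by_contra hpos
    push Not at hpos
    set a := inner ℝ (x - q) w with ha
    have hr := hg.r_pos
    let t := min (r / (‖w‖ + 1)) (a / (B + 1))
    have ht : 0 < t := by positivity
    have h1 := hstep t ht (by
      calc t * ‖w‖ ≤ r / (‖w‖ + 1) * (‖w‖ + 1) := by
            gcongr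
            · exact min_le_left _ _
            · linarith
        _ = r := by field_simp)
    have h2 : B * t ≤ a := by
      calc B * t ≤ (B + 1) * (a / (B + 1)) := by
            gcongr
            · linarith
            · exact min_le_right _ _
        _ = a := by field_simp
    linarith
  refine le_antisymm (hle w hw) ?_
  have := hle (-w) (Submodule.neg_mem _ hw)
  rw [inner_neg_right] at this
  linarith

theorem UniformGeometry.tangentialProj_sub (hg : UniformGeometry d Γ C r) {x q : Euc k}
    (hq : IsClosestPoint Γ x q) : tangentialProj Γ q (x - q) = 0 := by
  refine (Submodule.starProjection_apply_eq_zero_iff _).2 fun w hw => ?_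
  rw [real_inner_comm]
  exact hg.inner_eq_zero hq hw

/-- Since `x - q` is normal and short, it pairs with `q' - q` to at most a quarter of `‖q' - q‖ ^
2`, and similarly for `x' - q'`. Hence `⟪x - x', q - q'⟫ ≥ ‖q - q'‖ ^ 2 / 2`. -/
theorem UniformGeometry.norm_closest_sub_le (hg : UniformGeometry d Γ C r) {x q x' q' : Euc k}
    {s : ℝ} (hs : 4 * C * s ≤ 1) (hq : IsClosestPoint Γ x q) (hq' : IsClosestPoint Γ x' q')
    (hx : Metric.infDist x Γ ≤ s) (hx' : Metric.infDist x' Γ ≤ s) :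
    ‖q - q'‖ ≤ 2 * ‖x - x'‖ := by
  have hC := hg.C_ge
  have key : ∀ {x q q' : Euc k}, IsClosestPoint Γ x q → q' ∈ Γ → Metric.infDist x Γ ≤ s →
      |inner ℝ (x - q) (q' - q)| ≤ 1 / 4 * ‖q' - q‖ ^ 2 := by
    intro x q q' hq hq' hx
    have h1 := hg.normal_le q hq.1 q' hq'
    have h2 : inner ℝ (x - q) (q' - q) =
        inner ℝ (x - q) ((q' - q) - tangentialProj Γ q (q' - q)) := by
      rw [inner_sub_right (x - q) (q' - q), hg.inner_eq_zero hq
        (w := tangentialProj Γ q (q' - q)) (Submodule.starProjection_apply_mem _ _), sub_zero]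
    have h3 : ‖x - q‖ ≤ s := by rw [← dist_eq_norm, hq.2]; exact hx
    rw [h2]
    refine (abs_real_inner_le_norm _ _).trans ?_
    calc ‖x - q‖ * ‖(q' - q) - tangentialProj Γ q (q' - q)‖ ≤ s * (C * ‖q' - q‖ ^ 2) := by
          gcongr
          exact (norm_nonneg _).trans h3
      _ ≤ 1 / 4 * ‖q' - q‖ ^ 2 := by nlinarith [sq_nonneg ‖q' - q‖]
  have h1 := abs_le.1 (key hq hq'.1 hx)
  have h2 := abs_le.1 (key hq' hq.1 hx')
  rw [norm_sub_rev q' q] at h1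
  have h3 : inner ℝ (x - x') (q - q') =
      ‖q - q'‖ ^ 2 - inner ℝ (x - q) (q' - q) - inner ℝ (x' - q') (q - q') := by
    have e : x - x' = (q - q') + (x - q) - (x' - q') := by abel
    have e2 : q' - q = -(q - q') := by abel
    rw [e, inner_sub_left, inner_add_left, real_inner_self_eq_norm_sq, e2, inner_neg_right]
    ring
  have h4 := real_inner_le_norm (x - x') (q - q')
  have h5 : ‖q - q'‖ * ‖q - q'‖ ≤ (2 * ‖x - x'‖) * ‖q - q'‖ := by nlinarith
  rcases (norm_nonneg (q - q')).eq_or_lt with h0 | h0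
  · rw [← h0]; positivity
  · exact le_of_mul_le_mul_right h5 h0

/-- Near `q₀` chords of `Γ` are almost tangential at `q₀`: the deviation from the tangent space at
`q'` and the rotation of that space to the one at `q₀` together cost at most half of the chord. -/
theorem UniformGeometry.norm_sub_le_two_mul_proj (hg : UniformGeometry d Γ C r) {q₀ q q' : Euc k}
    {s : ℝ} (hs : 6 * C * s ≤ 1) (hq₀ : q₀ ∈ Γ) (hq : q ∈ Γ) (hq' : q' ∈ Γ)
    (h : ‖q - q₀‖ ≤ s) (h' : ‖q' - q₀‖ ≤ s) :
    ‖q - q'‖ ≤ 2 * ‖tangentialProj Γ q₀ (q - q')‖ := by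
  have hC := hg.C_ge
  have h1 := hg.normal_le q' hq' q hq
  have h2 := (tangentialProj Γ q' - tangentialProj Γ q₀).le_of_opNorm_le
    (hg.proj_sub_le q' hq' q₀ hq₀) (q - q')
  have h3 : ‖q - q'‖ ≤ 2 * s := by
    have := norm_sub_le (q - q₀) (q' - q₀)
    rw [sub_sub_sub_cancel_right] at this
    linarith
  have e : q - q' = tangentialProj Γ q₀ (q - q') + (((q - q') - tangentialProj Γ q' (q - q')) +
      (tangentialProj Γ q' - tangentialProj Γ q₀) (q - q')) := by
    rw [sub_apply]; abel
  have h4 : ‖q - q'‖ ≤ ‖tangentialProj Γ q₀ (q - q')‖ +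
      (C * ‖q - q'‖ ^ 2 + C * ‖q' - q₀‖ * ‖q - q'‖) := by
    conv_lhs => rw [e]
    exact (norm_add_le _ _).trans (add_le_add le_rfl ((norm_add_le _ _).trans (add_le_add h1 h2)))
  have h5 : C * ‖q - q'‖ ^ 2 + C * ‖q' - q₀‖ * ‖q - q'‖ ≤ 1 / 2 * ‖q - q'‖ := by
    have h6 : C * ‖q - q'‖ + C * ‖q' - q₀‖ ≤ 1 / 2 := by nlinarith
    nlinarith [norm_nonneg (q - q')]
  linarith

end ClosestPoint

/-! ### The discrete manifold as a graph of small slope. -/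

section DiscreteChart

variable {d k : ℕ} {Γ : Set (Euc k)} {C r δ₀ κ h : ℝ} {𝒯 𝒦 : Finset (Finset (Euc k))}

theorem discreteTangentialProj_sub {K : Finset (Euc k)} {y y' : Euc k} (hy : y ∈ simplex K)
    (hy' : y' ∈ simplex K) : discreteTangentialProj K (y - y') = y - y' := by
  refine (Submodule.starProjection_eq_self_iff).2 ?_
  have h1 := convexHull_subset_affineSpan (𝕜 := ℝ) (K : Set (Euc k)) hy
  have h2 := convexHull_subset_affineSpan (𝕜 := ℝ) (K : Set (Euc k)) hy'
  rw [← direction_affineSpan]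
  exact AffineSubspace.vsub_mem_direction h1 h2

theorem simplex_subset_carrier {𝒮 : Finset (Finset (Euc k))} {K : Finset (Euc k)} (hK : K ∈ 𝒮) :
    simplex K ⊆ carrier 𝒮 :=
  subset_biUnion_of_mem (u := fun s => simplex s) (Finset.mem_coe.2 hK)

theorem mem_carrier {𝒮 : Finset (Finset (Euc k))} {y : Euc k} :
    y ∈ carrier 𝒮 ↔ ∃ K ∈ 𝒮, y ∈ simplex K := by
  simp [carrier]

theorem IsDiscreteManifold.norm_closestPoint_sub_le (hM : IsDiscreteManifold d Γ δ₀ κ h 𝒯 𝒦)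
    (hg : UniformGeometry d Γ C r) (hδ : IsTubularRadius Γ δ₀) (hκ : 4 * C * (κ * h ^ 2) ≤ 1)
    {y y' : Euc k} (hy : y ∈ carrier 𝒦) (hy' : y' ∈ carrier 𝒦) :
    ‖closestPoint Γ y - closestPoint Γ y'‖ ≤ 2 * ‖y - y'‖ :=
  hg.norm_closest_sub_le hκ (hδ.isClosestPoint (hM.subset_tube hy))
    (hδ.isClosestPoint (hM.subset_tube hy')) (hM.dist_le y hy) (hM.dist_le y' hy')

/-- The discrete manifold is, near each of its points, a graph with small slope over the tangent
space of `Γ`. -/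
theorem IsDiscreteManifold.exists_chart (hM : IsDiscreteManifold d Γ δ₀ κ h 𝒯 𝒦)
    (hg : UniformGeometry d Γ C r) (hδ : IsTubularRadius Γ δ₀) (hκ0 : 0 ≤ κ) (hh : 0 ≤ h)
    (hκ : 4 * C * (κ * h ^ 2) ≤ 1)
    {R ε : ℝ} (hR : R ≤ r) (hRC : 6 * C ^ 2 * R ≤ 1) (hε : ε ≤ 1)
    (hRε : 2 * (κ * h + 4 * C ^ 2 * R + 2 * C * (κ * h ^ 2)) ≤ ε) {y₀ : Euc k}
    (hy₀ : y₀ ∈ carrier 𝒦) {A : Euc d →ₗᵢ[ℝ] Euc k}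
    (hA : ∀ x, tangentialProj Γ (closestPoint Γ y₀) x = A (coordMap A x))
    (hAmem : ∀ u, A u ∈ tangentSpaceAt Γ (closestPoint Γ y₀)) (hR0 : 0 ≤ R) :
    ∃ Y : Euc d → Euc k, Y 0 = y₀ ∧ (∀ u ∈ Metric.closedBall 0 R, Y u ∈ carrier 𝒦) ∧
      (∀ u ∈ Metric.closedBall 0 R, ∀ v ∈ Metric.closedBall 0 R,
        ‖Y u - Y v - A (u - v)‖ ≤ ε * ‖u - v‖) ∧
      ∀ y ∈ carrier 𝒦, ‖closestPoint Γ y - closestPoint Γ y₀‖ ≤ R →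
        ∃ u ∈ Metric.closedBall 0 R, Y u = y := by
  have hC := hg.C_ge
  set q₀ := closestPoint Γ y₀ with hq₀
  have hq₀Γ : q₀ ∈ Γ := hM.bijOn.mapsTo hy₀
  have hs : 6 * C * (C * R) ≤ 1 := by nlinarith
  -- the graph chart of `Γ`
  have hχ : ∀ u ∈ Metric.closedBall (0 : Euc d) R, ∃ q ∈ Γ,
      tangentialProj Γ q₀ (q - q₀) = A u ∧ ‖q - q₀‖ ≤ C * R := by
    intro u hu
    have hu' : ‖u‖ ≤ R := by simpa using hu
    obtain ⟨q, h1, h2, h3⟩ := hg.exists_graph q₀ hq₀Γ (A u) (hAmem u) (by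
      rw [A.norm_map]; linarith)
    rw [A.norm_map] at h3
    exact ⟨q, h1, h2, h3.trans (by gcongr)⟩
  choose! χ hχΓ hχA hχR using hχ
  have huniq : ∀ u ∈ Metric.closedBall (0 : Euc d) R, ∀ q ∈ Γ, ‖q - q₀‖ ≤ C * R →
      tangentialProj Γ q₀ (q - q₀) = A u → χ u = q := by
    intro u hu q hq hqR hqA
    have h1 := hg.norm_sub_le_two_mul_proj hs hq₀Γ (hχΓ u hu) hq (hχR u hu) hqR
    rw [← sub_sub_sub_cancel_right (χ u) q q₀, map_sub, hχA u hu, hqA, sub_self, norm_zero,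
      mul_zero] at h1
    have := norm_le_zero_iff.1 h1
    rw [sub_sub_sub_cancel_right] at this
    exact sub_eq_zero.1 this
  have hχsub : ∀ u ∈ Metric.closedBall (0 : Euc d) R, ∀ v ∈ Metric.closedBall (0 : Euc d) R,
      tangentialProj Γ q₀ (χ u - χ v) = A (u - v) := by
    intro u hu v hv
    rw [← sub_sub_sub_cancel_right (χ u) (χ v) q₀, map_sub, hχA u hu, hχA v hv, map_sub]
  have hχlip : ∀ u ∈ Metric.closedBall (0 : Euc d) R, ∀ v ∈ Metric.closedBall (0 : Euc d) R,
      ‖χ u - χ v‖ ≤ 2 * ‖u - v‖ := by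
    intro u hu v hv
    have h1 := hg.norm_sub_le_two_mul_proj hs hq₀Γ (hχΓ u hu) (hχΓ v hv) (hχR u hu) (hχR v hv)
    rwa [hχsub u hu v hv, A.norm_map] at h1
  have hχc : ContinuousOn χ (Metric.closedBall 0 R) := by
    refine LipschitzOnWith.continuousOn (K := 2)
      (LipschitzOnWith.of_dist_le_mul fun u hu v hv => ?_)
    rw [dist_eq_norm, dist_eq_norm]
    exact hχlip u hu v hv
  -- the lift to the discrete manifold
  have hlift : ∀ u ∈ Metric.closedBall (0 : Euc d) R, ∃ y ∈ carrier 𝒦, closestPoint Γ y = χ u :=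
    fun u hu => hM.bijOn.surjOn (hχΓ u hu)
  choose! Y hYc hYχ using hlift
  have hpc : ContinuousOn (closestPoint Γ) (carrier 𝒦) := by
    refine LipschitzOnWith.continuousOn (K := 2)
      (LipschitzOnWith.of_dist_le_mul fun u hu v hv => ?_)
    rw [dist_eq_norm, dist_eq_norm]
    exact hM.norm_closestPoint_sub_le hg hδ hκ hu hv
  -- Continuity of `Y` is not yet known. By injectivity of `p` on `Γ_h`, `Y u ∈ K` is equivalent to
  -- `χ u ∈ p(K)`, a closed condition since `χ` is continuous and `p(K)` compact.
  have hpiece_closed : ∀ K ∈ 𝒦, IsClosed (Metric.closedBall (0 : Euc d) R ∩ Y ⁻¹' simplex K) := by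
    intro K hK
    have hcl : IsClosed (closestPoint Γ '' simplex K) :=
      ((isCompact_simplex K).image_of_continuousOn
        (hpc.mono (simplex_subset_carrier hK))).isClosed
    have : Metric.closedBall (0 : Euc d) R ∩ Y ⁻¹' simplex K =
        Metric.closedBall (0 : Euc d) R ∩ χ ⁻¹' (closestPoint Γ '' simplex K) := by
      ext u
      refine and_congr_right fun hu => ⟨fun hy => ⟨Y u, hy, hYχ u hu⟩, ?_⟩
      rintro ⟨y, hy, hyu⟩
      have := hM.bijOn.injOn (hYc u hu) (simplex_subset_carrier hK hy) ((hYχ u hu).trans hyu.symm)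
      simpa only [mem_preimage, this] using hy
    rw [this]
    exact hχc.preimage_isClosed_of_isClosed Metric.isClosed_closedBall hcl
  -- Within one simplex the chord `e` lies in the direction of `K`, hence is nearly tangential at
  -- `q₀`. Its tangential part differs from `A (u - v)` only by the tangential part of the change of
  -- the offsets `Y - χ`, which are normal to `Γ`.
  have hpiece : ∀ K ∈ 𝒦, ∀ u ∈ Metric.closedBall (0 : Euc d) R, Y u ∈ simplex K →
      ∀ v ∈ Metric.closedBall (0 : Euc d) R, Y v ∈ simplex K →
      ‖Y u - Y v - A (u - v)‖ ≤ ε * ‖u - v‖ := by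
    intro K hK u hu huK v hv hvK
    set e := Y u - Y v with he
    have hnu := hδ.isClosestPoint (hM.subset_tube (hYc u hu))
    have hnv := hδ.isClosestPoint (hM.subset_tube (hYc v hv))
    rw [hYχ u hu] at hnu
    rw [hYχ v hv] at hnv
    have hTu := hg.tangentialProj_sub hnu
    have hTv := hg.tangentialProj_sub hnv
    have hχe : ‖χ u - χ v‖ ≤ 2 * ‖e‖ := by
      have := hM.norm_closestPoint_sub_le hg hδ hκ (hYc u hu) (hYc v hv)
      rwa [hYχ u hu, hYχ v hv] at this
    have hnvle : ‖Y v - χ v‖ ≤ κ * h ^ 2 := by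
      rw [← dist_eq_norm, hnv.2]; exact hM.dist_le _ (hYc v hv)
    have hχq := hg.proj_sub_le (χ u) (hχΓ u hu) q₀ hq₀Γ
    have hχR' := hχR u hu
    -- almost tangential
    have h1 : ‖e - tangentialProj Γ q₀ e‖ ≤ (κ * h + C * (C * R)) * ‖e‖ := by
      have hK1 := hM.proj_le K hK (Y u) huK
      rw [hYχ u hu] at hK1
      have e1 : e - tangentialProj Γ q₀ e =
          (tangentialProj Γ (χ u) - tangentialProj Γ q₀) e -
            (tangentialProj Γ (χ u) - discreteTangentialProj K) e := by
        rw [sub_apply, sub_apply,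
          discreteTangentialProj_sub huK hvK, ← he]
        abel
      rw [e1]
      refine (norm_sub_le _ _).trans ?_
      have b1 := (tangentialProj Γ (χ u) - tangentialProj Γ q₀).le_of_opNorm_le
        (hχq.trans (mul_le_mul_of_nonneg_left hχR' (by linarith))) e
      have b2 := (tangentialProj Γ (χ u) - discreteTangentialProj K).le_of_opNorm_le hK1 e
      linarith
    -- the normal offsets
    have h2 : ‖tangentialProj Γ q₀ ((Y u - χ u) - (Y v - χ v))‖ ≤
        (3 * (C * (C * R)) + 2 * (C * (κ * h ^ 2))) * ‖e‖ := by
      -- Each offset is annihilated by the tangential projection at its own foot point, so only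
      -- differences of projections at nearby points remain.
      have e2 : tangentialProj Γ q₀ ((Y u - χ u) - (Y v - χ v)) =
          (tangentialProj Γ (χ u) - tangentialProj Γ (χ v)) (-(Y v - χ v)) -
          (tangentialProj Γ (χ u) - tangentialProj Γ q₀) ((Y u - χ u) - (Y v - χ v)) := by
        rw [map_sub, sub_eq_zero] at hTu hTv
        simp only [sub_apply, map_sub, map_neg, hTu, hTv]
        abel
      rw [e2]
      refine (norm_sub_le _ _).trans ?_
      have b1 := (tangentialProj Γ (χ u) - tangentialProj Γ q₀).le_of_opNorm_le
        (hχq.trans (mul_le_mul_of_nonneg_left hχR' (by linarith))) ((Y u - χ u) - (Y v - χ v))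
      have b2 := (tangentialProj Γ (χ u) - tangentialProj Γ (χ v)).le_of_opNorm_le
        (hg.proj_sub_le (χ u) (hχΓ u hu) (χ v) (hχΓ v hv)) (-(Y v - χ v))
      rw [norm_neg] at b2
      have b3 : ‖(Y u - χ u) - (Y v - χ v)‖ ≤ 3 * ‖e‖ := by
        have : (Y u - χ u) - (Y v - χ v) = e - (χ u - χ v) := by rw [he]; abel
        rw [this]
        exact (norm_sub_le _ _).trans (by linarith)
      have b4 : C * ‖χ u - χ v‖ * ‖Y v - χ v‖ ≤ C * (2 * ‖e‖) * (κ * h ^ 2) := by gcongr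
      have b5 : C * (C * R) * ‖(Y u - χ u) - (Y v - χ v)‖ ≤ C * (C * R) * (3 * ‖e‖) := by gcongr
      linarith
    have h3 : e - A (u - v) =
        (e - tangentialProj Γ q₀ e) + tangentialProj Γ q₀ ((Y u - χ u) - (Y v - χ v)) := by
      have : (Y u - χ u) - (Y v - χ v) = e - (χ u - χ v) := by rw [he]; abel
      rw [this, map_sub (tangentialProj Γ q₀) e, hχsub u hu v hv]
      abel
    have h4 : ‖e - A (u - v)‖ ≤ ε / 2 * ‖e‖ := by
      rw [h3]
      refine (norm_add_le _ _).trans ((add_le_add h1 h2).trans ?_)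
      rw [← add_mul]
      refine mul_le_mul_of_nonneg_right ?_ (norm_nonneg _)
      nlinarith
    have h5 : ‖e‖ ≤ 2 * ‖u - v‖ := by
      have := norm_add_le (e - A (u - v)) (A (u - v))
      rw [sub_add_cancel, A.norm_map] at this
      nlinarith [norm_nonneg e]
    have hε0 : 0 ≤ ε := le_trans (by positivity) hRε
    nlinarith [norm_nonneg e]
  have h0mem : (0 : Euc d) ∈ Metric.closedBall (0 : Euc d) R := by simpa using hR0
  refine ⟨Y, ?_, hYc, ?_, ?_⟩
  · have h1 : χ 0 = q₀ := huniq 0 h0mem q₀ hq₀Γ (by simpa using by positivity) (by simp)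
    exact hM.bijOn.injOn (hYc 0 h0mem) hy₀ (by rw [hYχ 0 h0mem, h1])
  · have := norm_sub_le_of_finite_closed_cover_convex (f := fun u => Y u - A u) (L := ε)
      (convex_closedBall (0 : Euc d) R)
      (S := fun K : 𝒦 => Metric.closedBall (0 : Euc d) R ∩ Y ⁻¹' simplex K.1)
      (fun K => hpiece_closed K K.2)
      (fun u hu => by
        obtain ⟨K, hK, h1⟩ := mem_carrier.1 (hYc u hu)
        exact mem_iUnion.2 ⟨⟨K, hK⟩, hu, h1⟩)
      (by
        rintro ⟨K, hK⟩ u ⟨⟨-, huK⟩, hu⟩ v ⟨⟨-, hvK⟩, hv⟩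
        have := hpiece K hK u hu huK v hv hvK
        rwa [map_sub, sub_sub_sub_comm] at this)
    intro u hu v hv
    have h1 := this u hu v hv
    rwa [sub_sub_sub_comm, ← map_sub] at h1
  · intro y hy hyR
    have hqR : ‖closestPoint Γ y - q₀‖ ≤ C * R := hyR.trans (by nlinarith)
    have hu : coordMap A (closestPoint Γ y - q₀) ∈ Metric.closedBall (0 : Euc d) R := by
      rw [mem_closedBall_zero_iff]
      exact (norm_coordMap_le A _).trans hyR
    refine ⟨_, hu, ?_⟩
    refine hM.bijOn.injOn (hYc _ hu) hy ?_
    rw [hYχ _ hu]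
    exact huniq _ hu _ (hM.bijOn.mapsTo hy) hqR (hA _)

end DiscreteChart

/-! ### Surface measure under bi-Lipschitz maps. -/

section HausdorffImages

variable {X Y : Type*} [MetricSpace X] [MeasurableSpace X] [BorelSpace X]
  [MetricSpace Y] [MeasurableSpace Y] [BorelSpace Y]

theorem euclideanHausdorffMeasure_image_le {f : X → Y} {S : Set X} {K : NNReal} (d : ℕ)
    (hf : LipschitzOnWith K f S) : μHE[d] (f '' S) ≤ (K : ENNReal) ^ d * μHE[d] S := by
  have h := hf.hausdorffMeasure_image_le (d := d) (Nat.cast_nonneg d)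
  rw [ENNReal.rpow_natCast] at h
  rw [Measure.euclideanHausdorffMeasure_def, Measure.euclideanHausdorffMeasure_def,
    Measure.smul_apply, Measure.smul_apply, ENNReal.smul_def, ENNReal.smul_def, smul_eq_mul,
    smul_eq_mul]
  calc _ ≤ _ := mul_le_mul_right h _
    _ = _ := by ring

theorem euclideanHausdorffMeasure_le_image [Nonempty X] {f : X → Y} {S : Set X} {K : NNReal}
    (d : ℕ) (hf : ∀ u ∈ S, ∀ v ∈ S, dist u v ≤ K * dist (f u) (f v)) :
    μHE[d] S ≤ (K : ENNReal) ^ d * μHE[d] (f '' S) := by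
  have hinj : InjOn f S := fun u hu v hv huv => by
    have := hf u hu v hv
    rw [huv, dist_self, mul_zero] at this
    exact dist_le_zero.1 this
  have hg : LipschitzOnWith K (Function.invFunOn f S) (f '' S) := by
    refine LipschitzOnWith.of_dist_le_mul ?_
    rintro _ ⟨u, hu, rfl⟩ _ ⟨v, hv, rfl⟩
    rw [hinj.leftInvOn_invFunOn hu, hinj.leftInvOn_invFunOn hv]
    exact hf u hu v hv
  have := euclideanHausdorffMeasure_image_le d hg
  rwa [hinj.leftInvOn_invFunOn.image_image] at this

end HausdorffImages

/-! ### Measures of simplices and counting of elements. -/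

section MeshMeasure

variable {k : ℕ}

theorem euclideanHausdorffMeasure_affineSubspace_lt_top {d : ℕ} {s : AffineSubspace ℝ (Euc k)}
    (hs : Module.finrank ℝ s.direction = d) {B : Set (Euc k)} (hB : Bornology.IsBounded B)
    (hBs : B ⊆ s) : μHE[d] B < ⊤ := by
  rcases B.eq_empty_or_nonempty with rfl | ⟨x, hx⟩
  · simp
  let e : s.direction ≃ₗᵢ[ℝ] Euc d := (stdOrthonormalBasis ℝ s.direction).repr.trans
      (LinearIsometryEquiv.piLpCongrLeft 2 ℝ ℝ (finCongr hs))
  let f : Euc d → Euc k := fun u => (e.symm u : Euc k) + x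
  have hf : Isometry f := by
    refine Isometry.of_dist_eq fun u v => ?_
    simp only [f, dist_add_right]
    have := e.symm.isometry.dist_eq u v
    rw [← this]; rfl
  have hBf : B ⊆ range f := by
    intro y hy
    refine ⟨e ⟨y - x, AffineSubspace.vsub_mem_direction (hBs hy) (hBs hx)⟩, ?_⟩
    simp [f]
  rw [← image_preimage_eq_of_subset hBf, hf.euclideanHausdorffMeasure_image,
    EuclideanSpace.euclideanHausdorffMeasure_eq_volume]
  obtain ⟨R, hR⟩ := hB.subset_closedBall x
  have : f ⁻¹' B ⊆ Metric.closedBall 0 R := by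
    intro u hu
    have h1 := hR (show f u ∈ B from hu)
    rw [Metric.mem_closedBall] at h1 ⊢
    have h2 : f 0 = x := by simp [f]
    rw [← hf.dist_eq, h2]
    exact h1
  exact (measure_mono this).trans_lt measure_closedBall_lt_top

/-- Bounded parts of the subspace have finite measure in its own dimension, hence measure zero in
any higher one. Applied to common faces, this makes overlaps of simplices null sets. -/
theorem euclideanHausdorffMeasure_affineSubspace_eq_zero {d : ℕ} {s : AffineSubspace ℝ (Euc k)}
    (hs : Module.finrank ℝ s.direction < d) : μHE[d] (s : Set (Euc k)) = 0 := by
  rcases s.eq_bot_or_nonempty with rfl | ⟨x, hx⟩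
  · simp
  have hcov : (s : Set (Euc k)) ⊆ ⋃ n : ℕ, (s : Set (Euc k)) ∩ Metric.closedBall x n := by
    intro y hy
    obtain ⟨n, hn⟩ := exists_nat_ge (dist y x)
    exact mem_iUnion.2 ⟨n, hy, hn⟩
  refine measure_mono_null hcov (measure_iUnion_null fun n => ?_)
  rcases Measure.euclideanHausdorffMeasure_zero_or_top hs
    ((s : Set (Euc k)) ∩ Metric.closedBall x n) with h | h
  · exact h
  · exact absurd h (euclideanHausdorffMeasure_affineSubspace_lt_top rfl
      (Metric.isBounded_closedBall.subset inter_subset_right) inter_subset_left).ne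

theorem euclideanHausdorffMeasure_simplex_lt_top {d : ℕ} {𝒦 : Finset (Finset (Euc k))}
    (h : IsConformingMesh d 𝒦) {K : Finset (Euc k)} (hK : K ∈ 𝒦) : μHE[d] (simplex K) < ⊤ := by
  refine euclideanHausdorffMeasure_affineSubspace_lt_top (s := affineSpan ℝ (K : Set (Euc k)))
    ?_ (isCompact_simplex K).isBounded (convexHull_subset_affineSpan _)
  rw [direction_affineSpan]
  have h1 := (h.affineIndependent K hK).finrank_vectorSpan (n := d) (by
    simpa using h.card_eq K hK)
  have h2 : ∀ S : Set (Euc k), range ((↑) : K → Euc k) = S →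
      Module.finrank ℝ (vectorSpan ℝ S) = d := by
    rintro _ rfl
    exact h1
  exact h2 _ Subtype.range_coe

theorem euclideanHausdorffMeasure_simplex_inter {d : ℕ} {𝒦 : Finset (Finset (Euc k))}
    (h : IsConformingMesh d 𝒦) {K K' : Finset (Euc k)} (hK : K ∈ 𝒦) (hK' : K' ∈ 𝒦)
    (hne : K ≠ K') : μHE[d] (simplex K ∩ simplex K') = 0 := by
  classical
  rw [h.inter_eq K hK K' hK', ← Finset.coe_inter]
  rcases (K ∩ K').eq_empty_or_nonempty with h0 | h0
  · simp [h0]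
  refine measure_mono_null (convexHull_subset_affineSpan _)
    (euclideanHausdorffMeasure_affineSubspace_eq_zero ?_)
  obtain ⟨n, hn⟩ : ∃ n, (K ∩ K').card = n + 1 :=
    ⟨(K ∩ K').card - 1, by have := h0.card_pos; omega⟩
  have h1 := finrank_vectorSpan_image_finset_le ℝ (id : Euc k → Euc k) _ hn
  rw [Finset.image_id] at h1
  rw [direction_affineSpan]
  have := card_inter_le_of_ne h hK hK' hne
  omega

theorem volume_simplex_inter {𝒯 : Finset (Finset (Euc k))} (h : IsConformingMesh k 𝒯)
    {T T' : Finset (Euc k)} (hT : T ∈ 𝒯) (hT' : T' ∈ 𝒯) (hne : T ≠ T') :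
    volume (simplex T ∩ simplex T') = 0 := by
  rw [← EuclideanSpace.euclideanHausdorffMeasure_eq_volume]
  exact euclideanHausdorffMeasure_simplex_inter h hT hT' hne

/-- The volume of the unit ball of `ℝᵏ`. -/
noncomputable def unitBallVolume (k : ℕ) : ℝ := (volume (Metric.ball (0 : Euc k) 1)).toReal

theorem unitBallVolume_pos (k : ℕ) : 0 < unitBallVolume k :=
  ENNReal.toReal_pos (Metric.measure_ball_pos _ _ one_pos).ne' measure_ball_lt_top.ne

theorem volume_closedBall_toReal (x : Euc k) {r : ℝ} (hr : 0 ≤ r) :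
    (volume (Metric.closedBall x r)).toReal = r ^ k * unitBallVolume k := by
  rw [Measure.addHaar_closedBall _ _ hr, finrank_euclideanSpace_fin, ENNReal.toReal_mul,
    ENNReal.toReal_ofReal (by positivity), unitBallVolume]

/-- Packing: the open inscribed balls of distinct elements are disjoint, as their intersection is
open and null, and they all fit into a ball of radius `R h`. -/
theorem card_le_of_simplex_subset_closedBall {𝒯 𝒮 : Finset (Finset (Euc k))} {σ h R : ℝ}
    (h𝒯 : IsConformingMesh k 𝒯) (hσ : 0 < σ) (hh : 0 < h) (hR : 0 ≤ R)
    (hball : ∀ T ∈ 𝒯, ∃ x, Metric.closedBall x (h / σ) ⊆ simplex T) (h𝒮 : 𝒮 ⊆ 𝒯) {z : Euc k}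
    (hz : ∀ T ∈ 𝒮, simplex T ⊆ Metric.closedBall z (R * h)) : (𝒮.card : ℝ) ≤ (R * σ) ^ k := by
  choose! x hx using hball
  have hsub : ∀ T ∈ 𝒮, Metric.ball (x T) (h / σ) ⊆ simplex T := fun T hT =>
    Metric.ball_subset_closedBall.trans (hx T (h𝒮 hT))
  have hdisj : (𝒮 : Set (Finset (Euc k))).PairwiseDisjoint fun T => Metric.ball (x T) (h / σ) := by
    intro T hT T' hT' hne
    rw [Function.onFun, disjoint_iff_inter_eq_empty]
    rw [← (Metric.isOpen_ball.inter Metric.isOpen_ball).measure_eq_zero_iff (volume : Measure (Euc k))]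
    exact measure_mono_null (inter_subset_inter (hsub T hT) (hsub T' hT'))
      (volume_simplex_inter h𝒯 (h𝒮 hT) (h𝒮 hT') hne)
  have h1 : volume (⋃ T ∈ 𝒮, Metric.ball (x T) (h / σ)) ≤ volume (Metric.closedBall z (R * h)) :=
    measure_mono (iUnion₂_subset fun T hT => (hsub T hT).trans (hz T hT))
  rw [measure_biUnion_finset hdisj fun T _ => Metric.isOpen_ball.measurableSet] at h1
  have h2 := ENNReal.toReal_mono measure_closedBall_lt_top.ne h1
  rw [ENNReal.toReal_sum fun T _ => measure_ball_lt_top.ne,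
    volume_closedBall_toReal _ (by positivity)] at h2
  have h3 : ∀ T ∈ 𝒮, (volume (Metric.ball (x T) (h / σ))).toReal =
      (h / σ) ^ k * unitBallVolume k := by
    intro T _
    rw [Measure.addHaar_ball_of_pos _ _ (by positivity), finrank_euclideanSpace_fin, ENNReal.toReal_mul,
      ENNReal.toReal_ofReal (by positivity), unitBallVolume]
  rw [Finset.sum_congr rfl h3, Finset.sum_const, nsmul_eq_mul, ← mul_assoc] at h2
  have h4 := le_of_mul_le_mul_right h2 (unitBallVolume_pos k)
  have h5 : (h / σ) ^ k * (R * σ) ^ k = (R * h) ^ k := by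
    rw [← mul_pow]
    congr 1
    field_simp
  have h6 : 0 < (h / σ) ^ k := by positivity
  rw [← h5, mul_comm] at h4
  exact le_of_mul_le_mul_left h4 h6

end MeshMeasure

/-! ### Inverse estimates for affine functions. -/

section AffineEstimates

variable {k : ℕ}

/-- Move from the centre by `r / 2` along the gradient, in the direction that increases the absolute
value. There the function has size at least `r / 2 * ‖b‖`, and it varies by at most half of that on
the ball of radius `r / 4`. -/
theorem exists_closedBall_le_abs_affine (β : ℝ) (b z : Euc k) {r : ℝ} (hr : 0 ≤ r) :
    ∃ z', Metric.closedBall z' (r / 4) ⊆ Metric.closedBall z r ∧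
      ∀ x ∈ Metric.closedBall z' (r / 4), r / 4 * ‖b‖ ≤ |β + inner ℝ b x| := by
  rcases eq_or_ne b 0 with rfl | hb
  · exact ⟨z, Metric.closedBall_subset_closedBall (by linarith), fun x _ => by simp⟩
  have hb0 : 0 < ‖b‖ := norm_pos_iff.2 hb
  obtain ⟨s, hs, hsβ⟩ : ∃ s : ℝ, |s| = 1 ∧ 0 ≤ s * (β + inner ℝ b z) := by
    rcases le_total 0 (β + inner ℝ b z) with h | h
    · exact ⟨1, abs_one, by linarith⟩
    · exact ⟨-1, by simp, by linarith⟩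
  have hs2 : s * s = 1 := by rw [← abs_mul_abs_self, hs, one_mul]
  set z' := z + (s * (r / 2) / ‖b‖) • b with hz'
  have hzz : ‖z' - z‖ = r / 2 := by
    rw [hz', add_sub_cancel_left, norm_smul, Real.norm_eq_abs, abs_div, abs_mul, hs, abs_norm,
      abs_of_nonneg (by linarith), one_mul, div_mul_cancel₀ _ hb0.ne']
  refine ⟨z', Metric.closedBall_subset_closedBall' (by rw [dist_eq_norm, hzz]; linarith),
    fun x hx => ?_⟩
  rw [mem_closedBall_iff_norm] at hx
  have e : s * (β + inner ℝ b x) =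
      s * (β + inner ℝ b z) + r / 2 * ‖b‖ + s * inner ℝ b (x - z') := by
    have h1 : inner ℝ b (x - z') = inner ℝ b x - inner ℝ b z - s * (r / 2) * ‖b‖ := by
      rw [hz', inner_sub_right, inner_add_right, inner_smul_right, real_inner_self_eq_norm_sq]
      field_simp
      ring
    rw [h1]
    linear_combination ((r / 2) * ‖b‖) * hs2
  have h2 : |s * inner ℝ b (x - z')| ≤ r / 4 * ‖b‖ := by
    rw [abs_mul, hs, one_mul]
    refine (abs_real_inner_le_norm _ _).trans ?_
    rw [mul_comm]
    gcongr
  have h3 : |β + inner ℝ b x| = |s * (β + inner ℝ b x)| := by rw [abs_mul, hs, one_mul]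
  rw [h3]
  refine le_trans ?_ (le_abs_self _)
  rw [e]
  linarith [(abs_le.1 h2).1]

/-- Inverse estimate for affine functions on a shape regular element. -/
theorem norm_sq_le_integral_affine {T : Finset (Euc k)} {r : ℝ} (hr : 0 ≤ r)
    {z : Euc k} (hz : Metric.closedBall z r ⊆ simplex T) (β : ℝ) (b : Euc k) :
    (r / 4) ^ 2 * ‖b‖ ^ 2 * ((r / 4) ^ k * unitBallVolume k) ≤
      ∫ x in simplex T, (β + inner ℝ b x) ^ 2 := by
  obtain ⟨z', hz', hle⟩ := exists_closedBall_le_abs_affine β b z hr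
  have hint : IntegrableOn (fun x => (β + inner ℝ b x) ^ 2) (simplex T) :=
    (Continuous.continuousOn (by fun_prop)).integrableOn_compact (isCompact_simplex T)
  have hsub := hz'.trans hz
  calc (r / 4) ^ 2 * ‖b‖ ^ 2 * ((r / 4) ^ k * unitBallVolume k)
      = ∫ _ in Metric.closedBall z' (r / 4), (r / 4 * ‖b‖) ^ 2 := by
        rw [setIntegral_const, smul_eq_mul, Measure.real,
          volume_closedBall_toReal _ (by positivity)]
        ring
    _ ≤ ∫ x in Metric.closedBall z' (r / 4), (β + inner ℝ b x) ^ 2 := by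
        refine setIntegral_mono_on (integrableOn_const measure_closedBall_lt_top.ne)
          (hint.mono_set hsub) Metric.isClosed_closedBall.measurableSet fun x hx => ?_
        rw [← sq_abs (β + inner ℝ b x)]
        exact pow_le_pow_left₀ (by positivity) (hle x hx) 2
    _ ≤ _ := setIntegral_mono_set hint (ae_of_all _ fun x => sq_nonneg _)
        (LE.le.eventuallyLE hsub)

theorem volume_simplex_le {T : Finset (Euc k)} {r : ℝ} (hT : Metric.diam (simplex T) ≤ r)
    (hne : (simplex T).Nonempty) :
    (volume (simplex T)).toReal ≤ r ^ k * unitBallVolume k := by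
  obtain ⟨x, hx⟩ := hne
  have hr : 0 ≤ r := Metric.diam_nonneg.trans hT
  rw [← volume_closedBall_toReal x hr]
  refine ENNReal.toReal_mono measure_closedBall_lt_top.ne (measure_mono fun y hy => ?_)
  rw [mem_closedBall_iff_norm]
  exact norm_sub_le_of_mem_simplex hT hy hx

end AffineEstimates

/-! ### Gradients of finite element functions. -/

section Gradients

variable {k : ℕ}

theorem IsP1Function.exists_affine {𝒮 : Finset (Finset (Euc k))} {v : Euc k → ℝ}
    (hv : IsP1Function 𝒮 v) : ∃ (β : Finset (Euc k) → ℝ) (b : Finset (Euc k) → Euc k),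
      ∀ T ∈ 𝒮, ∀ x ∈ simplex T, v x = β T + inner ℝ (b T) x := by
  have : ∀ T ∈ 𝒮, ∃ (β : ℝ) (b : Euc k), ∀ x ∈ simplex T, v x = β + inner ℝ b x := by
    intro T hT
    obtain ⟨a, ha⟩ := hv.2 T hT
    refine ⟨a 0, (InnerProductSpace.toDual ℝ (Euc k)).symm
      (LinearMap.toContinuousLinearMap a.linear), fun x hx => ?_⟩
    rw [ha x hx, InnerProductSpace.toDual_symm_apply]
    have := a.map_vadd 0 x
    simp only [vadd_eq_add, add_zero] at this
    rw [this, add_comm]; rfl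
  choose! β b h using this
  exact ⟨β, b, h⟩

theorem hasFDerivWithinAt_of_eq_affine {v : Euc k → ℝ} {S : Set (Euc k)} {β : ℝ} {b : Euc k}
    (h : ∀ x ∈ S, v x = β + inner ℝ b x) {x : Euc k} (hx : x ∈ S) :
    HasFDerivWithinAt v (innerSL ℝ b) S x := by
  have h1 : HasFDerivWithinAt (fun x => β + innerSL ℝ b x) (innerSL ℝ b) S x :=
    ((innerSL ℝ b).hasFDerivWithinAt).const_add β
  exact h1.congr (fun y hy => h y hy) (h x hx)

/-- Derivatives within `S` need not be unique when `S` has empty interior, but any two agree on the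
tangent cone, which contains `y - x` by convexity. -/
theorem inner_gradientWithin_eq {v : Euc k → ℝ} {S : Set (Euc k)} {β : ℝ} {b : Euc k}
    (hS : Convex ℝ S) (h : ∀ x ∈ S, v x = β + inner ℝ b x) {x y : Euc k} (hx : x ∈ S)
    (hy : y ∈ S) : inner ℝ (gradientWithin v S x) (y - x) = inner ℝ b (y - x) := by
  have h1 := hasFDerivWithinAt_of_eq_affine h hx
  have h2 : HasFDerivWithinAt v (fderivWithin ℝ v S x) S x :=
    h1.differentiableWithinAt.hasFDerivWithinAt
  have h3 : y - x ∈ tangentConeAt ℝ S x :=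
    mem_tangentConeAt_of_segment_subset (hS.segment_subset hx hy)
  have h4 := h2.unique_on h1 h3
  rw [gradientWithin, InnerProductSpace.toDual_symm_apply, h4]
  simp

theorem discreteTangentialProj_gradientWithin {v : Euc k → ℝ} {K : Finset (Euc k)} {β : ℝ}
    {b : Euc k} (h : ∀ x ∈ simplex K, v x = β + inner ℝ b x) {x : Euc k} (hx : x ∈ simplex K) :
    discreteTangentialProj K (gradientWithin v (simplex K) x) = discreteTangentialProj K b := by
  rw [← sub_eq_zero, ← map_sub]
  refine (Submodule.starProjection_apply_eq_zero_iff _).2 ?_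
  have hspan : vectorSpan ℝ (K : Set (Euc k)) ≤
      (Submodule.span ℝ {gradientWithin v (simplex K) x - b})ᗮ := by
    have h1 : vectorSpan ℝ (K : Set (Euc k)) ≤
        Submodule.span ℝ ((· - x) '' (simplex K)) := by
      have hxs : x ∈ affineSpan ℝ (K : Set (Euc k)) := convexHull_subset_affineSpan _ hx
      have e1 : affineSpan ℝ (simplex K) = affineSpan ℝ (K : Set (Euc k)) :=
        affineSpan_convexHull _
      rw [← direction_affineSpan, ← e1, direction_affineSpan,
        vectorSpan_eq_span_vsub_set_right ℝ hx]
      rfl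
    refine h1.trans (Submodule.span_le.2 ?_)
    rintro _ ⟨y, hy, rfl⟩
    refine (Submodule.mem_orthogonal_singleton_iff_inner_right).2 ?_
    rw [inner_sub_left, inner_gradientWithin_eq (convex_simplex K) h hx hy, sub_self]
  intro w hw
  rw [real_inner_comm]
  exact (Submodule.mem_orthogonal_singleton_iff_inner_right).1 (hspan hw)

theorem gradientWithin_eq_of_affine {v : Euc k → ℝ} {T : Finset (Euc k)} {β : ℝ} {b : Euc k}
    (hspan : affineSpan ℝ (T : Set (Euc k)) = ⊤) (h : ∀ x ∈ simplex T, v x = β + inner ℝ b x)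
    {x : Euc k} (hx : x ∈ simplex T) : gradientWithin v (simplex T) x = b := by
  have h1 := discreteTangentialProj_gradientWithin h hx
  have h2 : ∀ w, discreteTangentialProj T w = w := by
    intro w
    refine (Submodule.starProjection_eq_self_iff).2 ?_
    rw [← direction_affineSpan, hspan, AffineSubspace.direction_top]
    trivial
  rwa [h2, h2] at h1

end Gradients

/-! ### Variation of a function along a chain. -/

section Chains

/-- Cut the chain at its last visit to `a`; what follows never returns there. -/
theorem reflTransGen_of_avoiding {α : Type*} {R : α → α → Prop} {a b x : α} (hab : b ≠ a)
    (h : Relation.ReflTransGen R x b) :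
    (x ≠ a ∧ Relation.ReflTransGen (fun y z => R y z ∧ y ≠ a ∧ z ≠ a) x b) ∨
      ∃ a', R a a' ∧ a' ≠ a ∧ Relation.ReflTransGen (fun y z => R y z ∧ y ≠ a ∧ z ≠ a) a' b := by
  induction h using Relation.ReflTransGen.head_induction_on with
  | refl => exact Or.inl ⟨hab, .refl⟩
  | @head x y hxy _ ih =>
    rcases ih with ⟨hy, h⟩ | h
    · by_cases hx : x = a
      · exact Or.inr ⟨y, hx ▸ hxy, hy, h⟩
      · exact Or.inl ⟨hx, .head ⟨hxy, hx, hy⟩ h⟩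
    · exact Or.inr h

/-- A function that varies by at most `ε` along each step varies by at most `ε |s|` along a chain
in the finite set `s`. -/
theorem abs_sub_le_card_mul_of_reflTransGen {α : Type*} [DecidableEq α] {g : α → ℝ} {ε : ℝ}
    (hε : 0 ≤ ε) :
    ∀ (n : ℕ) (s : Finset α) (R : α → α → Prop) (a b : α), s.card ≤ n →
      (∀ x y, R x y → x ∈ s ∧ y ∈ s ∧ |g x - g y| ≤ ε) → Relation.ReflTransGen R a b →
      |g a - g b| ≤ n * ε := by
  intro n
  induction n with
  | zero =>
    intro s R a b hs hR h
    have hs0 : s = ∅ := Finset.card_eq_zero.1 (by omega)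
    rcases h.cases_head with rfl | ⟨y, hy, -⟩
    · simp
    · exact absurd (hR _ _ hy).1 (by simp [hs0])
  | succ n ih =>
    intro s R a b hs hR h
    by_cases hab : b = a
    · subst hab
      simp only [sub_self, abs_zero]
      positivity
    -- After the last visit to `a` the chain stays in `s.erase a`, so the number of elements, not
    -- the length of the chain, enters the bound.
    have key : ∃ a', R a a' ∧ a' ≠ a ∧
        Relation.ReflTransGen (fun y z => R y z ∧ y ≠ a ∧ z ≠ a) a' b := by
      rcases reflTransGen_of_avoiding hab h with ⟨h1, -⟩ | h1
      · exact absurd rfl h1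
      · exact h1
    obtain ⟨a', h1, -, h3⟩ := key
    have h4 := ih (s.erase a) _ a' b (by
      rw [Finset.card_erase_of_mem (hR _ _ h1).1]; omega) (fun x y hxy => ⟨
        Finset.mem_erase.2 ⟨hxy.2.1, (hR _ _ hxy.1).1⟩,
        Finset.mem_erase.2 ⟨hxy.2.2, (hR _ _ hxy.1).2.1⟩, (hR _ _ hxy.1).2.2⟩) h3
    have h5 := abs_sub_le (g a) (g a') (g b)
    have h6 := (hR _ _ h1).2.2
    push_cast
    linarith

end Chains

/-! ### The estimate on one patch of the discrete manifold. -/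

section LocalEstimate

variable {k d : ℕ}

/-- By continuity the jump `b T - b T'` is orthogonal to the common face. Its normal part is at most
`2 δ`, so goodness of the face bounds the full jump by `2 δ / η`. The affine functions agree at a
common vertex within distance `L` of `z`. -/
theorem abs_affine_sub_le_of_faceAdj {𝒜 : Finset (Finset (Euc k))} {A : Euc d →ₗᵢ[ℝ] Euc k}
    {η δ L : ℝ} (hη : 0 < η) {β : Finset (Euc k) → ℝ} {b : Finset (Euc k) → Euc k} {z : Euc k}
    (hz : ∀ T ∈ 𝒜, simplex T ⊆ Metric.closedBall z L)
    (hδ : ∀ T ∈ 𝒜, ‖b T - A (coordMap A (b T))‖ ≤ δ)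
    (hcont : ∀ T ∈ 𝒜, ∀ T' ∈ 𝒜, ∀ x ∈ simplex T ∩ simplex T',
      β T + inner ℝ (b T) x = β T' + inner ℝ (b T') x)
    {T T' : Finset (Euc k)} (h : FaceAdj 𝒜 (IsGoodFace A η) T T') :
    |(β T + inner ℝ (b T) z) - (β T' + inner ℝ (b T') z)| ≤ 2 * δ / η * L := by
  obtain ⟨hT, hT', ⟨x, hxT, hxT'⟩, hgood⟩ := h
  have hmem : ∀ y ∈ (T : Set (Euc k)) ∩ T', y ∈ simplex T ∩ simplex T' := fun y hy =>
    ⟨subset_convexHull ℝ _ hy.1, subset_convexHull ℝ _ hy.2⟩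
  have hval : ∀ y ∈ (T : Set (Euc k)) ∩ T', inner ℝ (b T - b T') y = β T' - β T := by
    intro y hy
    have := hcont T hT T' hT' y (hmem y hy)
    rw [inner_sub_left]
    linarith
  have h1 := hgood (b T - b T') fun y hy y' hy' => by
    rw [inner_sub_right, hval y hy, hval y' hy', sub_self]
  have h2 : ‖b T - b T' - A (coordMap A (b T - b T'))‖ ≤ 2 * δ := by
    have e : b T - b T' - A (coordMap A (b T - b T')) =
        (b T - A (coordMap A (b T))) - (b T' - A (coordMap A (b T'))) := by
      rw [map_sub (coordMap A) (b T) (b T'), map_sub A (coordMap A (b T)) (coordMap A (b T'))]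
      abel
    rw [e]
    refine (norm_sub_le _ _).trans ?_
    linarith [hδ T hT, hδ T' hT']
  have h3 : ‖b T - b T'‖ ≤ 2 * δ / η := by
    rw [le_div_iff₀ hη]; linarith
  have h4 : ‖z - x‖ ≤ L := by
    rw [← dist_eq_norm, dist_comm]
    exact hz T hT (hmem x ⟨hxT, hxT'⟩).1
  have e : (β T + inner ℝ (b T) z) - (β T' + inner ℝ (b T') z) =
      inner ℝ (b T - b T') (z - x) := by
    rw [inner_sub_right, hval x ⟨hxT, hxT'⟩, inner_sub_left]
    ring
  rw [e]
  exact (abs_real_inner_le_norm _ _).trans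
    (mul_le_mul h3 h4 (norm_nonneg _) ((norm_nonneg _).trans h3))

/-- An affine function is large on part of each ball of a graph with small slope. -/
theorem exists_subball_le_affine {A : Euc d →ₗᵢ[ℝ] Euc k} {Y : Euc d → Euc k} {h δ ρ : ℝ}
    (hh : 0 < h) (hρ : 0 < ρ) {S : Set (Euc d)}
    (hY : ∀ u ∈ S, ∀ v ∈ S, ‖Y u - Y v - h • A (u - v)‖ ≤ 1 / 4 * h * ‖u - v‖)
    {u₁ : Euc d} (hu₁ : Metric.closedBall u₁ ρ ⊆ S) (β : ℝ) (b : Euc k)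
    (hb : ‖b - A (coordMap A b)‖ ≤ δ) :
    ∃ u₂, Metric.closedBall u₂ (ρ / 8) ⊆ Metric.closedBall u₁ ρ ∧
      ∀ u ∈ Metric.closedBall u₂ (ρ / 8),
        h * ‖b‖ ≤ 32 / (7 * ρ) * |β + inner ℝ b (Y u)| + 3 * (h * δ) := by
  set a := coordMap A b with ha
  have hab : ‖b‖ ≤ ‖a‖ + δ := by
    have := norm_add_le (b - A a) (A a)
    rw [sub_add_cancel, A.norm_map] at this
    linarith
  obtain ⟨s, hs, hsβ⟩ : ∃ s : ℝ, |s| = 1 ∧ 0 ≤ s * (β + inner ℝ b (Y u₁)) := by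
    rcases le_total 0 (β + inner ℝ b (Y u₁)) with h | h
    · exact ⟨1, abs_one, by linarith⟩
    · exact ⟨-1, by simp, by linarith⟩
  have hs2 : s * s = 1 := by rw [← abs_mul_abs_self, hs, one_mul]
  -- A step of length `ρ / 2` along the tangential gradient, with the sign that increases the
  -- absolute value. If `a = 0`, the quotient is 0 by convention and `w = 0`, which is harmless.
  set w : Euc d := (s * (ρ / 2) / ‖a‖) • a with hw
  have hwn : ‖w‖ ≤ ρ / 2 := by
    rw [hw, norm_smul, Real.norm_eq_abs, abs_div, abs_mul, hs, abs_norm,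
      abs_of_pos (half_pos hρ), one_mul]
    rcases eq_or_ne ‖a‖ 0 with h0 | h0
    · rw [h0, mul_zero]; positivity
    · rw [div_mul_cancel₀ _ h0]
  have hwa : inner ℝ a w = s * (ρ / 2) * ‖a‖ := by
    rw [hw, inner_smul_right, real_inner_self_eq_norm_sq]
    rcases eq_or_ne ‖a‖ 0 with h0 | h0
    · simp [h0]
    · field_simp
  have hsub : Metric.closedBall (u₁ + w) (ρ / 8) ⊆ Metric.closedBall u₁ ρ :=
    Metric.closedBall_subset_closedBall' (by
      rw [dist_eq_norm, add_sub_cancel_left]; linarith)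
  refine ⟨u₁ + w, hsub, fun u hu => ?_⟩
  have hu₁S : u₁ ∈ S := hu₁ (Metric.mem_closedBall_self hρ.le)
  have hu₂S : u₁ + w ∈ S := hu₁ (hsub (Metric.mem_closedBall_self (by positivity)))
  have huS : u ∈ S := hu₁ (hsub hu)
  have huw : ‖u - (u₁ + w)‖ ≤ ρ / 8 := by rwa [← mem_closedBall_iff_norm]
  have hAin : ∀ x : Euc d, inner ℝ b (A x) = inner ℝ a x := fun x => (coordMap_inner A x b).symm
  have e1 : |inner ℝ b (Y (u₁ + w)) - inner ℝ b (Y u₁) - h * (s * (ρ / 2) * ‖a‖)| ≤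
      ‖b‖ * (1 / 4 * h * (ρ / 2)) := by
    have h1 := hY _ hu₂S _ hu₁S
    rw [add_sub_cancel_left] at h1
    have h2 : inner ℝ b (Y (u₁ + w)) - inner ℝ b (Y u₁) - h * (s * (ρ / 2) * ‖a‖) =
        inner ℝ b (Y (u₁ + w) - Y u₁ - h • A w) := by
      rw [inner_sub_right, inner_sub_right, inner_smul_right, hAin, hwa]
    rw [h2]
    refine (abs_real_inner_le_norm _ _).trans ?_
    gcongr
    exact h1.trans (by gcongr)
  have e2 : |inner ℝ b (Y u) - inner ℝ b (Y (u₁ + w))| ≤ ‖b‖ * (5 / 4 * h * (ρ / 8)) := by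
    have h1 := hY _ huS _ hu₂S
    have h2 := norm_add_le (Y u - Y (u₁ + w) - h • A (u - (u₁ + w))) (h • A (u - (u₁ + w)))
    rw [sub_add_cancel, norm_smul, A.norm_map, Real.norm_eq_abs, abs_of_pos hh] at h2
    rw [← inner_sub_right]
    refine (abs_real_inner_le_norm _ _).trans ?_
    gcongr
    calc _ ≤ 5 / 4 * h * ‖u - (u₁ + w)‖ := by linarith
      _ ≤ _ := by gcongr
  have e3 : h * (ρ / 2) * ‖a‖ - ‖b‖ * (1 / 4 * h * (ρ / 2)) - ‖b‖ * (5 / 4 * h * (ρ / 8)) ≤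
      |β + inner ℝ b (Y u)| := by
    set X := inner ℝ b (Y (u₁ + w)) - inner ℝ b (Y u₁) - h * (s * (ρ / 2) * ‖a‖)
    set Z := inner ℝ b (Y u) - inner ℝ b (Y (u₁ + w))
    have h1 : |β + inner ℝ b (Y u)| = |s * (β + inner ℝ b (Y u))| := by rw [abs_mul, hs, one_mul]
    have h2 : s * (β + inner ℝ b (Y u)) =
        s * (β + inner ℝ b (Y u₁)) + h * (ρ / 2) * ‖a‖ + s * X + s * Z := by
      simp only [X, Z]
      linear_combination (h * (ρ / 2) * ‖a‖) * hs2
    have h3 : |s * X| ≤ ‖b‖ * (1 / 4 * h * (ρ / 2)) := by rwa [abs_mul, hs, one_mul]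
    have h4 : |s * Z| ≤ ‖b‖ * (5 / 4 * h * (ρ / 8)) := by rwa [abs_mul, hs, one_mul]
    rw [h1]
    refine le_trans ?_ (le_abs_self _)
    rw [h2]
    linarith [(abs_le.1 h3).1, (abs_le.1 h4).1]
  have hδ0 : 0 ≤ δ := (norm_nonneg _).trans hb
  have e4 : h * (ρ / 2) * ‖b‖ ≤ h * (ρ / 2) * (‖a‖ + δ) := by gcongr
  -- `1/2 - 1/8 - 5/32 = 7/32`: the gain along the gradient, minus the slope error over the step and
  -- the variation of the function over the small ball.
  have e5 : 7 * ρ / 32 * (h * ‖b‖) ≤ |β + inner ℝ b (Y u)| + ρ / 2 * (h * δ) := by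
    nlinarith [e3, e4]
  have e6 : h * ‖b‖ = 32 / (7 * ρ) * (7 * ρ / 32 * (h * ‖b‖)) := by field_simp
  rw [e6]
  refine (mul_le_mul_of_nonneg_left e5 (by positivity)).trans ?_
  rw [mul_add]
  have e7 : 32 / (7 * ρ) * (ρ / 2 * (h * δ)) = 16 / 7 * (h * δ) := by field_simp; ring
  rw [e7]
  have : 0 ≤ h * δ := by positivity
  linarith

theorem norm_sub_le_of_near_isometry {A : Euc d →ₗᵢ[ℝ] Euc k} {Y : Euc d → Euc k} {h : ℝ}
    (hh : 0 < h) {S : Set (Euc d)}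
    (hY : ∀ u ∈ S, ∀ v ∈ S, ‖Y u - Y v - h • A (u - v)‖ ≤ 1 / 4 * h * ‖u - v‖)
    {u v : Euc d} (hu : u ∈ S) (hv : v ∈ S) : ‖Y u - Y v‖ ≤ 5 / 4 * h * ‖u - v‖ := by
  have h1 := hY u hu v hv
  have h2 := norm_add_le (Y u - Y v - h • A (u - v)) (h • A (u - v))
  rw [sub_add_cancel, norm_smul, A.norm_map, Real.norm_eq_abs, abs_of_pos hh] at h2
  linarith

theorem le_norm_sub_of_near_isometry {A : Euc d →ₗᵢ[ℝ] Euc k} {Y : Euc d → Euc k} {h : ℝ}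
    (hh : 0 < h) {S : Set (Euc d)}
    (hY : ∀ u ∈ S, ∀ v ∈ S, ‖Y u - Y v - h • A (u - v)‖ ≤ 1 / 4 * h * ‖u - v‖)
    {u v : Euc d} (hu : u ∈ S) (hv : v ∈ S) : 3 / 4 * h * ‖u - v‖ ≤ ‖Y u - Y v‖ := by
  have h1 := hY u hu v hv
  have h2 := norm_sub_le (Y u - Y v) (Y u - Y v - h • A (u - v))
  rw [sub_sub_cancel, norm_smul, A.norm_map, Real.norm_eq_abs, abs_of_pos hh] at h2
  linarith

/-- On part of a patch of the discrete manifold, a finite element function controls its affine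
piece on a given element up to normal derivatives. -/
theorem exists_pointwise_estimate (d k N : ℕ) {σ : ℝ} (hσ : 0 < σ) :
    ∃ C > 0, ∃ ρ > 0, ∀ (A : Euc d →ₗᵢ[ℝ] Euc k) (h : ℝ) (𝒜 : Finset (Finset (Euc k)))
      (Y : Euc d → Euc k), 0 < h → IsConformingMesh k 𝒜 → 𝒜.card ≤ N →
      (∀ T ∈ 𝒜, Metric.diam (simplex T) ≤ σ * h) →
      (∀ T ∈ 𝒜, ∃ x, Metric.closedBall x (h / σ) ⊆ simplex T) →
      (∀ u ∈ Metric.closedBall 0 1, ∀ v ∈ Metric.closedBall 0 1,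
        ‖Y u - Y v - h • A (u - v)‖ ≤ 1 / 4 * h * ‖u - v‖) →
      (∀ T ∈ 𝒜, ∃ u ∈ Metric.closedBall 0 1, Y u ∈ simplex T) →
      (∀ u ∈ Metric.closedBall 0 1, ∀ᶠ z in nhds (Y u), ∃ T ∈ 𝒜, z ∈ simplex T) →
      ∀ (v : Euc k → ℝ) (β : Finset (Euc k) → ℝ) (b : Finset (Euc k) → Euc k) (δ : ℝ),
      ContinuousOn v (carrier 𝒜) →
      (∀ T ∈ 𝒜, ∀ x ∈ simplex T, v x = β T + inner ℝ (b T) x) →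
      (∀ T ∈ 𝒜, ‖b T - A (coordMap A (b T))‖ ≤ δ) →
      ∀ T₀ ∈ 𝒜, Y 0 ∈ simplex T₀ → ∀ θ > 0,
        ∃ u₂ : Euc d, Metric.closedBall u₂ ρ ⊆ Metric.closedBall 0 1 ∧
          ∀ u ∈ Metric.closedBall u₂ ρ, |v (Y 0)| + h * ‖b T₀‖ ≤
            C * (|v (Y u)| + h * δ + θ) := by
  classical
  obtain ⟨η, hη, ρ, hρ, hchain⟩ := exists_chain d k N hσ
  set C₁ : ℝ := N * (2 / η * (σ + 4)) with hC₁
  have hC₁0 : 0 ≤ C₁ := by positivity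
  refine ⟨(1 + 72 / (7 * ρ)) * (C₁ + 2) + 7, by positivity, ρ / 8, by positivity, ?_⟩
  intro A h 𝒜 Y hh h𝒜 hN hdiam hball hY hmeet hcov v β b δ hv haff hδ T₀ hT₀ hx₀ θ hθ
  have hδ0 : 0 ≤ δ := (norm_nonneg _).trans (hδ T₀ hT₀)
  have huc : UniformContinuousOn v (carrier 𝒜) :=
    (isCompact_carrier 𝒜).uniformContinuousOn_of_continuous hv
  -- The chain ends at elements containing the shifted point `Y u + e`, while `v` is wanted at `Y
  -- u`. Uniform continuity of `v` makes the effect of the shift at most `θ`.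
  obtain ⟨θ₁, hθ₁, huc⟩ := Metric.uniformContinuousOn_iff.1 huc θ hθ
  set θ₂ : ℝ := min (min θ₁ h) (θ / (‖b T₀‖ + 1)) with hθ₂
  have hθ₂0 : 0 < θ₂ := by positivity
  obtain ⟨e, he, u₁, hu₁, hlink⟩ := hchain A h 𝒜 Y hh h𝒜 hN hdiam hball hY hmeet hcov T₀ hT₀ hx₀
    θ₂ hθ₂0
  obtain ⟨u₂, hu₂, hsub⟩ := exists_subball_le_affine hh hρ hY hu₁ (β T₀) (b T₀) (hδ T₀ hT₀)
  refine ⟨u₂, hu₂.trans hu₁, fun u hu => ?_⟩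
  have huB := hu₁ (hu₂ hu)
  have h0B : (0 : Euc d) ∈ Metric.closedBall (0 : Euc d) 1 := by simp
  obtain ⟨T, hT, hzT, hTT⟩ := hlink u (hu₂ hu)
  obtain ⟨T', hT', hyT'⟩ := (hcov u huB).self_of_nhds
  have he1 : ‖e‖ < θ₁ := he.trans_le ((min_le_left _ _).trans (min_le_left _ _))
  have he2 : ‖e‖ < h := he.trans_le ((min_le_left _ _).trans (min_le_right _ _))
  have he3 : ‖b T₀‖ * ‖e‖ ≤ θ := by
    have h1 : ‖e‖ < θ / (‖b T₀‖ + 1) := he.trans_le (min_le_right _ _)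
    rw [lt_div_iff₀ (by positivity)] at h1
    nlinarith [norm_nonneg e, norm_nonneg (b T₀)]
  have hz : ∀ S ∈ 𝒜, simplex S ⊆ Metric.closedBall (Y u + e) ((σ + 4) * h) := by
    intro S hS x hx
    obtain ⟨u', hu', hyS⟩ := hmeet S hS
    have h1 := norm_sub_le_of_mem_simplex (hdiam S hS) hx hyS
    have h2 := norm_sub_le_of_near_isometry hh hY hu' huB
    have h3 : ‖u' - u‖ ≤ 2 := by
      have := norm_sub_le u' u
      have := mem_closedBall_zero_iff.1 hu'
      have := mem_closedBall_zero_iff.1 huB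
      linarith
    rw [mem_closedBall_iff_norm]
    have e1 : x - (Y u + e) = (x - Y u') + (Y u' - Y u) - e := by abel
    rw [e1]
    have h4 := norm_sub_le ((x - Y u') + (Y u' - Y u)) e
    have h5 := norm_add_le (x - Y u') (Y u' - Y u)
    nlinarith
  -- All affine pieces are compared at the one point `Y u + e`, even those of elements that do not
  -- contain it. Each of the at most `N` elements in the chain costs a multiple of `h δ`.
  have k1 : |(β T₀ + inner ℝ (b T₀) (Y u + e)) - (β T + inner ℝ (b T) (Y u + e))| ≤ C₁ * (h * δ) := by
    have := abs_sub_le_card_mul_of_reflTransGen (g := fun S => β S + inner ℝ (b S) (Y u + e))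
      (ε := 2 * δ / η * ((σ + 4) * h)) (by positivity) N 𝒜 _ T₀ T hN (fun S S' hSS' => ⟨hSS'.1,
        hSS'.2.1, abs_affine_sub_le_of_faceAdj hη hz hδ (fun S hS S' hS' x hx => by
          rw [← haff S hS x hx.1, ← haff S' hS' x hx.2]) hSS'⟩) hTT
    refine this.trans (le_of_eq ?_)
    rw [hC₁]; ring
  rw [← haff T hT _ hzT] at k1
  have k2 : |v (Y u + e) - v (Y u)| ≤ θ := by
    rw [← Real.dist_eq]
    refine (huc _ (simplex_subset_carrier hT hzT) _ (simplex_subset_carrier hT' hyT') ?_).le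
    rwa [dist_eq_norm, add_sub_cancel_left]
  have k3 : |inner ℝ (b T₀) e| ≤ θ := (abs_real_inner_le_norm _ _).trans he3
  have k4 : |β T₀ + inner ℝ (b T₀) (Y u)| ≤ |v (Y u)| + C₁ * (h * δ) + 2 * θ := by
    have e1 : β T₀ + inner ℝ (b T₀) (Y u) = v (Y u) + (v (Y u + e) - v (Y u)) +
        ((β T₀ + inner ℝ (b T₀) (Y u + e)) - v (Y u + e)) - inner ℝ (b T₀) e := by
      rw [inner_add_right]; ring
    rw [e1]
    have h1 := abs_sub (v (Y u) + (v (Y u + e) - v (Y u)) +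
        ((β T₀ + inner ℝ (b T₀) (Y u + e)) - v (Y u + e))) (inner ℝ (b T₀) e)
    have h2 := abs_add_le (v (Y u) + (v (Y u + e) - v (Y u)))
      ((β T₀ + inner ℝ (b T₀) (Y u + e)) - v (Y u + e))
    have h3 := abs_add_le (v (Y u)) (v (Y u + e) - v (Y u))
    linarith
  have k5 := hsub u hu
  have k6 : |v (Y 0)| ≤ |β T₀ + inner ℝ (b T₀) (Y u)| + 5 / 4 * (h * ‖b T₀‖) := by
    have e1 : v (Y 0) = (β T₀ + inner ℝ (b T₀) (Y u)) - inner ℝ (b T₀) (Y u - Y 0) := by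
      rw [haff T₀ hT₀ _ hx₀, inner_sub_right]; ring
    have h1 := norm_sub_le_of_near_isometry hh hY huB h0B
    rw [sub_zero] at h1
    have h2 : ‖u‖ ≤ 1 := mem_closedBall_zero_iff.1 huB
    have h3 : |inner ℝ (b T₀) (Y u - Y 0)| ≤ ‖b T₀‖ * (5 / 4 * h) := by
      refine (abs_real_inner_le_norm _ _).trans ?_
      gcongr
      exact h1.trans (by nlinarith)
    rw [e1]
    have := abs_sub (β T₀ + inner ℝ (b T₀) (Y u)) (inner ℝ (b T₀) (Y u - Y 0))
    linarith
  set X := |β T₀ + inner ℝ (b T₀) (Y u)|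
  have hhδ : 0 ≤ h * δ := by positivity
  calc |v (Y 0)| + h * ‖b T₀‖ ≤ X + 9 / 4 * (h * ‖b T₀‖) := by linarith
    _ ≤ X + 9 / 4 * (32 / (7 * ρ) * X + 3 * (h * δ)) := by gcongr
    _ = (1 + 72 / (7 * ρ)) * X + 27 / 4 * (h * δ) := by ring
    _ ≤ (1 + 72 / (7 * ρ)) * (|v (Y u)| + C₁ * (h * δ) + 2 * θ) + 27 / 4 * (h * δ) := by gcongr
    _ ≤ (1 + 72 / (7 * ρ)) * ((C₁ + 2) * (|v (Y u)| + h * δ + θ)) +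
        7 * (|v (Y u)| + h * δ + θ) := by
      gcongr ?_ * ?_ + ?_
      · nlinarith [abs_nonneg (v (Y u)), mul_nonneg hC₁0 (abs_nonneg (v (Y u))),
          mul_nonneg hC₁0 hθ.le]
      · nlinarith [abs_nonneg (v (Y u))]
    _ = _ := by ring

/-- Integrated form of `exists_pointwise_estimate`. -/
theorem exists_local_estimate (d k N : ℕ) {σ : ℝ} (hσ : 0 < σ) :
    ∃ C > 0, ∀ (A : Euc d →ₗᵢ[ℝ] Euc k) (h : ℝ) (𝒜 : Finset (Finset (Euc k)))
      (Y : Euc d → Euc k), 0 < h → IsConformingMesh k 𝒜 → 𝒜.card ≤ N →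
      (∀ T ∈ 𝒜, Metric.diam (simplex T) ≤ σ * h) →
      (∀ T ∈ 𝒜, ∃ x, Metric.closedBall x (h / σ) ⊆ simplex T) →
      (∀ u ∈ Metric.closedBall 0 1, ∀ v ∈ Metric.closedBall 0 1,
        ‖Y u - Y v - h • A (u - v)‖ ≤ 1 / 4 * h * ‖u - v‖) →
      (∀ T ∈ 𝒜, ∃ u ∈ Metric.closedBall 0 1, Y u ∈ simplex T) →
      (∀ u ∈ Metric.closedBall 0 1, ∀ᶠ z in nhds (Y u), ∃ T ∈ 𝒜, z ∈ simplex T) →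
      ∀ (v : Euc k → ℝ) (β : Finset (Euc k) → ℝ) (b : Finset (Euc k) → Euc k) (δ : ℝ),
      ContinuousOn v (carrier 𝒜) →
      (∀ T ∈ 𝒜, ∀ x ∈ simplex T, v x = β T + inner ℝ (b T) x) →
      (∀ T ∈ 𝒜, ‖b T - A (coordMap A (b T))‖ ≤ δ) →
      ∀ T₀ ∈ 𝒜, Y 0 ∈ simplex T₀ → ∀ F : Set (Euc k), Y '' Metric.closedBall 0 1 ⊆ F →
        μHE[d] F < ⊤ → IntegrableOn (fun x => v x ^ 2) F μHE[d] →
        (|v (Y 0)| + h * ‖b T₀‖) ^ 2 ≤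
          C * ((h ^ d)⁻¹ * (∫ x in F, v x ^ 2 ∂μHE[d]) + h ^ 2 * δ ^ 2) := by
  obtain ⟨C, hC, ρ, hρ, hpt⟩ := exists_pointwise_estimate d k N hσ
  set ν : ℝ := (3 / 4) ^ d * (ρ ^ d * unitBallVolume d) with hν
  have hν0 : 0 < ν := by have := unitBallVolume_pos d; positivity
  refine ⟨3 * C ^ 2 * (ν⁻¹ + 1), by positivity, ?_⟩
  intro A h 𝒜 Y hh h𝒜 hN hdiam hball hY hmeet hcov v β b δ hv haff hδ T₀ hT₀ hx₀ F hF hFfin hint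
  set m := |v (Y 0)| + h * ‖b T₀‖ with hm
  have hm0 : 0 ≤ m := by positivity
  set I := ∫ x in F, v x ^ 2 ∂μHE[d] with hI
  have hI0 : 0 ≤ I := integral_nonneg fun x => sq_nonneg _
  have hYc : ContinuousOn Y (Metric.closedBall 0 1) :=
    LipschitzOnWith.continuousOn (K := Real.toNNReal (5 / 4 * h))
      (LipschitzOnWith.of_dist_le_mul fun u hu v hv => by
        rw [dist_eq_norm, dist_eq_norm, Real.coe_toNNReal _ (by positivity)]
        exact norm_sub_le_of_near_isometry hh hY hu hv)
  -- The good ball depends on `θ`, but its radius and the constant do not. The estimate is therefore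
  -- integrated first, and `θ` tends to 0 afterwards.
  have hkey : ∀ θ > 0, m ^ 2 ≤ 3 * C ^ 2 * ((ν * h ^ d)⁻¹ * I + h ^ 2 * δ ^ 2 + θ ^ 2) := by
    intro θ hθ
    obtain ⟨u₂, hu₂, hpw⟩ := hpt A h 𝒜 Y hh h𝒜 hN hdiam hball hY hmeet hcov v β b δ hv haff hδ T₀
      hT₀ hx₀ θ hθ
    set S := Y '' Metric.closedBall u₂ ρ with hS
    have hSF : S ⊆ F := (image_mono hu₂).trans hF
    have hSc : IsCompact S := (isCompact_closedBall u₂ ρ).image_of_continuousOn (hYc.mono hu₂)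
    have hSfin : μHE[d] S < ⊤ := (measure_mono hSF).trans_lt hFfin
    have hSlow : ν * h ^ d ≤ (μHE[d] S).toReal := by
      have h1 := euclideanHausdorffMeasure_le_image (f := Y) (S := Metric.closedBall u₂ ρ)
        (K := Real.toNNReal ((3 / 4 * h)⁻¹)) d (fun u hu w hw => by
          rw [Real.coe_toNNReal _ (by positivity), dist_eq_norm, dist_eq_norm,
            ← div_eq_inv_mul, le_div_iff₀ (by positivity), mul_comm]
          exact le_norm_sub_of_near_isometry hh hY (hu₂ hu) (hu₂ hw))
      have h2 := ENNReal.toReal_mono (ENNReal.mul_ne_top (by simp) hSfin.ne) h1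
      rw [EuclideanSpace.euclideanHausdorffMeasure_eq_volume, volume_closedBall_toReal _ hρ.le,
        ENNReal.toReal_mul, ENNReal.toReal_pow, ENNReal.coe_toReal,
        Real.coe_toNNReal _ (by positivity), inv_pow, ← div_eq_inv_mul,
        le_div_iff₀ (by positivity)] at h2
      refine le_trans (le_of_eq ?_) h2
      rw [hν, mul_pow]; ring
    have hSpos : 0 < (μHE[d] S).toReal := lt_of_lt_of_le (by positivity) hSlow
    have h1 : (μHE[d] S).toReal * (m ^ 2 / (3 * C ^ 2) - h ^ 2 * δ ^ 2 - θ ^ 2) ≤ I := by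
      calc _ = ∫ _ in S, (m ^ 2 / (3 * C ^ 2) - h ^ 2 * δ ^ 2 - θ ^ 2) ∂μHE[d] := by
            rw [setIntegral_const, smul_eq_mul, Measure.real]
        _ ≤ ∫ x in S, v x ^ 2 ∂μHE[d] := by
            refine setIntegral_mono_on (integrableOn_const hSfin.ne) (hint.mono_set hSF)
              hSc.isClosed.measurableSet ?_
            rintro _ ⟨u, hu, rfl⟩
            have h2 := pow_le_pow_left₀ hm0 (hpw u hu) 2
            have h3 : (|v (Y u)| + h * δ + θ) ^ 2 ≤
                3 * (v (Y u) ^ 2 + h ^ 2 * δ ^ 2 + θ ^ 2) := by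
              rw [← sq_abs (v (Y u))]
              nlinarith [sq_nonneg (|v (Y u)| - h * δ), sq_nonneg (|v (Y u)| - θ),
                sq_nonneg (h * δ - θ)]
            have h4 : m ^ 2 / (3 * C ^ 2) ≤ v (Y u) ^ 2 + h ^ 2 * δ ^ 2 + θ ^ 2 := by
              rw [div_le_iff₀ (by positivity)]
              rw [mul_pow] at h2
              nlinarith [sq_nonneg C]
            linarith
        _ ≤ I := setIntegral_mono_set hint (ae_of_all _ fun x => sq_nonneg _)
            (LE.le.eventuallyLE hSF)
    have h2 : m ^ 2 / (3 * C ^ 2) - h ^ 2 * δ ^ 2 - θ ^ 2 ≤ (ν * h ^ d)⁻¹ * I := by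
      rcases le_or_gt (m ^ 2 / (3 * C ^ 2) - h ^ 2 * δ ^ 2 - θ ^ 2) 0 with h0 | h0
      · exact h0.trans (by positivity)
      · rw [← div_eq_inv_mul, le_div_iff₀ (by positivity), mul_comm]
        exact (mul_le_mul_of_nonneg_right hSlow h0.le).trans h1
    have h3 : m ^ 2 / (3 * C ^ 2) ≤ (ν * h ^ d)⁻¹ * I + h ^ 2 * δ ^ 2 + θ ^ 2 := by linarith
    rw [div_le_iff₀ (by positivity)] at h3
    linarith
  have hlim : m ^ 2 ≤ 3 * C ^ 2 * ((ν * h ^ d)⁻¹ * I + h ^ 2 * δ ^ 2) := by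
    refine le_of_forall_pos_le_add fun ε hε => ?_
    have h1 := hkey (Real.sqrt (ε / (3 * C ^ 2))) (Real.sqrt_pos.2 (by positivity))
    rw [Real.sq_sqrt (by positivity), mul_add _ _ (ε / (3 * C ^ 2)),
      mul_div_cancel₀ _ (by positivity)] at h1
    exact h1
  refine hlim.trans ?_
  rw [mul_assoc (3 * C ^ 2)]
  gcongr
  rw [mul_inv, mul_assoc]
  set X := (h ^ d)⁻¹ * I
  have hX : 0 ≤ X := by positivity
  have : 0 ≤ ν⁻¹ := by positivity
  have h2 : 0 ≤ h ^ 2 * δ ^ 2 := by positivity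
  nlinarith [mul_nonneg this h2]

end LocalEstimate

/-! ### Integrals over meshes as integrals over their carriers. -/

section MeshIntegrals

variable {k : ℕ}

theorem integrableOn_of_continuousOn_isCompact {μ : Measure (Euc k)} {S : Set (Euc k)}
    (hS : IsCompact S) (hμ : μ S < ⊤) {f : Euc k → ℝ} (hf : ContinuousOn f S) :
    IntegrableOn f S μ := by
  obtain ⟨M, hM⟩ := hS.exists_bound_of_continuousOn hf
  exact ⟨hf.aestronglyMeasurable hS.isClosed.measurableSet, .restrict_of_bounded (C := M) hμ
    ((ae_restrict_iff' hS.isClosed.measurableSet).2 (ae_of_all _ hM))⟩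

theorem euclideanHausdorffMeasure_carrier_lt_top {d : ℕ} {𝒦 : Finset (Finset (Euc k))}
    (h : IsConformingMesh d 𝒦) : μHE[d] (carrier 𝒦) < ⊤ := by
  refine (measure_biUnion_finset_le 𝒦 simplex).trans_lt ?_
  exact ENNReal.sum_lt_top.2 fun K hK => euclideanHausdorffMeasure_simplex_lt_top h hK

theorem integrableOn_carrier {d : ℕ} {𝒦 : Finset (Finset (Euc k))} (h : IsConformingMesh d 𝒦)
    {f : Euc k → ℝ} (hf : ContinuousOn f (carrier 𝒦)) : IntegrableOn f (carrier 𝒦) μHE[d] :=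
  integrableOn_of_continuousOn_isCompact (isCompact_carrier 𝒦)
    (euclideanHausdorffMeasure_carrier_lt_top h) hf

theorem meshIntegral_eq_integral_carrier {d : ℕ} {𝒦 : Finset (Finset (Euc k))}
    (h : IsConformingMesh d 𝒦) {f : Euc k → ℝ} (hf : IntegrableOn f (carrier 𝒦) μHE[d]) :
    meshIntegral μHE[d] 𝒦 (fun _ => f) = ∫ x in carrier 𝒦, f x ∂μHE[d] := by
  have e : carrier 𝒦 = ⋃ K : 𝒦, simplex K.1 := by
    ext x
    simp [carrier]
  rw [e] at hf ⊢
  have h1 := integral_iUnion_ae (fun K : 𝒦 => (isClosed_simplex K.1).measurableSet.nullMeasurableSet)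
    (fun K K' hne => euclideanHausdorffMeasure_simplex_inter h K.2 K'.2
      fun h => hne (Subtype.ext h)) hf
  rw [h1, tsum_fintype, meshIntegral]
  exact (Finset.sum_coe_sort 𝒦 fun K => ∫ x in simplex K, f x ∂μHE[d]).symm

end MeshIntegrals

/-! ### The extended normal projection near the discrete manifold. -/

section Setting

variable {k d : ℕ} {Γ : Set (Euc k)} {C r δ₀ σ κ h : ℝ} {Ω : Set (Euc k)}
  {𝒯 𝒦 : Finset (Finset (Euc k))}

/-- The hypotheses on the background mesh and the discrete manifold, for `h` so small that the
active mesh lies in a neighbourhood of `Γ` with a Lipschitz continuous closest point projection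
and that `Γ_h` is, on balls of radius `h`, a graph with small slope. -/
structure IsFineMesh (d : ℕ) (Γ : Set (Euc k)) (C r δ₀ σ κ h : ℝ) (Ω : Set (Euc k))
    (𝒯 𝒦 : Finset (Finset (Euc k))) : Prop where
  geom : UniformGeometry d Γ C r
  tub : IsTubularRadius Γ δ₀
  σ_pos : 0 < σ
  κ_pos : 0 < κ
  h_pos : 0 < h
  isOpen : IsOpen Ω
  thick : Metric.thickening δ₀ Γ ⊆ Ω
  bg : IsBackgroundMesh σ h Ω 𝒯
  disc : IsDiscreteManifold d Γ δ₀ κ h 𝒯 𝒦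
  h_le_one : h ≤ 1
  tube_lt : κ * h ^ 2 + σ * h < δ₀
  tube_le : 4 * C * (κ * h ^ 2 + σ * h) ≤ 1
  h_le : h ≤ r
  curvature_le : 6 * C ^ 2 * h ≤ 1
  slope_le : 2 * (κ * h + 4 * C ^ 2 * h + 2 * C * (κ * h ^ 2)) ≤ 1 / 4

theorem mem_activeMesh {T : Finset (Euc k)} {G : Set (Euc k)} :
    T ∈ activeMesh 𝒯 G ↔ T ∈ 𝒯 ∧ (simplex T ∩ G).Nonempty := by
  classical
  exact Finset.mem_filter

theorem IsConformingMesh.subset {n : ℕ} {𝒜 : Finset (Finset (Euc k))} (h : IsConformingMesh n 𝒯)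
    (h𝒜 : 𝒜 ⊆ 𝒯) : IsConformingMesh n 𝒜 :=
  ⟨fun s hs => h.card_eq s (h𝒜 hs), fun s hs => h.affineIndependent s (h𝒜 hs),
    fun s hs t ht => h.inter_eq s (h𝒜 hs) t (h𝒜 ht)⟩

theorem activeMesh_subset {G : Set (Euc k)} : activeMesh 𝒯 G ⊆ 𝒯 := fun _ hT =>
  (mem_activeMesh.1 hT).1

theorem carrier_mono {𝒜 : Finset (Finset (Euc k))} (h𝒜 : 𝒜 ⊆ 𝒯) : carrier 𝒜 ⊆ carrier 𝒯 :=
  biUnion_subset_biUnion_left h𝒜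

namespace IsFineMesh

variable (H : IsFineMesh d Γ C r δ₀ σ κ h Ω 𝒯 𝒦)
include H

theorem simplex_nonempty {T : Finset (Euc k)} (hT : T ∈ 𝒯) : (simplex T).Nonempty :=
  (interior_simplex_nonempty H.bg.conforming hT).mono interior_subset

theorem carrier_subset : carrier 𝒦 ⊆ carrier (activeMesh 𝒯 (carrier 𝒦)) := by
  intro y hy
  obtain ⟨K, hK, hyK⟩ := mem_carrier.1 hy
  obtain ⟨T, hT, hKT⟩ := H.disc.compatible K hK
  exact mem_carrier.2 ⟨T, mem_activeMesh.2 ⟨hT, y, hKT hyK, hy⟩, hKT hyK⟩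

theorem infDist_le {x : Euc k} (hx : x ∈ carrier (activeMesh 𝒯 (carrier 𝒦))) :
    Metric.infDist x Γ ≤ κ * h ^ 2 + σ * h := by
  obtain ⟨T, hT, hxT⟩ := mem_carrier.1 hx
  obtain ⟨hT, y, hyT, hy⟩ := mem_activeMesh.1 hT
  have h1 := Metric.infDist_le_infDist_add_dist (s := Γ) (x := x) (y := y)
  have h2 := norm_sub_le_of_mem_simplex (H.bg.diam_le T hT) hxT hyT
  rw [← dist_eq_norm] at h2
  linarith [H.disc.dist_le y hy]

theorem isClosestPoint {x : Euc k} (hx : x ∈ carrier (activeMesh 𝒯 (carrier 𝒦))) :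
    IsClosestPoint Γ x (closestPoint Γ x) := by
  have hne : Γ.Nonempty := by
    obtain ⟨T, hT, -⟩ := mem_carrier.1 hx
    obtain ⟨-, y, -, hy⟩ := mem_activeMesh.1 hT
    exact ⟨_, H.disc.bijOn.mapsTo hy⟩
  exact H.tub.isClosestPoint (Metric.mem_thickening_iff_infDist_lt hne |>.2
    ((H.infDist_le hx).trans_lt H.tube_lt))

theorem norm_closestPoint_sub_le {x x' : Euc k} (hx : x ∈ carrier (activeMesh 𝒯 (carrier 𝒦)))
    (hx' : x' ∈ carrier (activeMesh 𝒯 (carrier 𝒦))) :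
    ‖closestPoint Γ x - closestPoint Γ x'‖ ≤ 2 * ‖x - x'‖ :=
  H.geom.norm_closest_sub_le H.tube_le (H.isClosestPoint hx) (H.isClosestPoint hx')
    (H.infDist_le hx) (H.infDist_le hx')

theorem continuousOn_closestPoint :
    ContinuousOn (closestPoint Γ) (carrier (activeMesh 𝒯 (carrier 𝒦))) :=
  LipschitzOnWith.continuousOn (K := 2) (LipschitzOnWith.of_dist_le_mul fun x hx y hy => by
    rw [dist_eq_norm, dist_eq_norm]
    exact H.norm_closestPoint_sub_le hx hy)

theorem exists_discreteNormalProjExt_eq {x : Euc k}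
    (hx : x ∈ carrier (activeMesh 𝒯 (carrier 𝒦))) :
    ∃ K ∈ 𝒦, discreteNormalProjExt Γ 𝒦 x = discreteNormalProj K ∧
      ∃ y ∈ simplex K, closestPoint Γ y = closestPoint Γ x := by
  classical
  have hne : (simplicesOver Γ 𝒦 x).Nonempty := by
    obtain ⟨y, hy, hyx⟩ := H.disc.bijOn.surjOn (H.isClosestPoint hx).1
    obtain ⟨K, hK, hyK⟩ := mem_carrier.1 hy
    exact ⟨K, Finset.mem_filter.2 ⟨hK, y, hyK, hyx⟩⟩
  obtain ⟨h1, h2⟩ := Finset.mem_filter.1 hne.choose_spec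
  exact ⟨hne.choose, h1, dif_pos hne, h2⟩

/-- The simplex selected at `x` lies over `p(x)`, where its tangential projection is `κ h`-close to
that of `Γ`. The latter varies by at most `2 C ‖x - x₀‖` between `p(x)` and `p(x₀)`. -/
theorem norm_discreteNormalProjExt_sub_le {x x₀ : Euc k}
    (hx : x ∈ carrier (activeMesh 𝒯 (carrier 𝒦)))
    (hx₀ : x₀ ∈ carrier (activeMesh 𝒯 (carrier 𝒦))) (b : Euc k) :
    ‖discreteNormalProjExt Γ 𝒦 x b - (b - tangentialProj Γ (closestPoint Γ x₀) b)‖ ≤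
      (κ * h + 2 * C * ‖x - x₀‖) * ‖b‖ := by
  obtain ⟨K, hK, hKe, y, hy, hyx⟩ := H.exists_discreteNormalProjExt_eq hx
  have hC := H.geom.C_ge
  have h1 := H.disc.proj_le K hK y hy
  rw [hyx] at h1
  have h2 := H.geom.proj_sub_le _ (H.isClosestPoint hx₀).1 _ (H.isClosestPoint hx).1
  have h3 := H.norm_closestPoint_sub_le hx₀ hx
  rw [norm_sub_rev x₀] at h3
  have e : discreteNormalProjExt Γ 𝒦 x b - (b - tangentialProj Γ (closestPoint Γ x₀) b) =
      ((tangentialProj Γ (closestPoint Γ x₀) - tangentialProj Γ (closestPoint Γ x)) +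
        (tangentialProj Γ (closestPoint Γ x) - discreteTangentialProj K)) b := by
    rw [hKe, discreteNormalProj, sub_apply, add_apply, sub_apply, sub_apply,
      ContinuousLinearMap.id_apply]
    abel
  rw [e]
  refine ContinuousLinearMap.le_of_opNorm_le _ ((norm_add_le _ _).trans ?_) b
  nlinarith

/-- The selected simplex depends on `x` only through the finite set `simplicesOver Γ 𝒦 x`, so the
integrand is constant on each of finitely many measurable sets. -/
theorem integrableOn_discreteNormalProjExt {T : Finset (Euc k)}
    (hT : T ∈ activeMesh 𝒯 (carrier 𝒦)) (b : Euc k) :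
    IntegrableOn (fun x => ‖discreteNormalProjExt Γ 𝒦 x b‖ ^ 2) (simplex T) := by
  classical
  have hTc : simplex T ⊆ carrier (activeMesh 𝒯 (carrier 𝒦)) := simplex_subset_carrier hT
  have hK : ∀ K ∈ 𝒦, MeasurableSet {x ∈ simplex T | closestPoint Γ x ∈ closestPoint Γ '' simplex K} := by
    intro K hK
    have h1 : IsClosed (closestPoint Γ '' simplex K) :=
      ((isCompact_simplex K).image_of_continuousOn (H.continuousOn_closestPoint.mono
        ((simplex_subset_carrier hK).trans H.carrier_subset))).isClosed
    exact ((H.continuousOn_closestPoint.mono hTc).preimage_isClosed_of_isClosed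
      (isClosed_simplex T) h1).measurableSet
  have hcov : simplex T = ⋃ s ∈ 𝒦.powerset, {x ∈ simplex T | simplicesOver Γ 𝒦 x = s} := by
    ext x
    simp only [mem_iUnion, mem_ofPred_eq, exists_prop, Finset.mem_powerset]
    exact ⟨fun hx => ⟨_, Finset.filter_subset _ _, hx, rfl⟩, fun ⟨_, _, hx, _⟩ => hx⟩
  rw [hcov, integrableOn_finset_iUnion]
  intro s hs
  have hms : MeasurableSet {x ∈ simplex T | simplicesOver Γ 𝒦 x = s} := by
    have e : {x ∈ simplex T | simplicesOver Γ 𝒦 x = s} = simplex T ∩ ⋂ K ∈ 𝒦,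
        if K ∈ s then {x ∈ simplex T | closestPoint Γ x ∈ closestPoint Γ '' simplex K}
        else {x ∈ simplex T | closestPoint Γ x ∈ closestPoint Γ '' simplex K}ᶜ := by
      ext x
      simp only [mem_ofPred_eq, mem_inter_iff, mem_iInter]
      refine and_congr_right fun hx => ⟨?_, fun h => ?_⟩
      · rintro rfl K hK
        split_ifs with hKs
        · exact ⟨hx, (Finset.mem_filter.1 hKs).2⟩
        · exact fun h' => hKs (Finset.mem_filter.2 ⟨hK, h'.2⟩)
      · ext K
        by_cases hK : K ∈ 𝒦
        · have := h K hK
          split_ifs at this with hKs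
          · exact ⟨fun _ => hKs, fun _ => Finset.mem_filter.2 ⟨hK, this.2⟩⟩
          · exact ⟨fun h' => absurd ⟨hx, (Finset.mem_filter.1 h').2⟩ this, fun h' => absurd h' hKs⟩
        · exact ⟨fun h' => absurd (Finset.mem_filter.1 h').1 hK,
            fun h' => absurd (Finset.mem_powerset.1 hs h') hK⟩
    rw [e]
    refine (isClosed_simplex T).measurableSet.inter
      (Finset.measurableSet_biInter _ fun K hK' => ?_)
    split_ifs
    · exact hK K hK'
    · exact (hK K hK').compl
  have hfin : volume {x ∈ simplex T | simplicesOver Γ 𝒦 x = s} ≠ ⊤ :=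
    ((measure_mono (sep_subset _ _)).trans_lt (isCompact_simplex T).measure_lt_top).ne
  refine (integrableOn_const (C := ‖(if hx : s.Nonempty then discreteNormalProj hx.choose
    else 0 : Euc k →L[ℝ] Euc k) b‖ ^ 2) hfin).congr_fun ?_ hms
  rintro x ⟨-, rfl⟩
  rfl

/-- The deviation of a constant vector from the tangent space at `p(x₀)` in terms of the
stabilization on an element. -/
theorem normal_sq_le {x₀ : Euc k} (hx₀ : x₀ ∈ carrier (activeMesh 𝒯 (carrier 𝒦)))
    {R : ℝ} (hR : 0 ≤ R) {T : Finset (Euc k)} (hT : T ∈ activeMesh 𝒯 (carrier 𝒦))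
    (hTR : simplex T ⊆ Metric.closedBall x₀ (R * h)) (β : ℝ) (b : Euc k) :
    ‖b - tangentialProj Γ (closestPoint Γ x₀) b‖ ^ 2 * (h ^ k * ((1 / (4 * σ)) ^ k * unitBallVolume k)) ≤
      2 * (∫ x in simplex T, ‖discreteNormalProjExt Γ 𝒦 x b‖ ^ 2) +
        32 * σ ^ 2 * (κ + 2 * C * R) ^ 2 * ∫ x in simplex T, (β + inner ℝ b x) ^ 2 := by
  have hC := H.geom.C_ge
  have hh := H.h_pos
  have hσ := H.σ_pos
  have hκ := H.κ_pos
  have hω := unitBallVolume_pos k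
  obtain ⟨hT', -⟩ := mem_activeMesh.1 hT
  obtain ⟨z, hz⟩ := H.bg.ball_subset T hT'
  set n := ‖b - tangentialProj Γ (closestPoint Γ x₀) b‖
  set M := (κ + 2 * C * R) * h * ‖b‖ with hM
  set B := Metric.closedBall z (h / σ / 4) with hB
  have hBT : B ⊆ simplex T := (Metric.closedBall_subset_closedBall (by
    have : 0 < h / σ := by positivity
    linarith)).trans hz
  have hBv : (volume B).toReal = h ^ k * ((1 / (4 * σ)) ^ k * unitBallVolume k) := by
    rw [hB, volume_closedBall_toReal _ (by positivity), ← mul_assoc, ← mul_pow]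
    congr 2
    field_simp
  have hint := H.integrableOn_discreteNormalProjExt hT b
  have h1 : (volume B).toReal * (n ^ 2 / 2 - M ^ 2) ≤
      ∫ x in simplex T, ‖discreteNormalProjExt Γ 𝒦 x b‖ ^ 2 := by
    calc _ = ∫ _ in B, (n ^ 2 / 2 - M ^ 2) := by rw [setIntegral_const, smul_eq_mul, Measure.real]
      _ ≤ ∫ x in B, ‖discreteNormalProjExt Γ 𝒦 x b‖ ^ 2 := by
        refine setIntegral_mono_on (integrableOn_const measure_closedBall_lt_top.ne)
          (hint.mono_set hBT) Metric.isClosed_closedBall.measurableSet fun x hx => ?_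
        have h2 := H.norm_discreteNormalProjExt_sub_le
          (simplex_subset_carrier hT (hBT hx)) hx₀ b
        have h3 : ‖x - x₀‖ ≤ R * h := by
          rw [← mem_closedBall_iff_norm]; exact hTR (hBT hx)
        have h4 : (κ * h + 2 * C * ‖x - x₀‖) * ‖b‖ ≤ M := by
          rw [hM]
          refine mul_le_mul_of_nonneg_right ?_ (norm_nonneg b)
          nlinarith
        have h5 : n ≤ ‖discreteNormalProjExt Γ 𝒦 x b‖ + M := by
          have := norm_sub_norm_le (b - tangentialProj Γ (closestPoint Γ x₀) b)
            (discreteNormalProjExt Γ 𝒦 x b)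
          rw [norm_sub_rev (b - _)] at this
          linarith
        have h6 : n ^ 2 ≤ (‖discreteNormalProjExt Γ 𝒦 x b‖ + M) ^ 2 :=
          pow_le_pow_left₀ (norm_nonneg _) h5 2
        nlinarith [sq_nonneg (‖discreteNormalProjExt Γ 𝒦 x b‖ - M)]
      _ ≤ _ := setIntegral_mono_set hint (ae_of_all _ fun x => sq_nonneg _)
        (LE.le.eventuallyLE hBT)
  -- The inverse estimate turns the consistency error `M`, of size `h ‖b‖`, into the `L²` norm of
  -- the affine function on `T`, with no negative power of `h`.
  have h2 := norm_sq_le_integral_affine (T := T) (by positivity : 0 ≤ h / σ) hz β b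
  rw [← volume_closedBall_toReal z (by positivity), ← hB, hBv] at h2
  rw [hBv] at h1
  set V := h ^ k * ((1 / (4 * σ)) ^ k * unitBallVolume k)
  have h3 : M ^ 2 * V = 16 * σ ^ 2 * (κ + 2 * C * R) ^ 2 * ((h / σ / 4) ^ 2 * ‖b‖ ^ 2 * V) := by
    rw [hM]; field_simp; ring
  have h4 := mul_le_mul_of_nonneg_left h2
    (by positivity : 0 ≤ 16 * σ ^ 2 * (κ + 2 * C * R) ^ 2)
  rw [← h3] at h4
  linarith

end IsFineMesh

end Setting

/-! ### The estimate on one active element. -/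

section Setting

variable {k d : ℕ} {Γ : Set (Euc k)} {C r δ₀ σ κ h : ℝ} {Ω : Set (Euc k)}
  {𝒯 𝒦 : Finset (Finset (Euc k))}

namespace IsFineMesh

variable (H : IsFineMesh d Γ C r δ₀ σ κ h Ω 𝒯 𝒦)
include H

theorem card_le {𝒮 : Finset (Finset (Euc k))} (h𝒮 : 𝒮 ⊆ 𝒯) {z : Euc k}
    (hz : ∀ T ∈ 𝒮, simplex T ⊆ Metric.closedBall z ((2 + 2 * σ) * h)) :
    𝒮.card ≤ ⌈((2 + 2 * σ) * σ) ^ k⌉₊ := by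
  have hσ := H.σ_pos
  have h1 := card_le_of_simplex_subset_closedBall H.bg.conforming hσ H.h_pos (by positivity)
    H.bg.ball_subset h𝒮 hz
  exact_mod_cast h1.trans (Nat.le_ceil _)

/-- The discrete manifold near one of its points as a graph, at scale `h`. -/
theorem exists_scaled_chart {y₀ : Euc k} (hy₀ : y₀ ∈ carrier 𝒦) :
    ∃ (A : Euc d →ₗᵢ[ℝ] Euc k) (Y : Euc d → Euc k),
      (∀ x, tangentialProj Γ (closestPoint Γ y₀) x = A (coordMap A x)) ∧ Y 0 = y₀ ∧
      (∀ u ∈ Metric.closedBall 0 1, Y u ∈ carrier 𝒦) ∧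
      ∀ u ∈ Metric.closedBall 0 1, ∀ v ∈ Metric.closedBall 0 1,
        ‖Y u - Y v - h • A (u - v)‖ ≤ 1 / 4 * h * ‖u - v‖ := by
  have hh := H.h_pos
  have hκ : 4 * C * (κ * h ^ 2) ≤ 1 := by
    have h1 := H.tube_le
    have h2 := H.geom.C_ge
    have h3 := H.σ_pos
    have : 0 ≤ 4 * C * (σ * h) := by positivity
    linarith
  obtain ⟨A, hA, hAmem⟩ := H.geom.exists_frame (H.disc.bijOn.mapsTo hy₀)
  obtain ⟨Y, hY0, hYmem, hY, -⟩ := H.disc.exists_chart H.geom H.tub H.κ_pos.le hh.le hκ H.h_le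
    H.curvature_le (by norm_num) H.slope_le hy₀ hA hAmem hh.le
  have hmem : ∀ u ∈ Metric.closedBall (0 : Euc d) 1, h • u ∈ Metric.closedBall (0 : Euc d) h := by
    intro u hu
    rw [mem_closedBall_zero_iff] at hu ⊢
    rw [norm_smul, Real.norm_eq_abs, abs_of_pos hh]
    exact mul_le_of_le_one_right hh.le hu
  refine ⟨A, fun u => Y (h • u), hA, by simp only [smul_zero, hY0], fun u hu => hYmem _ (hmem u hu),
    fun u hu v hv => ?_⟩
  have h1 := hY _ (hmem u hu) _ (hmem v hv)
  rw [← smul_sub, map_smul A h (u - v), norm_smul, Real.norm_eq_abs, abs_of_pos hh] at h1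
  rw [mul_assoc]
  exact h1

/-- `Γ_h` lies in the open set `Ω`, so points near `y` are covered by the mesh, and only by elements
that contain `y` and are therefore active. -/
theorem eventually_mem_active {y : Euc k} (hy : y ∈ carrier 𝒦) :
    ∀ᶠ z in nhds y, ∃ T ∈ activeMesh 𝒯 (carrier 𝒦), y ∈ simplex T ∧ z ∈ simplex T := by
  have h1 : Ω ∈ nhds y := H.isOpen.mem_nhds (H.thick (H.disc.subset_tube hy))
  filter_upwards [h1, eventually_mem_imp_mem (𝒜 := 𝒯) simplex isClosed_simplex y] with z hz hzy
  have h2 : z ∈ carrier 𝒯 := H.bg.carrier_eq ▸ subset_closure hz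
  obtain ⟨T, hT, hzT⟩ := mem_carrier.1 h2
  exact ⟨T, mem_activeMesh.2 ⟨hT, y, hzy T hT hzT, hy⟩, hzy T hT hzT, hzT⟩

end IsFineMesh

open Classical in
/-- The elements of a mesh that lie in the ball of radius `R` about `x`. -/
noncomputable def elementsNear (𝒯h : Finset (Finset (Euc k))) (R : ℝ) (x : Euc k) :
    Finset (Finset (Euc k)) :=
  𝒯h.filter fun T => simplex T ⊆ Metric.closedBall x R

theorem mem_elementsNear {𝒯h : Finset (Finset (Euc k))} {R : ℝ} {x : Euc k} {T : Finset (Euc k)} :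
    T ∈ elementsNear 𝒯h R x ↔ T ∈ 𝒯h ∧ simplex T ⊆ Metric.closedBall x R := by
  classical
  exact Finset.mem_filter

/-- Control of a finite element function on an active element by its values on nearby parts of the
discrete manifold and the stabilization on nearby elements. -/
theorem exists_element_estimate (d k : ℕ) (C : ℝ) {σ κ : ℝ} (hC : 1 ≤ C) (hσ : 0 < σ)
    (hκ : 0 < κ) : ∃ C' > 0, ∀ (Γ : Set (Euc k)) (r δ₀ h : ℝ) (Ω : Set (Euc k))
      (𝒯 𝒦 : Finset (Finset (Euc k))), IsFineMesh d Γ C r δ₀ σ κ h Ω 𝒯 𝒦 →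
      ∀ (v : Euc k → ℝ) (β : Finset (Euc k) → ℝ) (b : Finset (Euc k) → Euc k),
      ContinuousOn v (carrier (activeMesh 𝒯 (carrier 𝒦))) →
      (∀ T ∈ activeMesh 𝒯 (carrier 𝒦), ∀ x ∈ simplex T, v x = β T + inner ℝ (b T) x) →
      ∀ T ∈ activeMesh 𝒯 (carrier 𝒦), ∀ x₀ ∈ simplex T ∩ carrier 𝒦,
        ∫ x in simplex T, v x ^ 2 ≤ C' * (h ^ k * ((h ^ d)⁻¹ *
          ∫ x in carrier 𝒦 ∩ Metric.closedBall x₀ (2 * h), v x ^ 2 ∂μHE[d]) +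
          h ^ 2 * ∑ T' ∈ elementsNear (activeMesh 𝒯 (carrier 𝒦)) ((2 + 2 * σ) * h) x₀,
            ((∫ x in simplex T', ‖discreteNormalProjExt Γ 𝒦 x (b T')‖ ^ 2) +
              ∫ x in simplex T', v x ^ 2)) := by
  classical
  obtain ⟨C₁, hC₁, hloc⟩ := exists_local_estimate d k ⌈((2 + 2 * σ) * σ) ^ k⌉₊ hσ
  set C₂ : ℝ := 2 + 32 * σ ^ 2 * (κ + 2 * C * (2 + 2 * σ)) ^ 2 with hC₂
  have hC₂0 : 0 < C₂ := by positivity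
  set q : ℝ := (1 / (4 * σ)) ^ k * unitBallVolume k with hq
  have hw := unitBallVolume_pos k
  have hq0 : 0 < q := by positivity
  refine ⟨(1 + σ) ^ 2 * (σ ^ k * unitBallVolume k) * C₁ * (1 + C₂ / q), by positivity, ?_⟩
  intro Γ r δ₀ h Ω 𝒯 𝒦 H v β b hv haff T hT x₀ hx₀
  have hh := H.h_pos
  set 𝒯h := activeMesh 𝒯 (carrier 𝒦) with h𝒯h
  set 𝒩 := elementsNear 𝒯h ((2 + 2 * σ) * h) x₀ with h𝒩
  set W : Finset (Euc k) → ℝ := fun T' =>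
    (∫ x in simplex T', ‖discreteNormalProjExt Γ 𝒦 x (b T')‖ ^ 2) + ∫ x in simplex T', v x ^ 2
    with hW
  have hW0 : ∀ T', 0 ≤ W T' := fun T' =>
    add_nonneg (integral_nonneg fun x => sq_nonneg _) (integral_nonneg fun x => sq_nonneg _)
  set F := carrier 𝒦 ∩ Metric.closedBall x₀ (2 * h) with hF
  obtain ⟨A, Y, hA, hY0, hYmem, hY⟩ := H.exists_scaled_chart hx₀.2
  have hYball : ∀ u ∈ Metric.closedBall (0 : Euc d) 1, ‖Y u - x₀‖ ≤ 5 / 4 * h := by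
    intro u hu
    have h1 := norm_sub_le_of_near_isometry hh hY hu (by simp : (0 : Euc d) ∈ Metric.closedBall 0 1)
    rw [hY0, sub_zero] at h1
    have := mem_closedBall_zero_iff.1 hu
    exact h1.trans (by nlinarith)
  -- The elements met by the patch. They lie within `(5/4 + σ) h` of `x₀`, hence in the ball of
  -- radius `(2 + 2 σ) h`, which bounds their number.
  set 𝒜 := 𝒯h.filter fun T' => ∃ u ∈ Metric.closedBall (0 : Euc d) 1, Y u ∈ simplex T' with h𝒜
  have h𝒜𝒯h : 𝒜 ⊆ 𝒯h := Finset.filter_subset _ _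
  have h𝒜𝒯 : 𝒜 ⊆ 𝒯 := h𝒜𝒯h.trans activeMesh_subset
  have h𝒜𝒩 : 𝒜 ⊆ 𝒩 := by
    intro T' hT'
    obtain ⟨h1, u, hu, hyT'⟩ := Finset.mem_filter.1 hT'
    refine mem_elementsNear.2 ⟨h1, fun x hx => ?_⟩
    have h2 := norm_sub_le_of_mem_simplex (H.bg.diam_le T' (activeMesh_subset h1)) hx hyT'
    have h3 := hYball u hu
    rw [mem_closedBall_iff_norm]
    have h4 := norm_add_le (x - Y u) (Y u - x₀)
    rw [sub_add_sub_cancel] at h4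
    nlinarith
  have hT𝒜 : T ∈ 𝒜 := Finset.mem_filter.2 ⟨hT, 0, by simp, by rw [hY0]; exact hx₀.1⟩
  have hx₀c : x₀ ∈ carrier 𝒯h := simplex_subset_carrier hT hx₀.1
  -- One bound for the normal parts of all gradients on `𝒜`, as `normal_sq_le` provides it; the
  -- factor `(h ^ k)⁻¹` comes from the volume of an element.
  set δ := Real.sqrt (C₂ / q * (h ^ k)⁻¹ * ∑ T' ∈ 𝒩, W T') with hδ
  have hsum0 : 0 ≤ ∑ T' ∈ 𝒩, W T' := Finset.sum_nonneg fun T' _ => hW0 T'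
  have hδ2 : δ ^ 2 = C₂ / q * (h ^ k)⁻¹ * ∑ T' ∈ 𝒩, W T' := Real.sq_sqrt (by positivity)
  have hnormal : ∀ T' ∈ 𝒜, ‖b T' - A (coordMap A (b T'))‖ ≤ δ := by
    intro T' hT'
    rw [← hA]
    refine Real.le_sqrt_of_sq_le ?_
    have h1 := H.normal_sq_le hx₀c (by positivity : (0 : ℝ) ≤ 2 + 2 * σ) (h𝒜𝒯h hT')
      (mem_elementsNear.1 (h𝒜𝒩 hT')).2 (β T') (b T')
    have h2 : ∫ x in simplex T', (β T' + inner ℝ (b T') x) ^ 2 = ∫ x in simplex T', v x ^ 2 :=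
      setIntegral_congr_fun (isClosed_simplex T').measurableSet fun x hx => by
        rw [haff T' (h𝒜𝒯h hT') x hx]
    rw [h2, ← hq] at h1
    set S := ∫ x in simplex T', ‖discreteNormalProjExt Γ 𝒦 x (b T')‖ ^ 2 with hS
    set Z := ∫ x in simplex T', v x ^ 2 with hZ
    have hS0 : 0 ≤ S := integral_nonneg fun x => sq_nonneg _
    have hZ0 : 0 ≤ Z := integral_nonneg fun x => sq_nonneg _
    have h3 : W T' ≤ ∑ T' ∈ 𝒩, W T' :=
      Finset.single_le_sum (fun T' _ => hW0 T') (h𝒜𝒩 hT')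
    have h4 : 2 * S + 32 * σ ^ 2 * (κ + 2 * C * (2 + 2 * σ)) ^ 2 * Z ≤ C₂ * W T' := by
      have : 0 ≤ 32 * σ ^ 2 * (κ + 2 * C * (2 + 2 * σ)) ^ 2 := by positivity
      rw [hC₂, hW]
      nlinarith [mul_nonneg this hS0]
    have h5 : ‖b T' - tangentialProj Γ (closestPoint Γ x₀) (b T')‖ ^ 2 * (h ^ k * q) ≤
        C₂ * ∑ T' ∈ 𝒩, W T' := h1.trans (h4.trans (by gcongr))
    rw [← le_div_iff₀ (by positivity)] at h5
    refine h5.trans (le_of_eq ?_)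
    field_simp
  have hFc : F ⊆ carrier 𝒦 := inter_subset_left
  have hmain := hloc A h 𝒜 Y hh (H.bg.conforming.subset h𝒜𝒯)
    (H.card_le h𝒜𝒯 fun T' hT' => (mem_elementsNear.1 (h𝒜𝒩 hT')).2)
    (fun T' hT' => H.bg.diam_le T' (h𝒜𝒯 hT')) (fun T' hT' => H.bg.ball_subset T' (h𝒜𝒯 hT')) hY
    (fun T' hT' => (Finset.mem_filter.1 hT').2)
    (fun u hu => by
      filter_upwards [H.eventually_mem_active (hYmem u hu)] with z hz
      obtain ⟨T', hT', h1, h2⟩ := hz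
      exact ⟨T', Finset.mem_filter.2 ⟨hT', u, hu, h1⟩, h2⟩)
    v β b δ (hv.mono (carrier_mono h𝒜𝒯h)) (fun T' hT' => haff T' (h𝒜𝒯h hT')) hnormal T hT𝒜
    (by rw [hY0]; exact hx₀.1) F
    (by
      rintro _ ⟨u, hu, rfl⟩
      refine ⟨hYmem u hu, ?_⟩
      rw [mem_closedBall_iff_norm]
      linarith [hYball u hu])
    ((measure_mono hFc).trans_lt (euclideanHausdorffMeasure_carrier_lt_top H.disc.conforming))
    ((integrableOn_carrier H.disc.conforming ((hv.mono H.carrier_subset).pow 2)).mono_set hFc)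
  rw [hY0] at hmain
  set m := |v x₀| + h * ‖b T‖ with hm
  set I := ∫ x in F, v x ^ 2 ∂μHE[d] with hI
  have hI0 : 0 ≤ I := integral_nonneg fun x => sq_nonneg _
  -- `T` has diameter at most `σ h`, so the value at `x₀` and the scaled gradient determine the size
  -- of `v` on all of `T`.
  have hbound : ∀ x ∈ simplex T, v x ^ 2 ≤ (1 + σ) ^ 2 * m ^ 2 := by
    intro x hx
    have h1 : v x = v x₀ + inner ℝ (b T) (x - x₀) := by
      rw [haff T hT x hx, haff T hT x₀ hx₀.1, inner_sub_right]; ring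
    have h2 : |inner ℝ (b T) (x - x₀)| ≤ ‖b T‖ * (σ * h) :=
      (abs_real_inner_le_norm _ _).trans (by
        gcongr
        exact norm_sub_le_of_mem_simplex (H.bg.diam_le T (activeMesh_subset hT)) hx hx₀.1)
    have h3 : |v x| ≤ (1 + σ) * m := by
      rw [h1]
      refine (abs_add_le _ _).trans ?_
      rw [hm]
      have h4 := mul_nonneg hσ.le (abs_nonneg (v x₀))
      have h5 := mul_nonneg hh.le (norm_nonneg (b T))
      nlinarith
    rw [← sq_abs, ← mul_pow]
    exact pow_le_pow_left₀ (abs_nonneg _) h3 2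
  have hZ : ∫ x in simplex T, v x ^ 2 ≤ (1 + σ) ^ 2 * m ^ 2 * ((σ * h) ^ k * unitBallVolume k) := by
    have h1 := volume_simplex_le (H.bg.diam_le T (activeMesh_subset hT)) ⟨x₀, hx₀.1⟩
    calc _ ≤ ∫ _ in simplex T, (1 + σ) ^ 2 * m ^ 2 := by
          refine setIntegral_mono_on (integrableOn_of_continuousOn_isCompact (isCompact_simplex T)
            (isCompact_simplex T).measure_lt_top
            ((hv.mono (simplex_subset_carrier hT)).pow 2))
            (integrableOn_const (isCompact_simplex T).measure_lt_top.ne)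
            (isClosed_simplex T).measurableSet hbound
      _ = (volume (simplex T)).toReal * ((1 + σ) ^ 2 * m ^ 2) := by
          rw [setIntegral_const, smul_eq_mul, Measure.real]
      _ ≤ _ := by
          rw [mul_comm]; gcongr
  refine hZ.trans ?_
  set X := h ^ k * ((h ^ d)⁻¹ * I) with hX
  have hX0 : 0 ≤ X := by positivity
  set J := h ^ 2 * ∑ T' ∈ 𝒩, W T' with hJ
  have hJ0 : 0 ≤ J := by positivity
  have h1 : h ^ k * m ^ 2 ≤ C₁ * (X + C₂ / q * J) := by
    calc h ^ k * m ^ 2 ≤ h ^ k * (C₁ * ((h ^ d)⁻¹ * I + h ^ 2 * δ ^ 2)) := by gcongr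
      _ = _ := by rw [hδ2, hX, hJ]; field_simp
  have h2 : X + C₂ / q * J ≤ (1 + C₂ / q) * (X + J) := by
    have : 0 ≤ C₂ / q := by positivity
    nlinarith [mul_nonneg this hX0]
  calc (1 + σ) ^ 2 * m ^ 2 * ((σ * h) ^ k * unitBallVolume k)
      = (1 + σ) ^ 2 * (σ ^ k * unitBallVolume k) * (h ^ k * m ^ 2) := by rw [mul_pow]; ring
    _ ≤ (1 + σ) ^ 2 * (σ ^ k * unitBallVolume k) * (C₁ * ((1 + C₂ / q) * (X + J))) := by
        exact mul_le_mul_of_nonneg_left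
          (h1.trans (mul_le_mul_of_nonneg_left h2 hC₁.le)) (by positivity)
    _ = _ := by ring

end Setting

/-! ### Summation over the active mesh with bounded overlap. -/

section Summation

variable {k d : ℕ} {Γ : Set (Euc k)} {C r δ₀ σ κ h : ℝ} {Ω : Set (Euc k)}
  {𝒯 𝒦 : Finset (Finset (Euc k))}

namespace IsFineMesh

variable (H : IsFineMesh d Γ C r δ₀ σ κ h Ω 𝒯 𝒦)
include H

/-- An element with a point within `(2 + 2 σ) h` of `y` lies in the ball of radius `(2 + 3 σ) h`, so
the packing bound applies. This is the overlap constant of both sums that follow. -/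
theorem card_real_le {𝒮 : Finset (Finset (Euc k))} (h𝒮 : 𝒮 ⊆ activeMesh 𝒯 (carrier 𝒦))
    {x : Finset (Euc k) → Euc k} (hx : ∀ T ∈ 𝒮, x T ∈ simplex T) {y : Euc k}
    (hy : ∀ T ∈ 𝒮, ‖x T - y‖ ≤ (2 + 2 * σ) * h) : (𝒮.card : ℝ) ≤ ((2 + 3 * σ) * σ) ^ k := by
  have hσ := H.σ_pos
  have h𝒮' := h𝒮.trans activeMesh_subset
  refine card_le_of_simplex_subset_closedBall H.bg.conforming hσ H.h_pos (by positivity)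
    H.bg.ball_subset h𝒮' (z := y) fun T hT z hz => ?_
  have h1 := norm_sub_le_of_mem_simplex (H.bg.diam_le T (h𝒮' hT)) hz (hx T hT)
  have h2 := norm_add_le (z - x T) (x T - y)
  rw [sub_add_sub_cancel] at h2
  rw [mem_closedBall_iff_norm]
  linarith [hy T hT]

/-- Interchange of the sums: a given `T'` is near only boundedly many base points `x T`. -/
theorem sum_sum_elementsNear_le {x : Finset (Euc k) → Euc k}
    (hx : ∀ T ∈ activeMesh 𝒯 (carrier 𝒦), x T ∈ simplex T) {W : Finset (Euc k) → ℝ}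
    (hW : ∀ T, 0 ≤ W T) :
    ∑ T ∈ activeMesh 𝒯 (carrier 𝒦),
      ∑ T' ∈ elementsNear (activeMesh 𝒯 (carrier 𝒦)) ((2 + 2 * σ) * h) (x T), W T' ≤
      ((2 + 3 * σ) * σ) ^ k * ∑ T ∈ activeMesh 𝒯 (carrier 𝒦), W T := by
  classical
  set 𝒯h := activeMesh 𝒯 (carrier 𝒦) with h𝒯h
  rw [Finset.sum_comm' (t' := 𝒯h)
    (s' := fun T' => 𝒯h.filter fun T => simplex T' ⊆ Metric.closedBall (x T) ((2 + 2 * σ) * h))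
    (by
      intro T T'
      rw [mem_elementsNear, Finset.mem_filter]
      tauto), Finset.mul_sum]
  refine Finset.sum_le_sum fun T' hT' => ?_
  rw [Finset.sum_const, nsmul_eq_mul]
  refine mul_le_mul_of_nonneg_right ?_ (hW T')
  obtain ⟨y, hy⟩ := H.simplex_nonempty (activeMesh_subset hT')
  refine H.card_real_le (Finset.filter_subset _ _)
    (fun T hT => hx T (Finset.mem_filter.1 hT).1) (y := y) fun T hT => ?_
  rw [norm_sub_rev, ← mem_closedBall_iff_norm]
  exact (Finset.mem_filter.1 hT).2 hy

theorem sum_integral_closedBall_le {x : Finset (Euc k) → Euc k}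
    (hx : ∀ T ∈ activeMesh 𝒯 (carrier 𝒦), x T ∈ simplex T) {f : Euc k → ℝ} (hf : ∀ y, 0 ≤ f y)
    (hfi : IntegrableOn f (carrier 𝒦) μHE[d]) :
    ∑ T ∈ activeMesh 𝒯 (carrier 𝒦),
      ∫ y in carrier 𝒦 ∩ Metric.closedBall (x T) (2 * h), f y ∂μHE[d] ≤
      ((2 + 3 * σ) * σ) ^ k * ∫ y in carrier 𝒦, f y ∂μHE[d] := by
  classical
  set 𝒯h := activeMesh 𝒯 (carrier 𝒦) with h𝒯h
  have hmeas : ∀ T, MeasurableSet (Metric.closedBall (x T) (2 * h)) := fun T =>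
    Metric.isClosed_closedBall.measurableSet
  have e : ∀ T ∈ 𝒯h, ∫ y in carrier 𝒦 ∩ Metric.closedBall (x T) (2 * h), f y ∂μHE[d] =
      ∫ y in carrier 𝒦, (Metric.closedBall (x T) (2 * h)).indicator f y ∂μHE[d] := fun T _ =>
    (setIntegral_indicator (hmeas T)).symm
  rw [Finset.sum_congr rfl e, ← integral_finsetSum _ fun T _ => hfi.indicator (hmeas T),
    ← integral_const_mul]
  refine integral_mono (integrable_finsetSum _ fun T _ => hfi.indicator (hmeas T))
    (hfi.const_mul _) fun y => ?_
  have e2 : ∑ T ∈ 𝒯h, (Metric.closedBall (x T) (2 * h)).indicator f y =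
      ((𝒯h.filter fun T => y ∈ Metric.closedBall (x T) (2 * h)).card : ℝ) * f y := by
    rw [← nsmul_eq_mul, ← Finset.sum_const, Finset.sum_filter]
    exact Finset.sum_congr rfl fun T _ => by rw [indicator_apply]
  simp only [e2]
  refine mul_le_mul_of_nonneg_right (H.card_real_le (Finset.filter_subset _ _)
    (fun T hT => hx T (Finset.mem_filter.1 hT).1) (y := y) fun T hT => ?_) (hf y)
  rw [norm_sub_rev, ← mem_closedBall_iff_norm]
  refine Metric.closedBall_subset_closedBall ?_ (Finset.mem_filter.1 hT).2
  have := H.σ_pos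
  have := H.h_pos
  gcongr
  linarith

end IsFineMesh

/-- The `L²` norm on the active mesh is controlled by the `L²` norm on the discrete manifold and
the normal gradient. -/
theorem exists_mesh_estimate (d k : ℕ) (C : ℝ) {σ κ : ℝ} (hC : 1 ≤ C) (hσ : 0 < σ)
    (hκ : 0 < κ) : ∃ C' > 0, ∃ h₁ > 0, ∀ (Γ : Set (Euc k)) (r δ₀ h : ℝ) (Ω : Set (Euc k))
      (𝒯 𝒦 : Finset (Finset (Euc k))), IsFineMesh d Γ C r δ₀ σ κ h Ω 𝒯 𝒦 → h ≤ h₁ →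
      ∀ (v : Euc k → ℝ) (β : Finset (Euc k) → ℝ) (b : Finset (Euc k) → Euc k),
      ContinuousOn v (carrier (activeMesh 𝒯 (carrier 𝒦))) →
      (∀ T ∈ activeMesh 𝒯 (carrier 𝒦), ∀ x ∈ simplex T, v x = β T + inner ℝ (b T) x) →
      ∑ T ∈ activeMesh 𝒯 (carrier 𝒦), ∫ x in simplex T, v x ^ 2 ≤
        C' * (h ^ k * ((h ^ d)⁻¹ * ∫ x in carrier 𝒦, v x ^ 2 ∂μHE[d]) +
          h ^ 2 * ∑ T ∈ activeMesh 𝒯 (carrier 𝒦),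
            ∫ x in simplex T, ‖discreteNormalProjExt Γ 𝒦 x (b T)‖ ^ 2) := by
  obtain ⟨C₁, hC₁, hel⟩ := exists_element_estimate d k C hC hσ hκ
  set N : ℝ := ((2 + 3 * σ) * σ) ^ k with hN
  have hN0 : 0 < N := by positivity
  -- For such `h` one has `C₁ * N * h ^ 2 ≤ 1 / 2`, and the mesh norm on the right is absorbed, at
  -- the price of doubling the constant.
  refine ⟨2 * (C₁ * N), by positivity, min 1 (1 / (2 * (C₁ * N))), by positivity, ?_⟩
  intro Γ r δ₀ h Ω 𝒯 𝒦 H hh₁ v β b hv haff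
  have hh := H.h_pos
  set 𝒯h := activeMesh 𝒯 (carrier 𝒦) with h𝒯h
  have hpt : ∀ T ∈ 𝒯h, ∃ x, x ∈ simplex T ∩ carrier 𝒦 := fun T hT => (mem_activeMesh.1 hT).2
  choose! x hx using hpt
  set S : Finset (Euc k) → ℝ := fun T =>
    ∫ x in simplex T, ‖discreteNormalProjExt Γ 𝒦 x (b T)‖ ^ 2 with hS
  set Z : Finset (Euc k) → ℝ := fun T => ∫ x in simplex T, v x ^ 2 with hZ
  have hS0 : ∀ T, 0 ≤ S T := fun T => integral_nonneg fun x => sq_nonneg _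
  have hZ0 : ∀ T, 0 ≤ Z T := fun T => integral_nonneg fun x => sq_nonneg _
  have h1 : ∑ T ∈ 𝒯h, Z T ≤ ∑ T ∈ 𝒯h, C₁ * (h ^ k * ((h ^ d)⁻¹ *
          ∫ y in carrier 𝒦 ∩ Metric.closedBall (x T) (2 * h), v y ^ 2 ∂μHE[d]) +
          h ^ 2 * ∑ T' ∈ elementsNear 𝒯h ((2 + 2 * σ) * h) (x T), (S T' + Z T')) :=
    Finset.sum_le_sum fun T hT => hel Γ r δ₀ h Ω 𝒯 𝒦 H v β b hv haff T hT (x T) (hx T hT)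
  rw [← Finset.mul_sum, Finset.sum_add_distrib, ← Finset.mul_sum, ← Finset.mul_sum,
    ← Finset.mul_sum] at h1
  have h2 := H.sum_sum_elementsNear_le (fun T hT => (hx T hT).1) (W := fun T => S T + Z T)
    fun T => add_nonneg (hS0 T) (hZ0 T)
  have h3 := H.sum_integral_closedBall_le (fun T hT => (hx T hT).1) (f := fun y => v y ^ 2)
    (fun y => sq_nonneg _)
    (integrableOn_carrier H.disc.conforming ((hv.mono H.carrier_subset).pow 2))
  rw [Finset.sum_add_distrib] at h2
  set sumS := ∑ T ∈ 𝒯h, S T with hsumS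
  set sumZ := ∑ T ∈ 𝒯h, Z T with hsumZ
  set I := ∫ y in carrier 𝒦, v y ^ 2 ∂μHE[d] with hI
  have hsumZ0 : 0 ≤ sumZ := Finset.sum_nonneg fun T _ => hZ0 T
  have h4 : sumZ ≤ C₁ * (h ^ k * ((h ^ d)⁻¹ * (N * I)) + h ^ 2 * (N * (sumS + sumZ))) := by
    refine h1.trans ?_
    gcongr
  have h5 : C₁ * N * h ^ 2 ≤ 1 / 2 := by
    have h6 : h ≤ 1 := hh₁.trans (min_le_left _ _)
    have h7 : h ≤ 1 / (2 * (C₁ * N)) := hh₁.trans (min_le_right _ _)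
    rw [le_div_iff₀ (by positivity)] at h7
    have h8 : h ^ 2 ≤ h := by nlinarith
    have h9 : C₁ * N * h ^ 2 ≤ C₁ * N * h := by gcongr
    linarith
  have h6 : C₁ * N * h ^ 2 * sumZ ≤ 1 / 2 * sumZ := by gcongr
  have e : C₁ * (h ^ k * ((h ^ d)⁻¹ * (N * I)) + h ^ 2 * (N * (sumS + sumZ))) =
      C₁ * N * (h ^ k * ((h ^ d)⁻¹ * I) + h ^ 2 * sumS) + C₁ * N * h ^ 2 * sumZ := by ring
  rw [e] at h4
  linarith

end Summation

/-! ### A Poincaré inequality for piecewise Lipschitz functions on a ball. -/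

section BallPoincare

variable {d : ℕ}

theorem volume_preimage_add_smul_le (a : Euc d) {s : ℝ} (hs : 1 / 2 ≤ s) (S : Set (Euc d)) :
    volume ((fun x => a + s • x) ⁻¹' S) ≤ 2 ^ d * volume S := by
  have hs0 : 0 < s := by linarith
  have e : (fun x : Euc d => a + s • x) ⁻¹' S = (s • ·) ⁻¹' ((a + ·) ⁻¹' S) := rfl
  rw [e, Measure.addHaar_preimage_smul _ hs0.ne', measure_preimage_add, finrank_euclideanSpace_fin]
  gcongr
  rw [abs_of_pos (by positivity)]
  have h1 : (s ^ d)⁻¹ ≤ 2 ^ d := by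
    rw [← inv_pow]
    refine pow_le_pow_left₀ (by positivity) ?_ d
    rw [inv_le_comm₀ hs0 two_pos]
    linarith
  calc ENNReal.ofReal (s ^ d)⁻¹ ≤ ENNReal.ofReal (2 ^ d) := ENNReal.ofReal_le_ofReal h1
    _ = 2 ^ d := by rw [ENNReal.ofReal_pow (by norm_num), ENNReal.ofReal_ofNat]

theorem lintegral_lintegral_lintegral_rotate {α β γ : Type*} [MeasurableSpace α]
    [MeasurableSpace β] [MeasurableSpace γ] {μ : Measure α} {ν : Measure β} {τ : Measure γ}
    [SFinite μ] [SFinite ν] [SFinite τ] {F : α → β → γ → ENNReal}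
    (hF : Measurable fun p : (α × γ) × β => F p.1.1 p.2 p.1.2) :
    ∫⁻ u, ∫⁻ u', ∫⁻ t, F u u' t ∂τ ∂ν ∂μ = ∫⁻ t, ∫⁻ u, ∫⁻ u', F u u' t ∂ν ∂μ ∂τ := by
  have e1 : ∀ u, ∫⁻ u', ∫⁻ t, F u u' t ∂τ ∂ν = ∫⁻ t, ∫⁻ u', F u u' t ∂ν ∂τ := fun u =>
    lintegral_lintegral_swap (Measurable.aemeasurable
      (hF.comp (by fun_prop : Measurable fun q : β × γ => ((u, q.2), q.1))))
  simp only [e1]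
  exact lintegral_lintegral_swap (Measurable.aemeasurable hF.lintegral_prod_right')

/-- Averaged over all segments in `B`, the part of a segment that lies in `S` is controlled by the
measure of `S`. -/
theorem lintegral_segment_le {B S : Set (Euc d)} (hS : MeasurableSet S) :
    ∫⁻ u in B, ∫⁻ u' in B, ∫⁻ t in Icc (0 : ℝ) 1,
      S.indicator (fun _ => (1 : ENNReal)) ((1 - t) • u + t • u') ≤
      2 ^ d * volume S * volume B := by
  have hind : Measurable (S.indicator fun _ => (1 : ENNReal)) := measurable_const.indicator hS
  have hinner : ∀ (a : Euc d) (s : ℝ), 1 / 2 ≤ s →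
      ∫⁻ x in B, S.indicator (fun _ => (1 : ENNReal)) (a + s • x) ≤ 2 ^ d * volume S := by
    intro a s hs
    refine (lintegral_mono' Measure.restrict_le_self le_rfl).trans ?_
    have e : (fun x => S.indicator (fun _ => (1 : ENNReal)) (a + s • x)) =
        ((fun x => a + s • x) ⁻¹' S).indicator 1 := by
      ext x
      rfl
    rw [e, lintegral_indicator_one (hS.preimage (by fun_prop))]
    exact volume_preimage_add_smul_le a hs S
  have ht : ∀ t ∈ Icc (0 : ℝ) 1, ∫⁻ u in B, ∫⁻ u' in B,
      S.indicator (fun _ => (1 : ENNReal)) ((1 - t) • u + t • u') ≤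
        2 ^ d * volume S * volume B := by
    intro t ht
    -- One of `t` and `1 - t` is at least 1/2. Integrating first over the endpoint with that weight,
    -- the change of variables costs at most `2 ^ d`.
    rcases le_total (1 / 2) t with h | h
    · calc _ ≤ ∫⁻ _ in B, 2 ^ d * volume S := lintegral_mono fun u => hinner ((1 - t) • u) t h
        _ = _ := setLIntegral_const _ _
    · have hm : Measurable fun p : Euc d × Euc d =>
          S.indicator (fun _ => (1 : ENNReal)) ((1 - t) • p.1 + t • p.2) :=
        hind.comp (by fun_prop)
      rw [lintegral_lintegral_swap hm.aemeasurable]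
      calc _ ≤ ∫⁻ _ in B, 2 ^ d * volume S := lintegral_mono fun u' => by
            have := hinner (t • u') (1 - t) (by linarith)
            simp only [add_comm (t • u')] at this
            exact this
        _ = _ := setLIntegral_const _ _
  have hm : Measurable fun p : (Euc d × ℝ) × Euc d =>
      S.indicator (fun _ => (1 : ENNReal)) ((1 - p.1.2) • p.1.1 + p.1.2 • p.2) :=
    hind.comp (by fun_prop)
  rw [lintegral_lintegral_lintegral_rotate (F := fun u u' t =>
    S.indicator (fun _ => (1 : ENNReal)) ((1 - t) • u + t • u')) hm]
  calc _ ≤ ∫⁻ _ in Icc (0 : ℝ) 1, 2 ^ d * volume S * volume B :=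
        setLIntegral_mono measurable_const ht
    _ = _ := by rw [setLIntegral_const, Real.volume_Icc]; simp

/-- Poincaré inequality on a ball for a continuous function that is Lipschitz continuous on each
set of a finite cover. -/
theorem exists_const_lintegral_sub_sq_le {n : ℕ} {R : ℝ} (hR : 0 < R) {w : Euc d → ℝ}
    (hw : ContinuousOn w (Metric.closedBall 0 R)) {S : Fin n → Set (Euc d)}
    (hS : ∀ i, IsClosed (S i)) (hcov : Metric.closedBall 0 R ⊆ ⋃ i, S i) {c : Fin n → ℝ}
    (hc : ∀ i, 0 ≤ c i) (hlip : ∀ i, ∀ u ∈ S i ∩ Metric.closedBall 0 R,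
      ∀ u' ∈ S i ∩ Metric.closedBall 0 R, |w u - w u'| ≤ c i * ‖u - u'‖) :
    ∃ a : ℝ, ∫⁻ u in Metric.closedBall 0 R, ENNReal.ofReal ((w u - a) ^ 2) ≤
      2 ^ d * ∑ i, ENNReal.ofReal ((2 * R * c i) ^ 2) * volume (S i) := by
  set B := Metric.closedBall (0 : Euc d) R with hB
  have hBc : Convex ℝ B := convex_closedBall 0 R
  have hBtop : volume B ≠ ⊤ := measure_closedBall_lt_top.ne
  have hB0 : volume B ≠ 0 := (Metric.measure_closedBall_pos _ _ hR).ne'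
  set φ : Fin n → Euc d → ENNReal := fun i u => ∫⁻ u' in B, ∫⁻ t in Icc (0 : ℝ) 1,
    (S i).indicator (fun _ => (1 : ENNReal)) ((1 - t) • u + t • u') with hφ
  have hind : ∀ i, Measurable ((S i).indicator fun _ => (1 : ENNReal)) := fun i =>
    measurable_const.indicator (hS i).measurableSet
  have hinner : ∀ i, Measurable fun p : Euc d × Euc d => ∫⁻ t in Icc (0 : ℝ) 1,
      (S i).indicator (fun _ => (1 : ENNReal)) ((1 - t) • p.1 + t • p.2) := fun i =>
    Measurable.lintegral_prod_right' (ν := volume.restrict (Icc (0 : ℝ) 1))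
      (f := fun q : (Euc d × Euc d) × ℝ =>
        (S i).indicator (fun _ => (1 : ENNReal)) ((1 - q.2) • q.1.1 + q.2 • q.1.2))
      ((hind i).comp (by fun_prop))
  have hφm : ∀ i, Measurable (φ i) := fun i => (hinner i).lintegral_prod_right'
  -- Along the segment from `u` to `u'`, of length at most `2 R`, the function has slope at most `2
  -- R c i` during the time spent in `S i`.
  have hpt : ∀ u ∈ B, ∀ u' ∈ B, ENNReal.ofReal ((w u' - w u) ^ 2) ≤
      ∑ i, ENNReal.ofReal ((2 * R * c i) ^ 2) * ∫⁻ t in Icc (0 : ℝ) 1,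
        (S i).indicator (fun _ => (1 : ENNReal)) ((1 - t) • u + t • u') := by
    intro u hu u' hu'
    set ℓ : ℝ → Euc d := fun t => (1 - t) • u + t • u' with hℓ
    have hℓc : Continuous ℓ := by fun_prop
    have hℓB : ∀ t ∈ Icc (0 : ℝ) 1, ℓ t ∈ B := fun t ht =>
      hBc hu hu' (by linarith [ht.2]) ht.1 (by ring)
    have huu : ‖u' - u‖ ≤ 2 * R := by
      have := norm_sub_le u' u
      have := mem_closedBall_zero_iff.1 hu
      have := mem_closedBall_zero_iff.1 hu'
      linarith
    have hℓd : ∀ s t, ‖ℓ s - ℓ t‖ = |s - t| * ‖u' - u‖ := by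
      intro s t
      have : ℓ s - ℓ t = (s - t) • (u' - u) := by simp only [hℓ]; module
      rw [this, norm_smul, Real.norm_eq_abs]
    have h1 := sq_sub_le_sum_of_finite_cover (f := fun t => w (ℓ t))
      (hw.comp hℓc.continuousOn hℓB) (c := fun i => 2 * R * c i)
      (fun i => by have := hc i; positivity) (S := fun i => ℓ ⁻¹' S i)
      (fun i => ((hS i).preimage hℓc).measurableSet)
      (fun t ht => by
        obtain ⟨i, hi⟩ := mem_iUnion.1 (hcov (hℓB t ht))
        exact mem_iUnion.2 ⟨i, hi⟩)
      (fun i s hs t ht => by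
        refine (hlip i _ ⟨hs.1, hℓB s hs.2⟩ _ ⟨ht.1, hℓB t ht.2⟩).trans ?_
        rw [hℓd]
        have := mul_le_mul_of_nonneg_left huu (mul_nonneg (hc i) (abs_nonneg (s - t)))
        linarith)
    have e0 : ℓ 0 = u := by simp [hℓ]
    have e1 : ℓ 1 = u' := by simp [hℓ]
    simp only [e0, e1] at h1
    refine (ENNReal.ofReal_le_ofReal h1).trans ?_
    rw [ENNReal.ofReal_sum_of_nonneg fun i _ => by positivity]
    refine Finset.sum_le_sum fun i _ => ?_
    rw [ENNReal.ofReal_mul (by positivity)]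
    gcongr
    refine ENNReal.ofReal_toReal_le.trans (le_of_eq ?_)
    rw [← Measure.restrict_apply ((hS i).preimage hℓc).measurableSet,
      ← lintegral_indicator_one ((hS i).preimage hℓc).measurableSet]
    rfl
  set Φ : Euc d → ENNReal := fun u => ∑ i, ENNReal.ofReal ((2 * R * c i) ^ 2) * φ i u with hΦ
  have hΦm : Measurable Φ := Finset.measurable_fun_sum _ fun i _ => (hφm i).const_mul _
  -- The constant `a` is the value of `w` at a point where `Φ` does not exceed its average, which
  -- avoids working with the mean of `w`.
  obtain ⟨u, hu, hle⟩ := exists_le_setLAverage hB0 hBtop hΦm.aemeasurable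
  refine ⟨w u, ?_⟩
  calc ∫⁻ u' in B, ENNReal.ofReal ((w u' - w u) ^ 2)
      ≤ ∫⁻ u' in B, ∑ i, ENNReal.ofReal ((2 * R * c i) ^ 2) * ∫⁻ t in Icc (0 : ℝ) 1,
        (S i).indicator (fun _ => (1 : ENNReal)) ((1 - t) • u + t • u') :=
        setLIntegral_mono' Metric.isClosed_closedBall.measurableSet fun u' hu' => hpt u hu u' hu'
    _ = Φ u := by
        have hm : ∀ i, Measurable fun u' : Euc d => ∫⁻ t in Icc (0 : ℝ) 1,
            (S i).indicator (fun _ => (1 : ENNReal)) ((1 - t) • u + t • u') := fun i =>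
          (hinner i).comp measurable_prodMk_left
        rw [lintegral_finsetSum _ fun i _ => (hm i).const_mul _]
        refine Finset.sum_congr rfl fun i _ => ?_
        rw [lintegral_const_mul _ (hm i)]
    _ ≤ (∫⁻ u in B, Φ u) / volume B := by
        rw [← setLAverage_eq]; exact hle
    _ ≤ (∑ i, ENNReal.ofReal ((2 * R * c i) ^ 2) * (2 ^ d * volume (S i) * volume B)) /
        volume B := by
        gcongr
        rw [lintegral_finsetSum _ fun i _ => (hφm i).const_mul _]
        refine Finset.sum_le_sum fun i _ => ?_
        rw [lintegral_const_mul _ (hφm i)]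
        gcongr
        exact lintegral_segment_le (hS i).measurableSet
    _ = _ := by
        have e : ∑ i, ENNReal.ofReal ((2 * R * c i) ^ 2) * (2 ^ d * volume (S i) * volume B) =
            (2 ^ d * ∑ i, ENNReal.ofReal ((2 * R * c i) ^ 2) * volume (S i)) * volume B := by
          rw [Finset.mul_sum, Finset.sum_mul]
          exact Finset.sum_congr rfl fun i _ => by ring
        rw [e, ENNReal.mul_div_cancel_right hB0 hBtop]

end BallPoincare

/-! ### The Poincaré inequality on a patch of the discrete manifold. -/

section Patches

variable {k d : ℕ}

/-- Poincaré inequality on a patch of a discrete manifold. -/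
theorem exists_const_integral_sub_sq_le_patch {𝒦 : Finset (Finset (Euc k))}
    (h𝒦 : IsConformingMesh d 𝒦) {A : Euc d →ₗᵢ[ℝ] Euc k} {Y : Euc d → Euc k} {R : ℝ} (hR : 0 < R)
    (hY : ∀ u ∈ Metric.closedBall 0 R, ∀ u' ∈ Metric.closedBall 0 R,
      ‖Y u - Y u' - (1 : ℝ) • A (u - u')‖ ≤ 1 / 4 * 1 * ‖u - u'‖)
    (hmem : ∀ u ∈ Metric.closedBall 0 R, Y u ∈ carrier 𝒦) {v : Euc k → ℝ}
    (hv : ContinuousOn v (carrier 𝒦)) {g : Finset (Euc k) → ℝ} (hg : ∀ K ∈ 𝒦, 0 ≤ g K)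
    (hlip : ∀ K ∈ 𝒦, ∀ y ∈ simplex K, ∀ y' ∈ simplex K, |v y - v y'| ≤ g K * ‖y - y'‖) :
    ∃ a : ℝ, ∫ y in Y '' Metric.closedBall 0 R, (v y - a) ^ 2 ∂μHE[d] ≤
      (5 / 4) ^ d * 2 ^ d * (4 / 3) ^ d * (5 / 2 * R) ^ 2 *
        ∑ K ∈ 𝒦, g K ^ 2 * (μHE[d] (simplex K)).toReal := by
  set B := Metric.closedBall (0 : Euc d) R with hB
  have hup : ∀ u ∈ B, ∀ u' ∈ B, ‖Y u - Y u'‖ ≤ 5 / 4 * ‖u - u'‖ := fun u hu u' hu' => by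
    have := norm_sub_le_of_near_isometry one_pos hY hu hu'
    rwa [mul_one] at this
  have hlow : ∀ u ∈ B, ∀ u' ∈ B, 3 / 4 * ‖u - u'‖ ≤ ‖Y u - Y u'‖ := fun u hu u' hu' => by
    have := le_norm_sub_of_near_isometry one_pos hY hu hu'
    rwa [mul_one] at this
  have hYl : LipschitzOnWith (5 / 4) Y B := LipschitzOnWith.of_dist_le_mul fun u hu u' hu' => by
    rw [dist_eq_norm, dist_eq_norm]
    exact_mod_cast hup u hu u' hu'
  have hYc : ContinuousOn Y B := hYl.continuousOn
  have hBm : MeasurableSet B := Metric.isClosed_closedBall.measurableSet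
  have hPc : IsCompact (Y '' B) := (isCompact_closedBall 0 R).image_of_continuousOn hYc
  have hPsub : Y '' B ⊆ carrier 𝒦 := image_subset_iff.2 hmem
  let e := 𝒦.equivFin
  let S : Fin 𝒦.card → Set (Euc d) := fun i => B ∩ Y ⁻¹' simplex (e.symm i).1
  have hS : ∀ i, IsClosed (S i) := fun i =>
    hYc.preimage_isClosed_of_isClosed Metric.isClosed_closedBall (isClosed_simplex _)
  obtain ⟨a, ha⟩ := exists_const_lintegral_sub_sq_le hR (w := fun u => v (Y u))
    (hv.comp hYc hmem) hS (fun u hu => by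
      obtain ⟨K, hK, hyK⟩ := mem_carrier.1 (hmem u hu)
      refine mem_iUnion.2 ⟨e ⟨K, hK⟩, hu, ?_⟩
      simpa using hyK) (c := fun i => 5 / 4 * g (e.symm i).1)
    (fun i => by have := hg _ (e.symm i).2; positivity)
    (fun i u hu u' hu' => by
      refine (hlip _ (e.symm i).2 _ hu.1.2 _ hu'.1.2).trans ?_
      have := mul_le_mul_of_nonneg_left (hup u hu.2 u' hu'.2) (hg _ (e.symm i).2)
      linarith)
  refine ⟨a, ?_⟩
  have hvol : ∀ i, volume (S i) ≤ (4 / 3) ^ d * μHE[d] (simplex (e.symm i).1) := by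
    intro i
    have h1 := euclideanHausdorffMeasure_le_image (f := Y) (S := S i) (K := 4 / 3) d
      (fun u hu u' hu' => by
        rw [dist_eq_norm, dist_eq_norm]
        have := hlow u hu.1 u' hu'.1
        push_cast
        linarith)
    rw [EuclideanSpace.euclideanHausdorffMeasure_eq_volume] at h1
    refine h1.trans ?_
    have e1 : ((4 / 3 : NNReal) : ENNReal) = 4 / 3 := by
      rw [ENNReal.coe_div (by norm_num)]; norm_num
    rw [e1]
    gcongr
    rintro _ ⟨u, hu, rfl⟩
    exact hu.2
  -- Surface measure on the patch is dominated by the image of Lebesgue measure, so no area formula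
  -- is needed; `hvol` is the corresponding bound in the other direction.
  have hmeas : μHE[d].restrict (Y '' B) ≤
      ((5 / 4 : NNReal) : ENNReal) ^ d • Measure.map Y (volume.restrict B) := by
    refine Measure.le_iff.2 fun E hE => ?_
    have hYm : AEMeasurable Y (volume.restrict B) := hYc.aemeasurable hBm
    rw [Measure.restrict_apply hE, Measure.smul_apply, smul_eq_mul, Measure.map_apply_of_aemeasurable
      hYm hE]
    have h1 := euclideanHausdorffMeasure_image_le d (hYl.mono (inter_subset_right (s := Y ⁻¹' E)))
    rw [EuclideanSpace.euclideanHausdorffMeasure_eq_volume] at h1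
    have h2 : E ∩ Y '' B ⊆ Y '' (Y ⁻¹' E ∩ B) := by
      rintro _ ⟨hE, u, hu, rfl⟩
      exact ⟨u, ⟨hE, hu⟩, rfl⟩
    exact (measure_mono h2).trans (h1.trans (mul_le_mul' le_rfl (Measure.le_restrict_apply _ _)))
  have hint : IntegrableOn (fun y => (v y - a) ^ 2) (Y '' B) μHE[d] :=
    (integrableOn_carrier h𝒦 ((hv.sub continuousOn_const).pow 2)).mono_set hPsub
  have hG : ∀ K ∈ 𝒦, 0 ≤ g K ^ 2 * (μHE[d] (simplex K)).toReal := fun K _ => by positivity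
  rw [← ENNReal.ofReal_le_ofReal_iff (mul_nonneg (by positivity) (Finset.sum_nonneg hG)),
    ofReal_integral_eq_lintegral_ofReal hint (ae_of_all _ fun y => sq_nonneg _)]
  calc ∫⁻ y in Y '' B, ENNReal.ofReal ((v y - a) ^ 2) ∂μHE[d]
      ≤ ∫⁻ y, ENNReal.ofReal ((v y - a) ^ 2)
          ∂(((5 / 4 : NNReal) : ENNReal) ^ d • Measure.map Y (volume.restrict B)) :=
        lintegral_mono' hmeas le_rfl
    _ ≤ ((5 / 4 : NNReal) : ENNReal) ^ d * ∫⁻ u in B, ENNReal.ofReal ((v (Y u) - a) ^ 2) := by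
        rw [lintegral_smul_measure, smul_eq_mul]
        gcongr
        exact lintegral_map_le _ _
    _ ≤ ((5 / 4 : NNReal) : ENNReal) ^ d * (2 ^ d * ∑ i,
          ENNReal.ofReal ((2 * R * (5 / 4 * g (e.symm i).1)) ^ 2) *
            ((4 / 3) ^ d * μHE[d] (simplex (e.symm i).1))) := by
        gcongr
        refine ha.trans ?_
        gcongr with i
        exact hvol i
    _ = ((5 / 4 : NNReal) : ENNReal) ^ d * (2 ^ d * ∑ K ∈ 𝒦,
          ENNReal.ofReal ((2 * R * (5 / 4 * g K)) ^ 2) * ((4 / 3) ^ d * μHE[d] (simplex K))) := by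
        rw [e.symm.sum_comp fun K : 𝒦 => ENNReal.ofReal ((2 * R * (5 / 4 * g K.1)) ^ 2) *
          ((4 / 3) ^ d * μHE[d] (simplex K.1)), Finset.sum_coe_sort 𝒦 fun K =>
          ENNReal.ofReal ((2 * R * (5 / 4 * g K)) ^ 2) * ((4 / 3) ^ d * μHE[d] (simplex K))]
    _ = _ := by
        have e1 : ∀ K ∈ 𝒦, ENNReal.ofReal ((2 * R * (5 / 4 * g K)) ^ 2) *
            ((4 / 3) ^ d * μHE[d] (simplex K)) = ENNReal.ofReal ((4 / 3) ^ d * (5 / 2 * R) ^ 2 *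
              (g K ^ 2 * (μHE[d] (simplex K)).toReal)) := by
          intro K hK
          have e2 : (4 / 3) ^ d * (5 / 2 * R) ^ 2 * (g K ^ 2 * (μHE[d] (simplex K)).toReal) =
              (2 * R * (5 / 4 * g K)) ^ 2 * ((4 / 3) ^ d * (μHE[d] (simplex K)).toReal) := by ring
          rw [e2, ENNReal.ofReal_mul (by positivity), ENNReal.ofReal_mul (by positivity),
            ENNReal.ofReal_toReal (euclideanHausdorffMeasure_simplex_lt_top h𝒦 hK).ne,
            ENNReal.ofReal_pow (by positivity) d, ENNReal.ofReal_div_of_pos (by norm_num)]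
          norm_num
        rw [Finset.sum_congr rfl e1, ← ENNReal.ofReal_sum_of_nonneg fun K hK =>
          mul_nonneg (by positivity) (hG K hK), ← Finset.mul_sum]
        have e3 : ((5 / 4 : NNReal) : ENNReal) ^ d = ENNReal.ofReal ((5 / 4) ^ d) := by
          rw [ENNReal.ofReal_pow (by positivity)]
          congr 1
          rw [ENNReal.ofReal]
          congr 1
          ext
          rw [Real.coe_toNNReal _ (by norm_num)]
          norm_num
        have e4 : (2 : ENNReal) ^ d = ENNReal.ofReal (2 ^ d) := by
          rw [ENNReal.ofReal_pow (by positivity), ENNReal.ofReal_ofNat]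
        rw [e3, e4, ← ENNReal.ofReal_mul (by positivity), ← ENNReal.ofReal_mul (by positivity)]
        congr 1
        ring

/-- The average minimizes the mean square deviation. -/
theorem setIntegral_sub_average_sq_le {μ : Measure (Euc k)} {S : Set (Euc k)} (hS : μ S < ⊤)
    {v : Euc k → ℝ} (hv : IntegrableOn v S μ) (hv2 : IntegrableOn (fun x => v x ^ 2) S μ) (a : ℝ) :
    ∫ x in S, (v x - (∫ x in S, v x ∂μ) / (μ S).toReal) ^ 2 ∂μ ≤ ∫ x in S, (v x - a) ^ 2 ∂μ := by
  rcases eq_or_ne (μ S) 0 with h0 | h0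
  · rw [Measure.restrict_eq_zero.2 h0]; simp
  set m := (μ S).toReal with hm
  have hm0 : 0 < m := ENNReal.toReal_pos h0 hS.ne
  set J := ∫ x in S, v x ∂μ with hJ
  have hexp : ∀ c : ℝ, ∫ x in S, (v x - c) ^ 2 ∂μ =
      (∫ x in S, v x ^ 2 ∂μ) - 2 * c * J + c ^ 2 * m := by
    intro c
    have e : (fun x => (v x - c) ^ 2) = fun x => (v x ^ 2 - 2 * c * v x) + c ^ 2 := by
      ext x; ring
    have h1 : Integrable (fun x => 2 * c * v x) (μ.restrict S) := hv.const_mul _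
    have h2 : Integrable (fun x => v x ^ 2 - 2 * c * v x) (μ.restrict S) := hv2.sub h1
    rw [e, integral_add h2 (integrableOn_const hS.ne), integral_sub hv2 h1, integral_const_mul, setIntegral_const, smul_eq_mul,
      Measure.real]
    ring
  rw [hexp, hexp]
  have hJm : J = J / m * m := by field_simp
  set l := J / m
  rw [hJm]
  -- The two sides differ by exactly `m * (l - a) ^ 2`.
  nlinarith [mul_nonneg hm0.le (sq_nonneg (l - a))]

end Patches

/-! ### The Poincaré inequality on the whole discrete manifold. -/

section Poincare

variable {k d : ℕ} {Γ : Set (Euc k)} {C r δ₀ σ κ h : ℝ} {Ω : Set (Euc k)}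
  {𝒯 𝒦 : Finset (Finset (Euc k))}

/-- The centres of a finite cover of a connected set by balls are linked by overlapping balls. -/
theorem reflTransGen_of_isPreconnected_of_cover {E : Type*} [PseudoMetricSpace E] {Γ : Set E}
    (hΓ : IsPreconnected Γ) {Q : Finset E} (hQ : ↑Q ⊆ Γ) {s : ℝ} (hs : 0 < s)
    (hcov : Γ ⊆ ⋃ q ∈ Q, Metric.ball q s) {q₀ q : E} (hq₀ : q₀ ∈ Q) (hq : q ∈ Q) :
    Relation.ReflTransGen (fun a b => a ∈ Q ∧ b ∈ Q ∧
      (Γ ∩ (Metric.ball a s ∩ Metric.ball b s)).Nonempty) q₀ q := by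
  by_contra hcon
  set L := Relation.ReflTransGen (fun a b => a ∈ Q ∧ b ∈ Q ∧
    (Γ ∩ (Metric.ball a s ∩ Metric.ball b s)).Nonempty) q₀ with hL
  -- The balls about the centres reachable from `q₀` and those about the others form two open sets
  -- covering `Γ`. Connectedness makes them meet on `Γ`, which would link an unreachable centre.
  obtain ⟨z, hz, hz1, hz2⟩ := hΓ (⋃ a ∈ {a | a ∈ Q ∧ L a}, Metric.ball a s)
    (⋃ a ∈ {a | a ∈ Q ∧ ¬ L a}, Metric.ball a s)
    (isOpen_biUnion fun _ _ => Metric.isOpen_ball) (isOpen_biUnion fun _ _ => Metric.isOpen_ball)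
    (fun z hz => by
      obtain ⟨a, ha, hza⟩ := mem_iUnion₂.1 (hcov hz)
      by_cases h : L a
      · exact Or.inl (mem_iUnion₂.2 ⟨a, ⟨ha, h⟩, hza⟩)
      · exact Or.inr (mem_iUnion₂.2 ⟨a, ⟨ha, h⟩, hza⟩))
    ⟨q₀, hQ hq₀, mem_iUnion₂.2 ⟨q₀, ⟨hq₀, .refl⟩, Metric.mem_ball_self hs⟩⟩
    ⟨q, hQ hq, mem_iUnion₂.2 ⟨q, ⟨hq, hcon⟩, Metric.mem_ball_self hs⟩⟩
  obtain ⟨a, ha, hza⟩ := mem_iUnion₂.1 hz1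
  obtain ⟨b, hb, hzb⟩ := mem_iUnion₂.1 hz2
  exact hb.2 (ha.2.tail ⟨ha.1, hb.1, z, hz, hza, hzb⟩)

namespace IsFineMesh

variable (H : IsFineMesh d Γ C r δ₀ σ κ h Ω 𝒯 𝒦)
include H

theorem norm_sub_closestPoint_le {y : Euc k} (hy : y ∈ carrier 𝒦) :
    ‖y - closestPoint Γ y‖ ≤ κ * h := by
  have h1 := (H.isClosestPoint (H.carrier_subset hy)).2
  rw [dist_eq_norm] at h1
  rw [h1]
  refine (H.disc.dist_le y hy).trans ?_
  have h2 : h ^ 2 ≤ h := by nlinarith [H.h_pos, H.h_le_one]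
  exact mul_le_mul_of_nonneg_left h2 H.κ_pos.le

/-- The discrete manifold over a ball about a point of `Γ` as a graph. -/
theorem exists_patch {R : ℝ} (hR : 0 < R) (hRr : R ≤ r) (hRC : 128 * C ^ 2 * R ≤ 1)
    (hhC : 32 * C * κ * h ≤ 1) {q : Euc k} (hq : q ∈ Γ) :
    ∃ (A : Euc d →ₗᵢ[ℝ] Euc k) (Y : Euc d → Euc k),
      (∀ u ∈ Metric.closedBall 0 R, ∀ u' ∈ Metric.closedBall 0 R,
        ‖Y u - Y u' - (1 : ℝ) • A (u - u')‖ ≤ 1 / 4 * 1 * ‖u - u'‖) ∧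
      (∀ u ∈ Metric.closedBall 0 R, Y u ∈ carrier 𝒦) ∧
      (∀ y ∈ carrier 𝒦, ‖closestPoint Γ y - q‖ ≤ R → ∃ u ∈ Metric.closedBall 0 R, Y u = y) ∧
      ‖Y 0 - q‖ ≤ κ * h := by
  have hh := H.h_pos
  have hC := H.geom.C_ge
  have hκ0 := H.κ_pos
  have hσ := H.σ_pos
  have hκ : 4 * C * (κ * h ^ 2) ≤ 1 := by
    have h1 := H.tube_le
    have : 0 ≤ 4 * C * (σ * h) := by positivity
    linarith
  obtain ⟨y₀, hy₀, rfl⟩ := H.disc.bijOn.surjOn hq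
  obtain ⟨A, hA, hAmem⟩ := H.geom.exists_frame (H.disc.bijOn.mapsTo hy₀)
  -- The slope budget: the three terms with `κ` contribute at most `3/32` and the curvature term at
  -- most `1/32`, so twice their sum is at most `1/4`.
  obtain ⟨Y, hY0, hYmem, hY, hYsurj⟩ := H.disc.exists_chart (ε := 1 / 4) H.geom H.tub hκ0.le hh.le
    hκ hRr (by have : 0 ≤ C ^ 2 * R := by positivity
               linarith) (by norm_num) (by
      have h1 : κ * h ≤ C * (κ * h) := le_mul_of_one_le_left (by positivity) hC
      have h2 : C * (κ * h ^ 2) ≤ C * (κ * h) := by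
        have : h ^ 2 ≤ h := by nlinarith [H.h_le_one]
        gcongr
      linarith) hy₀ hA hAmem hR.le
  refine ⟨A, Y, fun u hu u' hu' => ?_, hYmem, hYsurj, ?_⟩
  · rw [one_smul, mul_one]
    exact hY u hu u' hu'
  · rw [hY0]
    exact H.norm_sub_closestPoint_le hy₀

end IsFineMesh

/-- Poincaré inequality on the discrete manifold, with a constant that depends on `Γ` only. -/
theorem exists_poincare (hΓ : IsCompact Γ) (hconn : IsConnected Γ) (hC : 1 ≤ C) (hr : 0 < r)
    (hκ : 0 < κ) : ∃ C' > 0, ∃ h₂ > 0, ∀ (δ₀ σ h : ℝ) (Ω : Set (Euc k))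
      (𝒯 𝒦 : Finset (Finset (Euc k))), IsFineMesh d Γ C r δ₀ σ κ h Ω 𝒯 𝒦 → h ≤ h₂ →
      ∀ (v : Euc k → ℝ) (g : Finset (Euc k) → ℝ), ContinuousOn v (carrier 𝒦) →
      (∀ K ∈ 𝒦, 0 ≤ g K) →
      (∀ K ∈ 𝒦, ∀ y ∈ simplex K, ∀ y' ∈ simplex K, |v y - v y'| ≤ g K * ‖y - y'‖) →
      ∃ a : ℝ, ∫ y in carrier 𝒦, (v y - a) ^ 2 ∂μHE[d] ≤
        C' * ∑ K ∈ 𝒦, g K ^ 2 * (μHE[d] (simplex K)).toReal := by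
  classical
  -- The patch radius depends on the geometry of `Γ` only and not on `h`, so the number of patches
  -- is fixed as well.
  set R := min r (1 / (128 * C ^ 2)) with hRdef
  have hR : 0 < R := by positivity
  have hRr : R ≤ r := min_le_left _ _
  have hRC : 128 * C ^ 2 * R ≤ 1 := by
    have : R ≤ 1 / (128 * C ^ 2) := min_le_right _ _
    rwa [le_div_iff₀ (by positivity), mul_comm] at this
  obtain ⟨t, htΓ, htf, htcov⟩ := hΓ.finite_cover_balls (by positivity : 0 < R / 4)
  obtain ⟨Q, rfl⟩ : ∃ Q : Finset (Euc k), (Q : Set (Euc k)) = t := ⟨htf.toFinset, by simp⟩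
  have htcov' : Γ ⊆ ⋃ q ∈ Q, Metric.ball q (R / 4) := by simpa using htcov
  obtain ⟨q₀, hq₀⟩ : ∃ q₀, q₀ ∈ Q := by
    obtain ⟨z, hz⟩ := hconn.nonempty
    obtain ⟨q, hq, -⟩ := mem_iUnion₂.1 (htcov' hz)
    exact ⟨q, hq⟩
  have hvd := unitBallVolume_pos d
  set C₀ : ℝ := (5 / 4) ^ d * 2 ^ d * (4 / 3) ^ d * (5 / 2 * R) ^ 2 with hC₀
  have hC₀0 : 0 < C₀ := by positivity
  set m₀ : ℝ := (3 / 4) ^ d * ((R / 4) ^ d * unitBallVolume d) with hm₀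
  have hm₀0 : 0 < m₀ := by positivity
  set M : ℝ := (5 / 4) ^ d * (R ^ d * unitBallVolume d) with hM
  have hM0 : 0 < M := by positivity
  have hQ0 : 0 < (Q.card : ℝ) := by exact_mod_cast Finset.card_pos.2 ⟨q₀, hq₀⟩
  refine ⟨Q.card * (2 * C₀ + 2 * M * (Q.card ^ 2 * (4 * C₀ / m₀))), by positivity,
    min (1 / (32 * C * κ)) (R / (16 * κ)), by positivity, ?_⟩
  intro δ₀ σ h Ω 𝒯 𝒦 H hh₂ v g hv hg hlip
  have hh := H.h_pos
  have hhC : 32 * C * κ * h ≤ 1 := by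
    have := hh₂.trans (min_le_left _ _)
    rwa [le_div_iff₀ (by positivity), mul_comm] at this
  have hhR : 16 * κ * h ≤ R := by
    have := hh₂.trans (min_le_right _ _)
    rwa [le_div_iff₀ (by positivity), mul_comm] at this
  set G := ∑ K ∈ 𝒦, g K ^ 2 * (μHE[d] (simplex K)).toReal with hG
  have hG0 : 0 ≤ G := Finset.sum_nonneg fun K _ => by positivity
  have hpatch : ∀ q ∈ Q, _ := fun q hq => H.exists_patch hR hRr hRC hhC (htΓ hq)
  choose! A Y hY hYmem hYsurj hY0 using hpatch
  have hpoin : ∀ q ∈ Q, ∃ a : ℝ, ∫ y in Y q '' Metric.closedBall 0 R, (v y - a) ^ 2 ∂μHE[d] ≤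
      C₀ * G := fun q hq => exists_const_integral_sub_sq_le_patch H.disc.conforming hR (hY q hq)
    (hYmem q hq) hv hg hlip
  choose! a ha using hpoin
  set P : Euc k → Set (Euc k) := fun q => Y q '' Metric.closedBall 0 R with hP
  have hlips : ∀ q ∈ Q, LipschitzOnWith (5 / 4) (Y q) (Metric.closedBall 0 R) := fun q hq =>
    LipschitzOnWith.of_dist_le_mul fun u hu u' hu' => by
      rw [dist_eq_norm, dist_eq_norm]
      have := norm_sub_le_of_near_isometry one_pos (hY q hq) hu hu'
      rw [mul_one] at this
      exact_mod_cast this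
  have hPsub : ∀ q ∈ Q, P q ⊆ carrier 𝒦 := fun q hq => image_subset_iff.2 (hYmem q hq)
  have hPm : ∀ q ∈ Q, MeasurableSet (P q) := fun q hq =>
    ((isCompact_closedBall 0 R).image_of_continuousOn (hlips q hq).continuousOn).isClosed.measurableSet
  have hfin := euclideanHausdorffMeasure_carrier_lt_top H.disc.conforming
  have hPfin : ∀ q ∈ Q, μHE[d] (P q) < ⊤ := fun q hq => (measure_mono (hPsub q hq)).trans_lt hfin
  have hPM : ∀ q ∈ Q, (μHE[d] (P q)).toReal ≤ M := by
    intro q hq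
    have h1 := euclideanHausdorffMeasure_image_le d (hlips q hq)
    rw [EuclideanSpace.euclideanHausdorffMeasure_eq_volume] at h1
    have h2 := ENNReal.toReal_mono (ENNReal.mul_ne_top (ENNReal.pow_ne_top ENNReal.coe_ne_top) measure_closedBall_lt_top.ne) h1
    rw [ENNReal.toReal_mul, ENNReal.toReal_pow, ENNReal.coe_toReal,
      volume_closedBall_toReal _ hR.le] at h2
    exact_mod_cast h2
  have hint : ∀ c : ℝ, IntegrableOn (fun y => (v y - c) ^ 2) (carrier 𝒦) μHE[d] := fun c =>
    integrableOn_carrier H.disc.conforming ((hv.sub continuousOn_const).pow 2)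
  -- Neighbouring patches share the image of a ball of radius `R / 4`, of measure at least `m₀`. On
  -- it `v` is close to both constants in mean square, so the constants are close to each other.
  have hstep : ∀ q q', (q ∈ Q ∧ q' ∈ Q ∧
      (Γ ∩ (Metric.ball q (R / 4) ∩ Metric.ball q' (R / 4))).Nonempty) →
      |a q - a q'| ≤ Real.sqrt (4 * C₀ / m₀ * G) := by
    rintro q q' ⟨hq, hq', z, hz, hzq, hzq'⟩
    rw [mem_ball_iff_norm] at hzq hzq'
    obtain ⟨y, hy, rfl⟩ := H.disc.bijOn.surjOn hz
    obtain ⟨u, hu, rfl⟩ := hYsurj q hq y hy (by linarith)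
    have h0R : (0 : Euc d) ∈ Metric.closedBall (0 : Euc d) R := Metric.mem_closedBall_self hR.le
    -- `3/4 ‖u‖ ≤ 2 κ h + R/4 ≤ 3/8 R`, by the smallness of `h` relative to `R`.
    have hun : ‖u‖ ≤ R / 2 := by
      have h1 := le_norm_sub_of_near_isometry one_pos (hY q hq) hu h0R
      rw [mul_one, sub_zero] at h1
      have h2 := H.norm_sub_closestPoint_le hy
      have h3 := hY0 q hq
      have e : Y q u - Y q 0 = (Y q u - closestPoint Γ (Y q u)) + (closestPoint Γ (Y q u) - q) -
          (Y q 0 - q) := by abel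
      have h4 := norm_sub_le ((Y q u - closestPoint Γ (Y q u)) + (closestPoint Γ (Y q u) - q))
        (Y q 0 - q)
      have h5 := norm_add_le (Y q u - closestPoint Γ (Y q u)) (closestPoint Γ (Y q u) - q)
      rw [← e] at h4
      linarith
    have hsub : Metric.closedBall u (R / 4) ⊆ Metric.closedBall 0 R :=
      Metric.closedBall_subset_closedBall' (by rw [dist_zero_right]; linarith)
    set S := Y q '' Metric.closedBall u (R / 4) with hS
    have hSP : S ⊆ P q := image_mono hsub
    -- Projections of points of `S` stay within `2 * 5/4 * R/4 + R/4 = 7/8 R` of `q'`, so `S` is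
    -- covered by the patch over `q'` too.
    have hSP' : S ⊆ P q' := by
      rintro _ ⟨w, hw, rfl⟩
      have hwR := hsub hw
      have h1 := H.norm_closestPoint_sub_le (H.carrier_subset (hYmem q hq w hwR))
        (H.carrier_subset hy)
      have h2 := norm_sub_le_of_near_isometry one_pos (hY q hq) hwR hu
      have h3 : ‖w - u‖ ≤ R / 4 := by rwa [← mem_closedBall_iff_norm]
      have h4 := norm_add_le (closestPoint Γ (Y q w) - closestPoint Γ (Y q u))
        (closestPoint Γ (Y q u) - q')
      rw [sub_add_sub_cancel] at h4
      obtain ⟨w', hw', he⟩ := hYsurj q' hq' _ (hYmem q hq w hwR) (by linarith)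
      exact ⟨w', hw', he⟩
    have hSfin : μHE[d] S < ⊤ := (measure_mono hSP).trans_lt (hPfin q hq)
    have hSc : MeasurableSet S := ((isCompact_closedBall u (R / 4)).image_of_continuousOn
      ((hlips q hq).continuousOn.mono hsub)).isClosed.measurableSet
    have hSlow : m₀ ≤ (μHE[d] S).toReal := by
      have h1 := euclideanHausdorffMeasure_le_image (f := Y q) (S := Metric.closedBall u (R / 4))
        (K := 4 / 3) d (fun w hw w' hw' => by
          have := le_norm_sub_of_near_isometry one_pos (hY q hq) (hsub hw) (hsub hw')
          rw [dist_eq_norm, dist_eq_norm]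
          push_cast
          linarith)
      have h2 := ENNReal.toReal_mono (ENNReal.mul_ne_top (ENNReal.pow_ne_top ENNReal.coe_ne_top) hSfin.ne) h1
      rw [EuclideanSpace.euclideanHausdorffMeasure_eq_volume, volume_closedBall_toReal _
        (by positivity), ENNReal.toReal_mul, ENNReal.toReal_pow, ENNReal.coe_toReal] at h2
      push_cast at h2
      calc m₀ ≤ (3 / 4) ^ d * ((4 / 3) ^ d * (μHE[d] S).toReal) := by rw [hm₀]; gcongr
        _ = _ := by rw [← mul_assoc, ← mul_pow]; norm_num
    have hintS : ∀ c : ℝ, IntegrableOn (fun y => (v y - c) ^ 2) S μHE[d] := fun c =>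
      (hint c).mono_set (hSP.trans (hPsub q hq))
    have hSa : ∀ p ∈ Q, S ⊆ P p → ∫ y in S, (v y - a p) ^ 2 ∂μHE[d] ≤ C₀ * G := fun p hp hSp =>
      (setIntegral_mono_set ((hint (a p)).mono_set (hPsub p hp)) (ae_of_all _ fun y => sq_nonneg _)
        (LE.le.eventuallyLE hSp)).trans (ha p hp)
    have h1 : (μHE[d] S).toReal * (a q - a q') ^ 2 ≤ 2 * (C₀ * G) + 2 * (C₀ * G) := by
      calc _ = ∫ _ in S, (a q - a q') ^ 2 ∂μHE[d] := by
            rw [setIntegral_const, smul_eq_mul, Measure.real]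
        _ ≤ ∫ y in S, (2 * (v y - a q) ^ 2 + 2 * (v y - a q') ^ 2) ∂μHE[d] := by
            refine setIntegral_mono_on (integrableOn_const hSfin.ne)
              (((hintS (a q)).const_mul 2).add ((hintS (a q')).const_mul 2)) hSc fun y _ => ?_
            nlinarith [sq_nonneg ((v y - a q) + (v y - a q'))]
        _ = 2 * (∫ y in S, (v y - a q) ^ 2 ∂μHE[d]) + 2 * ∫ y in S, (v y - a q') ^ 2 ∂μHE[d] := by
            rw [integral_add ((hintS (a q)).const_mul 2) ((hintS (a q')).const_mul 2),
              integral_const_mul, integral_const_mul]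
        _ ≤ _ := by
            have := hSa q hq hSP
            have := hSa q' hq' hSP'
            linarith
    refine Real.abs_le_sqrt ?_
    rw [div_mul_eq_mul_div, le_div_iff₀ hm₀0, mul_comm]
    have := mul_le_mul_of_nonneg_right hSlow (sq_nonneg (a q - a q'))
    linarith
  have hdev : ∀ q ∈ Q, (a q - a q₀) ^ 2 ≤ Q.card ^ 2 * (4 * C₀ / m₀ * G) := by
    intro q hq
    have h1 := abs_sub_le_card_mul_of_reflTransGen (g := a) (Real.sqrt_nonneg (4 * C₀ / m₀ * G))
      Q.card Q _ q₀ q le_rfl (fun x y hxy => ⟨hxy.1, hxy.2.1, hstep x y hxy⟩)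
      (reflTransGen_of_isPreconnected_of_cover hconn.isPreconnected htΓ (by positivity) htcov' hq₀ hq)
    rw [abs_sub_comm] at h1
    have h2 := pow_le_pow_left₀ (abs_nonneg _) h1 2
    rwa [sq_abs, mul_pow, Real.sq_sqrt (by positivity)] at h2
  refine ⟨a q₀, ?_⟩
  have hcarr : ∀ y ∈ carrier 𝒦, ∃ q ∈ Q, y ∈ P q := by
    intro y hy
    obtain ⟨q, hq, hyq⟩ := mem_iUnion₂.1 (htcov' (H.disc.bijOn.mapsTo hy))
    rw [mem_ball_iff_norm] at hyq
    obtain ⟨u, hu, he⟩ := hYsurj q hq y hy (by linarith)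
    exact ⟨q, hq, u, hu, he⟩
  calc ∫ y in carrier 𝒦, (v y - a q₀) ^ 2 ∂μHE[d]
      ≤ ∫ y in carrier 𝒦, ∑ q ∈ Q, (P q).indicator (fun y => (v y - a q₀) ^ 2) y ∂μHE[d] := by
        refine setIntegral_mono_on (hint _) (integrable_finsetSum _ fun q hq =>
          (hint _).indicator (hPm q hq)) (isCompact_carrier 𝒦).isClosed.measurableSet
          fun y hy => ?_
        obtain ⟨q, hq, hyq⟩ := hcarr y hy
        refine le_trans (le_of_eq ?_) (Finset.single_le_sum
          (fun q _ => indicator_nonneg (fun y _ => sq_nonneg (v y - a q₀)) y) hq)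
        rw [indicator_of_mem hyq]
    _ = ∑ q ∈ Q, ∫ y in P q, (v y - a q₀) ^ 2 ∂μHE[d] := by
        rw [integral_finsetSum _ fun q hq => (hint _).indicator (hPm q hq)]
        refine Finset.sum_congr rfl fun q hq => ?_
        rw [setIntegral_indicator (hPm q hq), inter_eq_right.2 (hPsub q hq)]
    _ ≤ ∑ q ∈ Q, (2 * C₀ + 2 * M * (Q.card ^ 2 * (4 * C₀ / m₀))) * G := by
        refine Finset.sum_le_sum fun q hq => ?_
        have hintP : ∀ c : ℝ, IntegrableOn (fun y => (v y - c) ^ 2) (P q) μHE[d] := fun c =>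
          (hint c).mono_set (hPsub q hq)
        calc _ ≤ ∫ y in P q, (2 * (v y - a q) ^ 2 + 2 * (a q - a q₀) ^ 2) ∂μHE[d] := by
              refine setIntegral_mono_on (hintP _) (((hintP _).const_mul 2).add
                (integrableOn_const (hPfin q hq).ne)) (hPm q hq) fun y _ => ?_
              nlinarith [sq_nonneg ((v y - a q) - (a q - a q₀))]
          _ = 2 * (∫ y in P q, (v y - a q) ^ 2 ∂μHE[d]) +
              (μHE[d] (P q)).toReal * (2 * (a q - a q₀) ^ 2) := by
              rw [integral_add ((hintP _).const_mul 2) (integrableOn_const (hPfin q hq).ne),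
                integral_const_mul, setIntegral_const, smul_eq_mul, Measure.real]
          _ ≤ 2 * (C₀ * G) + M * (2 * (Q.card ^ 2 * (4 * C₀ / m₀ * G))) := by
              gcongr
              · exact ha q hq
              · exact hPM q hq
              · exact hdev q hq
          _ = _ := by ring
    _ = _ := by rw [Finset.sum_const, nsmul_eq_mul]; ring

end Poincare

/-! ### Assembly of the two inequalities. -/

section Main

/-- All smallness conditions hold strictly at `h = 0` and are continuous in `h`. -/
theorem exists_forall_isFineMesh {k d : ℕ} {Γ : Set (Euc k)} {C r δ₀ σ κ : ℝ}
    (hg : UniformGeometry d Γ C r) (hδ : IsTubularRadius Γ δ₀) (hσ : 0 < σ) (hκ : 0 < κ) :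
    ∃ h₃ > 0, ∀ (h : ℝ) (Ω : Set (Euc k)) (𝒯 𝒦 : Finset (Finset (Euc k))), 0 < h → h ≤ h₃ →
      IsOpen Ω → Metric.thickening δ₀ Γ ⊆ Ω → IsBackgroundMesh σ h Ω 𝒯 →
      IsDiscreteManifold d Γ δ₀ κ h 𝒯 𝒦 → IsFineMesh d Γ C r δ₀ σ κ h Ω 𝒯 𝒦 := by
  have hC := hg.C_ge
  have hlim : ∀ f : ℝ → ℝ, Continuous f → ∀ a, f 0 < a → ∀ᶠ h in nhds (0 : ℝ), f h < a :=
    fun f hf a ha => hf.continuousAt.eventually_lt continuousAt_const ha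
  have h1 := hlim (fun h => h) (by fun_prop) 1 one_pos
  have h2 := hlim (fun h => κ * h ^ 2 + σ * h) (by fun_prop) δ₀ (by simpa using hδ.1)
  have h3 := hlim (fun h => 4 * C * (κ * h ^ 2 + σ * h)) (by fun_prop) 1 (by simp)
  have h4 := hlim (fun h => h) (by fun_prop) r hg.r_pos
  have h5 := hlim (fun h => 6 * C ^ 2 * h) (by fun_prop) 1 (by simp)
  have h6 := hlim (fun h => 2 * (κ * h + 4 * C ^ 2 * h + 2 * C * (κ * h ^ 2))) (by fun_prop)
    (1 / 4) (by simp)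
  obtain ⟨ε, hε, hball⟩ := Metric.eventually_nhds_iff.1
    (h1.and (h2.and (h3.and (h4.and (h5.and h6)))))
  refine ⟨ε / 2, half_pos hε, fun h Ω 𝒯 𝒦 hh hhε hΩ hthick hbg hdisc => ?_⟩
  obtain ⟨k1, k2, k3, k4, k5, k6⟩ := @hball h (by
    rw [Real.dist_0_eq_abs, abs_of_pos hh]; linarith)
  exact ⟨hg, hδ, hσ, hκ, hh, hΩ, hthick, hbg, hdisc, k1.le, k2, k3.le, k4.le, k5.le, k6.le⟩

theorem abs_affine_sub_le_of_mem_simplex {k : ℕ} {K : Finset (Euc k)} (b : Euc k) {y y' : Euc k}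
    (hy : y ∈ simplex K) (hy' : y' ∈ simplex K) :
    |inner ℝ b y - inner ℝ b y'| ≤ ‖discreteTangentialProj K b‖ * ‖y - y'‖ := by
  have e : inner ℝ b y - inner ℝ b y' = inner ℝ (discreteTangentialProj K b) (y - y') := by
    rw [← inner_sub_right, ← discreteTangentialProj_sub hy hy', discreteTangentialProj,
      ← Submodule.inner_starProjection_left_eq_right, ← discreteTangentialProj,
      discreteTangentialProj_sub hy hy']
  rw [e]
  exact abs_real_inner_le_norm _ _

theorem normalGradStab_eq {k c : ℕ} {Γ : Set (Euc k)} {α h : ℝ} {𝒯h 𝒦 : Finset (Finset (Euc k))}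
    (h𝒯h : IsConformingMesh k 𝒯h) {v : Euc k → ℝ} {β : Finset (Euc k) → ℝ}
    {b : Finset (Euc k) → Euc k}
    (haff : ∀ T ∈ 𝒯h, ∀ x ∈ simplex T, v x = β T + inner ℝ (b T) x) :
    normalGradStab c Γ α h 𝒯h 𝒦 v v = h ^ (α - c) *
      ∑ T ∈ 𝒯h, ∫ x in simplex T, ‖discreteNormalProjExt Γ 𝒦 x (b T)‖ ^ 2 := by
  rw [normalGradStab, meshIntegral]
  congr 1
  refine Finset.sum_congr rfl fun T hT => ?_
  refine setIntegral_congr_fun (isClosed_simplex T).measurableSet fun x hx => ?_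
  rw [gradientWithin_eq_of_affine (affineSpan_eq_top_of_mesh h𝒯h hT) (haff T hT) hx,
    real_inner_self_eq_norm_sq]

/-- The scaled form of `exists_mesh_estimate`. -/
theorem rpow_mul_le_of_le {d c : ℕ} {α h Z I S C : ℝ} (hα : α ≤ 2) (hh : 0 < h) (hh1 : h ≤ 1)
    (hC : 0 ≤ C) (hS : 0 ≤ S) (hZ : Z ≤ C * (h ^ (d + c) * ((h ^ d)⁻¹ * I) + h ^ 2 * S)) :
    h ^ (-(c : ℝ)) * Z ≤ C * (I + h ^ (α - c) * S) := by
  have h1 : h ^ (-(c : ℝ)) = (h ^ c)⁻¹ := by rw [Real.rpow_neg hh.le, Real.rpow_natCast]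
  have h2 : h ^ (-(c : ℝ)) * h ^ 2 ≤ h ^ (α - c) := by
    -- Here `α ≤ 2` and `h ≤ 1` enter: the mesh estimate has the weight `h ^ (2 - c)`, which is
    -- dominated by `h ^ (α - c)`.
    have e : h ^ (-(c : ℝ)) * h ^ 2 = h ^ ((2 : ℝ) - c) := by
      rw [← Real.rpow_natCast h 2, ← Real.rpow_add hh]
      congr 1
      push_cast
      ring
    rw [e]
    exact Real.rpow_le_rpow_of_exponent_ge hh hh1 (by linarith)
  have h3 : h ^ (-(c : ℝ)) * (h ^ (d + c) * ((h ^ d)⁻¹ * I)) = I := by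
    rw [h1, pow_add]
    field_simp
  have h0 : 0 ≤ h ^ (-(c : ℝ)) := Real.rpow_nonneg hh.le _
  calc h ^ (-(c : ℝ)) * Z
      ≤ h ^ (-(c : ℝ)) * (C * (h ^ (d + c) * ((h ^ d)⁻¹ * I) + h ^ 2 * S)) := by gcongr
    _ = C * (h ^ (-(c : ℝ)) * (h ^ (d + c) * ((h ^ d)⁻¹ * I)) + h ^ (-(c : ℝ)) * h ^ 2 * S) := by
        ring
    _ ≤ _ := by
        rw [h3]
        gcongr

end Main

theorem mainTheorem4 (d c : ℕ) (Γ : Set (Euc (d + c)))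
    (hΓ_compact : IsCompact Γ) (hΓ_smooth : IsSmoothSubmanifold d c Γ)
    (δ₀ : ℝ) (hδ₀ : IsTubularRadius Γ δ₀) (σ κ : ℝ) (hσ : 0 < σ) (hκ : 0 < κ) :
    ∃ h₀ : ℝ, 0 < h₀ ∧ ∃ C : ℝ, 0 < C ∧
      ∀ (α h : ℝ) (Ω : Set (Euc (d + c))) (𝒯 𝒦 : Finset (Finset (Euc (d + c)))),
        α ∈ Icc (0 : ℝ) 2 → 0 < h → h ≤ h₀ →
        IsOpen Ω → Bornology.IsBounded Ω → Metric.thickening δ₀ Γ ⊆ Ω →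
        IsBackgroundMesh σ h Ω 𝒯 → IsDiscreteManifold d Γ δ₀ κ h 𝒯 𝒦 →
        ∀ v : Euc (d + c) → ℝ, IsP1Function (activeMesh 𝒯 (carrier 𝒦)) v →
          h ^ (-(c : ℝ)) * meshNormSq volume (activeMesh 𝒯 (carrier 𝒦)) v ≤
              C * (meshNormSq μHE[d] 𝒦 v +
                normalGradStab c Γ α h (activeMesh 𝒯 (carrier 𝒦)) 𝒦 v v) ∧
          (IsConnected Γ →
            h ^ (-(c : ℝ)) * meshNormSq volume (activeMesh 𝒯 (carrier 𝒦))
                (fun x => v x - surfaceAverage d 𝒦 v) ≤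
              C * (surfaceGradNormSq d 𝒦 v +
                normalGradStab c Γ α h (activeMesh 𝒯 (carrier 𝒦)) 𝒦 v v)) := by
  classical
  obtain ⟨C₀, r, hg⟩ := exists_uniformGeometry hΓ_compact hΓ_smooth
  obtain ⟨h₃, hh₃, hfine⟩ := exists_forall_isFineMesh hg hδ₀ hσ hκ
  obtain ⟨C₁, hC₁, h₁, hh₁, hmesh⟩ := exists_mesh_estimate d (d + c) C₀ hg.C_ge hσ hκ
  obtain ⟨C₂, hC₂, h₂, hh₂, hpoin⟩ : ∃ C' > 0, ∃ h₂ > 0, IsConnected Γ →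
      ∀ (δ₀ σ h : ℝ) (Ω : Set (Euc (d + c))) (𝒯 𝒦 : Finset (Finset (Euc (d + c)))),
      IsFineMesh d Γ C₀ r δ₀ σ κ h Ω 𝒯 𝒦 → h ≤ h₂ →
      ∀ (v : Euc (d + c) → ℝ) (g : Finset (Euc (d + c)) → ℝ), ContinuousOn v (carrier 𝒦) →
      (∀ K ∈ 𝒦, 0 ≤ g K) →
      (∀ K ∈ 𝒦, ∀ y ∈ simplex K, ∀ y' ∈ simplex K, |v y - v y'| ≤ g K * ‖y - y'‖) →
      ∃ a : ℝ, ∫ y in carrier 𝒦, (v y - a) ^ 2 ∂μHE[d] ≤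
        C' * ∑ K ∈ 𝒦, g K ^ 2 * (μHE[d] (simplex K)).toReal := by
    -- The constants are chosen before connectedness is assumed, so arbitrary ones serve when `Γ` is
    -- not connected.
    by_cases hconn : IsConnected Γ
    · obtain ⟨C', hC', h₂, hh₂, hp⟩ :=
        exists_poincare (d := d) hΓ_compact hconn hg.C_ge hg.r_pos hκ
      exact ⟨C', hC', h₂, hh₂, fun _ => hp⟩
    · exact ⟨1, one_pos, 1, one_pos, fun h => absurd h hconn⟩
  refine ⟨min (min h₁ h₂) h₃, by positivity, C₁ * (1 + C₂), by positivity, ?_⟩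
  intro α h Ω 𝒯 𝒦 hα hh hh₀ hΩ _ hthick hbg hdisc v hv
  have H := hfine h Ω 𝒯 𝒦 hh (hh₀.trans (min_le_right _ _)) hΩ hthick hbg hdisc
  have hle₁ : h ≤ h₁ := hh₀.trans ((min_le_left _ _).trans (min_le_left _ _))
  have hle₂ : h ≤ h₂ := hh₀.trans ((min_le_left _ _).trans (min_le_right _ _))
  obtain ⟨β, b, haff⟩ := hv.exists_affine
  have hvK : ContinuousOn v (carrier 𝒦) := hv.1.mono H.carrier_subset
  rw [normalGradStab_eq (hbg.conforming.subset activeMesh_subset) haff]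
  set S := ∑ T ∈ activeMesh 𝒯 (carrier 𝒦),
    ∫ x in simplex T, ‖discreteNormalProjExt Γ 𝒦 x (b T)‖ ^ 2 with hS
  have hS0 : 0 ≤ S := Finset.sum_nonneg fun T _ => integral_nonneg fun x => sq_nonneg _
  have hstab0 : 0 ≤ h ^ (α - c) * S := mul_nonneg (Real.rpow_nonneg hh.le _) hS0
  -- Subtracting a constant leaves the gradients unchanged, so the stabilization term is the same
  -- for all `l`. Both inequalities follow, with `l = 0` and with `l` the average.
  have key : ∀ l : ℝ, h ^ (-(c : ℝ)) *
      meshNormSq volume (activeMesh 𝒯 (carrier 𝒦)) (fun x => v x - l) ≤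
        C₁ * ((∫ y in carrier 𝒦, (v y - l) ^ 2 ∂μHE[d]) + h ^ (α - c) * S) := fun l =>
    rpow_mul_le_of_le hα.2 hh H.h_le_one hC₁.le hS0
      (hmesh Γ r δ₀ h Ω 𝒯 𝒦 H hle₁ (fun x => v x - l) (fun T => β T - l) b
        (hv.1.sub continuousOn_const) fun T hT x hx => by rw [haff T hT x hx]; ring)
  constructor
  · have h1 := key 0
    simp only [sub_zero] at h1
    have h2 : meshNormSq μHE[d] 𝒦 v = ∫ y in carrier 𝒦, v y ^ 2 ∂μHE[d] :=
      meshIntegral_eq_integral_carrier H.disc.conforming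
        (integrableOn_carrier H.disc.conforming (hvK.pow 2))
    rw [h2]
    refine h1.trans ?_
    have hI0 : 0 ≤ ∫ y in carrier 𝒦, v y ^ 2 ∂μHE[d] := integral_nonneg fun y => sq_nonneg _
    gcongr
    exact le_mul_of_one_le_right hC₁.le (by linarith)
  · intro hconn
    have hTK : ∀ K ∈ 𝒦, ∃ T ∈ activeMesh 𝒯 (carrier 𝒦), simplex K ⊆ simplex T := by
      intro K hK
      obtain ⟨T, hT, hKT⟩ := hdisc.compatible K hK
      obtain ⟨y, hy⟩ : (simplex K).Nonempty := by
        rw [simplex, convexHull_nonempty_iff, Finset.coe_nonempty, ← Finset.card_pos,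
          hdisc.conforming.card_eq K hK]
        omega
      exact ⟨T, mem_activeMesh.2 ⟨hT, y, hKT hy, simplex_subset_carrier hK hy⟩, hKT⟩
    choose! T hT hKT using hTK
    set g : Finset (Euc (d + c)) → ℝ := fun K => ‖discreteTangentialProj K (b (T K))‖ with hgdef
    have haffK : ∀ K ∈ 𝒦, ∀ y ∈ simplex K, v y = β (T K) + inner ℝ (b (T K)) y :=
      fun K hK y hy => haff _ (hT K hK) y (hKT K hK hy)
    obtain ⟨a, ha⟩ := hpoin hconn δ₀ σ h Ω 𝒯 𝒦 H hle₂ v g hvK (fun K _ => norm_nonneg _)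
      fun K hK y hy y' hy' => by
        rw [haffK K hK y hy, haffK K hK y' hy', add_sub_add_left_eq_sub]
        exact abs_affine_sub_le_of_mem_simplex _ hy hy'
    have hgrad : surfaceGradNormSq d 𝒦 v =
        ∑ K ∈ 𝒦, g K ^ 2 * (μHE[d] (simplex K)).toReal := by
      rw [surfaceGradNormSq, meshIntegral]
      refine Finset.sum_congr rfl fun K hK => ?_
      have e : ∫ x in simplex K, ‖discreteTangentialProj K (gradientWithin v (simplex K) x)‖ ^ 2
          ∂μHE[d] = ∫ _ in simplex K, g K ^ 2 ∂μHE[d] :=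
        setIntegral_congr_fun (isClosed_simplex K).measurableSet fun x hx => by
          simp only [hgdef]
          rw [discreteTangentialProj_gradientWithin (haffK K hK) hx]
      rw [e, setIntegral_const, smul_eq_mul, Measure.real, mul_comm]
    have havg : surfaceAverage d 𝒦 v =
        (∫ y in carrier 𝒦, v y ∂μHE[d]) / (μHE[d] (carrier 𝒦)).toReal := by
      rw [surfaceAverage, meshIntegral_eq_integral_carrier H.disc.conforming
        (integrableOn_carrier H.disc.conforming hvK),
        meshIntegral_eq_integral_carrier (f := fun _ => 1) H.disc.conforming
          (integrableOn_carrier H.disc.conforming continuousOn_const), setIntegral_const,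
        smul_eq_mul, mul_one, Measure.real]
    -- The Poincaré inequality holds with some constant `a`; the average of `v` does at least as
    -- well.
    have hmin := setIntegral_sub_average_sq_le
      (euclideanHausdorffMeasure_carrier_lt_top H.disc.conforming)
      (integrableOn_carrier H.disc.conforming hvK)
      (integrableOn_carrier H.disc.conforming (hvK.pow 2)) a
    rw [← havg] at hmin
    refine (key _).trans ?_
    rw [mul_assoc]
    refine mul_le_mul_of_nonneg_left ?_ hC₁.le
    rw [← hgrad] at ha
    have hG0 : 0 ≤ surfaceGradNormSq d 𝒦 v := by
      rw [hgrad]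
      exact Finset.sum_nonneg fun K _ => by positivity
    have := mul_nonneg hC₂.le hstab0
    linarith
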